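/- Let $k$ be a field and let $\Lambda$ be a basic finite-dimensional $k$-algebra with a complete set $e_1,\dots,e_n$ of primitive pairwise orthogonal idempotents (basic means that the indecomposable projective right modules $e_1\Lambda,\dots,e_n\Lambda$ are pairwise non-isomorphic). Let $J\subseteq\{1,\dots,n\}$ be non-empty and $e_J=\sum_{j\in J}e_j$. All modules are finite-dimensional right modules. For a finite-dimensional algebra $A$ we use the following notions. * A $\tau$-rigid pair is a pair $(M,P)$ of an $A$-module $M$ and a projective $A$-module $P$ with $\operatorname{Hom}_A(M,\tau M)=0$ and $\operatorname{Hom}_A(P,M)=0$, where $\tau$ is the Auslander–Reiten translation. The support $\tau$-tilting complex $s\tau\mathcal C(A)$ is the simplicial complex whose vertices are the isomorphism classes of indecomposable $\tau$-rigid pairs and whose faces are the finite sets of such pairs whose (componentwise) direct sum is a $\tau$-rigid pair. * A 2-term object is a complex $P_1\to P_0$ of projective $A$-modules, regarded as an object of the homotopy category $K^b(\operatorname{proj}A)$; it is rigid if $\operatorname{Hom}_{K^b}(X,X[1])=0$. The 2-term silting complex $\mathcal{SC}(A)$ is the simplicial complex whose vertices are the isomorphism classes of indecomposable rigid 2-term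 objects and whose faces are the finite sets of such objects whose direct sum is rigid. * The dual graph (exchange graph) of a simplicial complex has the maximal faces as vertices, two of them being joined by an edge when they differ by exactly one vertex. The $\mathbf g$-vector of a 2-term object $\bigoplus_i (e_i\Lambda)^{b_i}\to\bigoplus_i (e_i\Lambda)^{a_i}$ over $\Lambda$ is $(a_i-b_i)_{i}\in\mathbb Z^n$; the $\mathbf g$-vector of a pair $(M,P)$ is that of $(P_1^M\to P_0^M)\oplus(P\to 0)$, where $P_1^M\to P_0^M$ is a minimal projective presentation of $M$. Then: 1. $s\tau\mathcal C(e_J\Lambda e_J)$ is isomorphic to the subcomplex of $s\tau\mathcal C(\Lambda)$ induced by the vertices whose $\mathbf g$-vectors vanish outside $J$, and the dual graphs of these two complexes are isomorphic. 2. $\mathcal{SC}(e_J\Lambda e_J)$ is isomorphic to the subcomplex $\mathcal{SC}_J(\Lambda)$ of $\mathcal{SC}(\Lambda)$ induced by the vertices whose $\mathbf g$-vectors vanish outside $J$, and the dual graphs of these two complexes are isomorphic. Moreover, these vertices are exactly the ones that are isomorphic in $K^b(\operatorname{proj}\Lambda)$ to a 2-term object $P_1\to P_0$ such that $P_1$ and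 $P_0$ are direct sums of modules $e_j\Lambda$ with $j\in J$. -/

import Mathlib

open CategoryTheory Limits MulOpposite

universe u v

noncomputable section

namespace AbstractSimplicialComplex

variable {V W : Type*}

/-- Two simplicial complexes are isomorphic: a bijection of the vertices which identifies the
faces. -/
def Isomorphic (K : AbstractSimplicialComplex V) (L : AbstractSimplicialComplex W) : Prop :=
  ∃ φ : V ≃ W, ∀ s : Finset V, s ∈ K.faces ↔ s.map φ.toEmbedding ∈ L.faces

/-- The subcomplex induced by a set `S` of vertices: all faces with vertices in `S`. -/
def induced (K : AbstractSimplicialComplex V) (S : Set V) : AbstractSimplicialComplex S where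
  faces := {s | s.map (Function.Embedding.subtype (· ∈ S)) ∈ K.faces}
  isRelLowerSet_faces := by
    intro s hs
    refine ⟨by simpa using (K.isRelLowerSet_faces hs).1, fun t hts ht => ?_⟩
    exact (K.isRelLowerSet_faces hs).2 (Finset.map_subset_map.2 hts) (by simpa using ht)
  singleton_mem x := by simpa using K.singleton_mem x.1

open Classical in
/-- The dual graph: its vertices are the maximal faces, and two of them are joined by an edge
when they differ by exactly one vertex. -/
def dualGraph (K : AbstractSimplicialComplex V) :
    SimpleGraph {F : Finset V // Maximal (· ∈ K.faces) F} where
  Adj F G := (F.1 \ G.1).card = 1 ∧ (G.1 \ F.1).card = 1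
  symm := ⟨fun _ _ h => ⟨h.2, h.1⟩⟩
  loopless := ⟨fun F h => by simp at h⟩

end AbstractSimplicialComplex

namespace SiltingCorner

/-! ### Idempotents and corner algebras -/

/-- A nonzero idempotent which is not a sum of two nonzero orthogonal idempotents. -/
structure IsPrimitiveIdempotent {Λ : Type v} [Ring Λ] (e : Λ) : Prop where
  idem : IsIdempotentElem e
  ne_zero : e ≠ 0
  eq_zero_or : ∀ f g : Λ, IsIdempotentElem f → IsIdempotentElem g → f * g = 0 → g * f = 0 →
    f + g = e → f = 0 ∨ g = 0

/-- The right ideal `e Λ`. Right `Λ`-modules are modules over `Λᵐᵒᵖ`. -/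
abbrev rightIdeal {Λ : Type v} [Ring Λ] (e : Λ) : Submodule Λᵐᵒᵖ Λ :=
  Submodule.span Λᵐᵒᵖ {e}

/-- `e 0, …, e (n-1)` is a complete set of primitive pairwise orthogonal idempotents of `Λ`, and
`Λ` is basic: the indecomposable projective modules `e i Λ` are pairwise non-isomorphic. -/
structure IsBasicSystem {Λ : Type v} [Ring Λ] {n : ℕ} (e : Fin n → Λ) : Prop where
  complete : CompleteOrthogonalIdempotents e
  primitive : ∀ i, IsPrimitiveIdempotent (e i)
  basic : ∀ i j, Nonempty (rightIdeal (e i) ≃ₗ[Λᵐᵒᵖ] rightIdeal (e j)) → i = j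

section Corner

variable {k : Type u} [Field k] {Λ : Type v} [Ring Λ] [Algebra k Λ] {e : Λ}

instance cornerSMul (he : IsIdempotentElem e) : SMul k he.Corner where
  smul c x := ⟨c • x.1, by
    have hx := (Subsemigroup.mem_corner_iff he).1 x.2
    exact (Subsemigroup.mem_corner_iff he).2
      ⟨by rw [mul_smul_comm, hx.1], by rw [smul_mul_assoc, hx.2]⟩⟩

instance cornerModule (he : IsIdempotentElem e) : Module k he.Corner :=
  Function.Injective.module k
    ({ toFun := fun x => x.1, map_zero' := rfl, map_add' := fun _ _ => rfl } : he.Corner →+ Λ)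
    Subtype.val_injective (fun _ _ => rfl)

/-- The `k`-algebra structure of the corner `e Λ e`; its ring structure is Mathlib's. -/
instance cornerAlgebra (he : IsIdempotentElem e) : Algebra k he.Corner :=
  Algebra.ofModule (fun c x y => Subtype.ext (smul_mul_assoc c x.1 y.1))
    (fun c x y => Subtype.ext (mul_smul_comm c x.1 y.1))

instance cornerFinite [Module.Finite k Λ] (he : IsIdempotentElem e) :
    Module.Finite k he.Corner :=
  Module.Finite.of_injective
    ({ toFun := fun x => x.1, map_add' := fun _ _ => rfl, map_smul' := fun _ _ => rfl } :
      he.Corner →ₗ[k] Λ) Subtype.val_injective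

end Corner

/-- The corner algebra `e_J Λ e_J`, where `e_J = ∑ j ∈ J, e j`. -/
abbrev CornerAlgebra {Λ : Type v} [Ring Λ] {n : ℕ} {e : Fin n → Λ}
    (he : OrthogonalIdempotents e) (J : Finset (Fin n)) : Type v :=
  (he.isIdempotentElem_sum (s := J)).Corner

/-! ### Finite direct sums -/

section Sums

variable {R : Type*} [Ring R] {m l : ℕ}

/-- The projection of a direct sum to a part of the summands. -/
def piRes (A : Fin m → Type*) [∀ i, AddCommGroup (A i)] [∀ i, Module R (A i)]
    (σ : Fin l → Fin m) : (∀ i, A i) →ₗ[R] (∀ i, A (σ i)) :=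
  LinearMap.pi fun i => LinearMap.proj (σ i)

/-- The inclusion of a part of the summands into a direct sum. -/
def piExt (A : Fin m → Type*) [∀ i, AddCommGroup (A i)] [∀ i, Module R (A i)]
    (σ : Fin l → Fin m) : (∀ i, A (σ i)) →ₗ[R] (∀ i, A i) :=
  ∑ i, LinearMap.single R A (σ i) ∘ₗ LinearMap.proj i

lemma piRes_piExt (A : Fin m → Type*) [∀ i, AddCommGroup (A i)] [∀ i, Module R (A i)]
    {σ : Fin l → Fin m} (hσ : Function.Injective σ) :
    piRes A σ ∘ₗ piExt A σ = (LinearMap.id : (∀ i, A (σ i)) →ₗ[R] _) := by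
  refine LinearMap.ext fun x => funext fun i => ?_
  simp only [piRes, piExt, LinearMap.comp_apply, LinearMap.pi_apply, LinearMap.proj_apply,
    LinearMap.sum_apply, Finset.sum_apply, LinearMap.single_apply, LinearMap.id_apply]
  rw [Finset.sum_eq_single i]
  · simp
  · intro j _ hj
    exact Pi.single_eq_of_ne (fun h => hj (hσ h).symm) _
  · simp

lemma piExt_map {A B : Fin m → Type*} [∀ i, AddCommGroup (A i)] [∀ i, Module R (A i)]
    [∀ i, AddCommGroup (B i)] [∀ i, Module R (B i)] (d : ∀ i, A i →ₗ[R] B i)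
    (σ : Fin l → Fin m) (x : ∀ i, A (σ i)) (j : Fin m) :
    d j (piExt (R := R) A σ x j) = piExt (R := R) B σ (fun i => d (σ i) (x i)) j := by
  simp only [piExt, LinearMap.comp_apply, LinearMap.proj_apply, LinearMap.sum_apply,
    Finset.sum_apply, LinearMap.single_apply, map_sum]
  exact Finset.sum_congr rfl fun i _ =>
    (Pi.apply_single (fun j => d j) (fun j => map_zero (d j)) (σ i) (x i) j)

/-- For `G ⊆ F`, the inclusion in terms of the enumerations of `G` and `F`. -/
def subIndex {V : Type*} {F G : Finset V} (h : G ⊆ F) (i : Fin G.card) : Fin F.card :=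
  F.equivFin ⟨(G.equivFin.symm i).1, h (G.equivFin.symm i).2⟩

lemma equivFin_symm_subIndex {V : Type*} {F G : Finset V} (h : G ⊆ F) (i : Fin G.card) :
    (F.equivFin.symm (subIndex h i)).1 = (G.equivFin.symm i).1 := by
  simp [subIndex]

lemma subIndex_injective {V : Type*} {F G : Finset V} (h : G ⊆ F) :
    Function.Injective (subIndex h) := by
  intro i j hij
  have := congrArg (fun a => (F.equivFin.symm a).1) hij
  simp only [equivFin_symm_subIndex] at this
  exact G.equivFin.symm.injective (Subtype.ext this)

end Sums

/-! ### 2-term objects of `K^b(proj Λ)` -/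

section TwoTerm

variable (Λ : Type v) [Ring Λ]

/-- The property of being a finitely generated projective right `Λ`-module. -/
def isProj : ObjectProperty (ModuleCat.{v} Λᵐᵒᵖ) :=
  fun M => Module.Finite Λᵐᵒᵖ M ∧ Module.Projective Λᵐᵒᵖ M

/-- The category `proj Λ`. -/
abbrev ProjCat := (isProj Λ).FullSubcategory

instance : (isProj Λ).ContainsZero where
  exists_zero := ⟨ModuleCat.of Λᵐᵒᵖ PUnit.{v + 1}, ModuleCat.isZero_of_subsingleton _,
    inferInstanceAs (Module.Finite Λᵐᵒᵖ PUnit.{v + 1}),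
    inferInstanceAs (Module.Projective Λᵐᵒᵖ PUnit.{v + 1})⟩

instance (P : ProjCat Λ) : Module.Finite Λᵐᵒᵖ P.obj := P.property.1

instance (P : ProjCat Λ) : Module.Projective Λᵐᵒᵖ P.obj := P.property.2

/-- The homotopy category of complexes in `proj Λ`; it contains `K^b(proj Λ)` as a full
subcategory. -/
abbrev KProj := HomotopyCategory (ProjCat Λ) (ComplexShape.up ℤ)

/-- A 2-term object `P₁ ⟶ P₀`. -/
structure TwoTerm where
  P₁ : ProjCat Λ
  P₀ : ProjCat Λ
  d : P₁.obj →ₗ[Λᵐᵒᵖ] P₀.obj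

variable {Λ}

/-- The finite direct sum in `proj Λ`. -/
def ProjCat.sum {m : ℕ} (P : Fin m → ProjCat Λ) : ProjCat Λ where
  obj := ModuleCat.of Λᵐᵒᵖ (∀ i, (P i).obj)
  property := ⟨inferInstanceAs (Module.Finite Λᵐᵒᵖ (∀ i, (P i).obj)),
    Module.Projective.of_equiv (DFinsupp.linearEquivFunOnFintype (R := Λᵐᵒᵖ)
      (M := fun i => (P i).obj))⟩

namespace TwoTerm

lemma rel : (ComplexShape.up ℤ).Rel (-1) 0 := by simp

/-- The cochain complex `⋯ ⟶ 0 ⟶ P₁ ⟶ P₀ ⟶ 0 ⟶ ⋯` with `P₀` in degree `0` and `P₁` in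
(cohomological) degree `-1`. -/
abbrev complex (X : TwoTerm Λ) : HomologicalComplex (ProjCat Λ) (ComplexShape.up ℤ) :=
  HomologicalComplex.double
    (ObjectProperty.homMk (ModuleCat.ofHom X.d) : X.P₁ ⟶ X.P₀) rel

/-- The 2-term object in the homotopy category. -/
abbrev toK (X : TwoTerm Λ) : KProj Λ :=
  (HomotopyCategory.quotient (ProjCat Λ) (ComplexShape.up ℤ)).obj X.complex

/-- Isomorphism of 2-term objects, in the homotopy category. -/
def IsIsomorphic (X Y : TwoTerm Λ) : Prop := Nonempty (X.toK ≅ Y.toK)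

/-- `X` is rigid: `Hom(X, X[1]) = 0` in the homotopy category. -/
def IsRigid (X : TwoTerm Λ) : Prop := ∀ f : X.toK ⟶ X.toK⟦(1 : ℤ)⟧, f = 0

/-- The direct sum of finitely many 2-term objects. -/
def sum {m : ℕ} (X : Fin m → TwoTerm Λ) : TwoTerm Λ where
  P₁ := ProjCat.sum fun i => (X i).P₁
  P₀ := ProjCat.sum fun i => (X i).P₀
  d := LinearMap.pi fun i => (X i).d ∘ₗ LinearMap.proj i

/-- `X` is indecomposable as an object of the category of 2-term objects. -/
def IsIndecomposable (X : TwoTerm Λ) : Prop :=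
  ¬ IsZero X.toK ∧ ∀ Y Z : TwoTerm Λ, X.IsIsomorphic (sum ![Y, Z]) →
    IsZero Y.toK ∨ IsZero Z.toK

/-- The map of complexes given by a commutative square. -/
def complexMap {X Y : TwoTerm Λ} (a₁ : X.P₁.obj →ₗ[Λᵐᵒᵖ] Y.P₁.obj)
    (a₀ : X.P₀.obj →ₗ[Λᵐᵒᵖ] Y.P₀.obj) (h : Y.d ∘ₗ a₁ = a₀ ∘ₗ X.d) : X.complex ⟶ Y.complex :=
  HomologicalComplex.mkHomFromDouble rel (by simp)
    ((ObjectProperty.homMk (ModuleCat.ofHom a₁) : X.P₁ ⟶ Y.P₁) ≫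
      (HomologicalComplex.doubleXIso₀ _ rel).inv)
    ((ObjectProperty.homMk (ModuleCat.ofHom a₀) : X.P₀ ⟶ Y.P₀) ≫
      (HomologicalComplex.doubleXIso₁ _ rel (by simp)).inv)
    (by
      have h' : (ObjectProperty.homMk (ModuleCat.ofHom a₁) : X.P₁ ⟶ Y.P₁) ≫
          (ObjectProperty.homMk (ModuleCat.ofHom Y.d) : Y.P₁ ⟶ Y.P₀) =
          (ObjectProperty.homMk (ModuleCat.ofHom X.d) : X.P₁ ⟶ X.P₀) ≫
          (ObjectProperty.homMk (ModuleCat.ofHom a₀) : X.P₀ ⟶ Y.P₀) := by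
        ext x
        exact LinearMap.congr_fun h x
      simp only [HomologicalComplex.double_d _ rel (show (-1 : ℤ) ≠ 0 by simp),
        Category.assoc, Iso.inv_hom_id_assoc]
      rw [← Category.assoc, h', Category.assoc])
    (fun j _ => by
      rw [HomologicalComplex.double_d_eq_zero₀ _ _ _ _ (by simp), comp_zero])

lemma complexMap_comp {X Y : TwoTerm Λ} {a₁ : X.P₁.obj →ₗ[Λᵐᵒᵖ] Y.P₁.obj}
    {a₀ : X.P₀.obj →ₗ[Λᵐᵒᵖ] Y.P₀.obj} (h : Y.d ∘ₗ a₁ = a₀ ∘ₗ X.d)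
    {b₁ : Y.P₁.obj →ₗ[Λᵐᵒᵖ] X.P₁.obj} {b₀ : Y.P₀.obj →ₗ[Λᵐᵒᵖ] X.P₀.obj}
    (h' : X.d ∘ₗ b₁ = b₀ ∘ₗ Y.d) (h₁ : b₁ ∘ₗ a₁ = LinearMap.id)
    (h₀ : b₀ ∘ₗ a₀ = LinearMap.id) :
    complexMap a₁ a₀ h ≫ complexMap b₁ b₀ h' = 𝟙 _ := by
  have e₁ : (ObjectProperty.homMk (ModuleCat.ofHom a₁) : X.P₁ ⟶ Y.P₁) ≫
      (ObjectProperty.homMk (ModuleCat.ofHom b₁) : Y.P₁ ⟶ X.P₁) = 𝟙 _ := by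
    ext x
    exact LinearMap.congr_fun h₁ x
  have e₀ : (ObjectProperty.homMk (ModuleCat.ofHom a₀) : X.P₀ ⟶ Y.P₀) ≫
      (ObjectProperty.homMk (ModuleCat.ofHom b₀) : Y.P₀ ⟶ X.P₀) = 𝟙 _ := by
    ext x
    exact LinearMap.congr_fun h₀ x
  apply HomologicalComplex.from_double_hom_ext
  · simp [complexMap, reassoc_of% e₁]
  · simp [complexMap, reassoc_of% e₀]

lemma IsRigid.of_retract {X Y : TwoTerm Λ} (hY : Y.IsRigid)
    (a₁ : X.P₁.obj →ₗ[Λᵐᵒᵖ] Y.P₁.obj) (a₀ : X.P₀.obj →ₗ[Λᵐᵒᵖ] Y.P₀.obj)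
    (h : Y.d ∘ₗ a₁ = a₀ ∘ₗ X.d)
    (b₁ : Y.P₁.obj →ₗ[Λᵐᵒᵖ] X.P₁.obj) (b₀ : Y.P₀.obj →ₗ[Λᵐᵒᵖ] X.P₀.obj)
    (h' : X.d ∘ₗ b₁ = b₀ ∘ₗ Y.d) (h₁ : b₁ ∘ₗ a₁ = LinearMap.id)
    (h₀ : b₀ ∘ₗ a₀ = LinearMap.id) : X.IsRigid := by
  intro f
  let i : X.toK ⟶ Y.toK := (HomotopyCategory.quotient _ _).map (complexMap a₁ a₀ h)
  let r : Y.toK ⟶ X.toK := (HomotopyCategory.quotient _ _).map (complexMap b₁ b₀ h')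
  have hir : i ≫ r = 𝟙 _ := by
    simp only [i, r]
    rw [← Functor.map_comp, complexMap_comp h h' h₁ h₀, CategoryTheory.Functor.map_id]
  have key := hY (r ≫ f ≫ i⟦(1 : ℤ)⟧')
  calc f = (i ≫ r) ≫ f ≫ (i ≫ r)⟦(1 : ℤ)⟧' := by simp [hir]
    _ = i ≫ (r ≫ f ≫ i⟦(1 : ℤ)⟧') ≫ r⟦(1 : ℤ)⟧' := by simp
    _ = 0 := by rw [key]; simp

lemma IsRigid.sum_comp {m l : ℕ} (X : Fin m → TwoTerm Λ) (hX : (sum X).IsRigid)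
    (σ : Fin l → Fin m) (hσ : Function.Injective σ) : (sum fun i => X (σ i)).IsRigid := by
  refine hX.of_retract (piExt (fun i => (X i).P₁.obj) σ) (piExt (fun i => (X i).P₀.obj) σ) ?_
    (piRes (fun i => (X i).P₁.obj) σ) (piRes (fun i => (X i).P₀.obj) σ) rfl
    (piRes_piExt (fun i => (X i).P₁.obj) hσ) (piRes_piExt (fun i => (X i).P₀.obj) hσ)
  refine LinearMap.ext fun x => funext fun j => ?_
  exact (piExt_map (fun i => (X i).d) σ x j)

end TwoTerm

variable (Λ) in
/-- Isomorphism of indecomposable rigid 2-term objects. -/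
def rigidSetoid : Setoid {X : TwoTerm Λ // X.IsIndecomposable ∧ X.IsRigid} where
  r X Y := X.1.IsIsomorphic Y.1
  iseqv := ⟨fun _ => ⟨Iso.refl _⟩, fun ⟨f⟩ => ⟨f.symm⟩, fun ⟨f⟩ ⟨g⟩ => ⟨f ≪≫ g⟩⟩

variable (Λ) in
/-- The isomorphism classes of indecomposable rigid 2-term objects. -/
def SiltingVertex := Quotient (rigidSetoid Λ)

/-- A representative of an isomorphism class. -/
def SiltingVertex.rep (x : SiltingVertex Λ) : TwoTerm Λ :=
  (Quotient.out (s := rigidSetoid Λ) x).1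

variable (Λ) in
/-- The 2-term silting complex of `Λ`: its vertices are the isomorphism classes of indecomposable
rigid 2-term objects and its faces are the sets of such objects whose direct sum is rigid. -/
def siltingComplex : AbstractSimplicialComplex (SiltingVertex Λ) where
  faces := {F | F.Nonempty ∧
    (TwoTerm.sum fun i : Fin F.card => (F.equivFin.symm i).1.rep).IsRigid}
  isRelLowerSet_faces := by
    rintro F ⟨hF, hr⟩
    refine ⟨hF, fun G hGF hG => ⟨hG, ?_⟩⟩
    have := TwoTerm.IsRigid.sum_comp _ hr (subIndex hGF) (subIndex_injective hGF)
    simpa only [equivFin_symm_subIndex] using this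
  singleton_mem x := by
    refine ⟨Finset.singleton_nonempty x, ?_⟩
    have h := (Quotient.out (s := rigidSetoid Λ) x).2.2
    have hx : ∀ i, (({x} : Finset (SiltingVertex Λ)).equivFin.symm i).1 = x := fun i =>
      Finset.mem_singleton.1 (({x} : Finset (SiltingVertex Λ)).equivFin.symm i).2
    simp only [hx]
    let i₀ : Fin (Finset.card {x}) := ⟨0, by simp⟩
    have hi : ∀ i : Fin (Finset.card {x}), i = i₀ := fun i => by
      have := i.2
      simp only [Finset.card_singleton] at this
      exact Fin.ext (by simp [i₀]; omega)
    refine TwoTerm.IsRigid.of_retract (Y := x.rep) h (LinearMap.proj i₀) (LinearMap.proj i₀) rfl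
      (LinearMap.pi fun _ => LinearMap.id) (LinearMap.pi fun _ => LinearMap.id) rfl ?_ ?_
    · exact LinearMap.ext fun y => funext fun i => by rw [hi i]; rfl
    · exact LinearMap.ext fun y => funext fun i => by rw [hi i]; rfl

end TwoTerm

/-! ### `τ`-rigid pairs -/

section Tau

variable {Λ : Type v} [Ring Λ]

/-- `N` is a superfluous submodule. -/
def IsSuperfluous {R M : Type*} [Ring R] [AddCommGroup M] [Module R M] (N : Submodule R M) :
    Prop :=
  ∀ L : Submodule R M, N ⊔ L = ⊤ → L = ⊤

/-- `P₁ ⟶ P₀ ⟶ M ⟶ 0` is a minimal projective presentation of `M`: it is exact, and both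
`P₀ ⟶ M` and `P₁ ⟶ ker π` are projective covers. -/
structure IsMinimalPresentation (X : TwoTerm Λ) {M : Type*} [AddCommGroup M] [Module Λᵐᵒᵖ M]
    (π : X.P₀.obj →ₗ[Λᵐᵒᵖ] M) : Prop where
  surjective : Function.Surjective π
  exact : LinearMap.range X.d = LinearMap.ker π
  superfluous₀ : IsSuperfluous (LinearMap.ker π)
  superfluous₁ : IsSuperfluous (LinearMap.ker X.d)

/-- The map of left `Λ`-modules `Hom(P₀, Λ) ⟶ Hom(P₁, Λ)` induced by `P₁ ⟶ P₀`. -/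
def TwoTerm.dStar (X : TwoTerm Λ) :
    (X.P₀.obj →ₗ[Λᵐᵒᵖ] Λ) →ₗ[Λ] (X.P₁.obj →ₗ[Λᵐᵒᵖ] Λ) where
  toFun g := g ∘ₗ X.d
  map_add' _ _ := rfl
  map_smul' _ _ := rfl

/-- The left `Λ`-module `coker (Hom(P₀, Λ) ⟶ Hom(P₁, Λ))`. If `P₁ ⟶ P₀` is a minimal
projective presentation of `M` then this is the transpose of `M`. -/
abbrev TwoTerm.Tr (X : TwoTerm Λ) := (X.P₁.obj →ₗ[Λᵐᵒᵖ] Λ) ⧸ LinearMap.range X.dStar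

variable (k : Type u) [Field k] [Algebra k Λ]

/-- The `k`-dual of the transpose. If `P₁ ⟶ P₀` is a minimal projective presentation of `M` then
this is the Auslander–Reiten translate of `M`. -/
def TwoTerm.Tau (X : TwoTerm Λ) := X.Tr →ₗ[k] k

instance (X : TwoTerm Λ) : AddCommGroup (X.Tau k) :=
  inferInstanceAs (AddCommGroup (X.Tr →ₗ[k] k))

/-- The right `Λ`-module structure `(φ a)(x) = φ (a x)` on the `k`-dual of a left module. -/
instance (X : TwoTerm Λ) : Module Λᵐᵒᵖ (X.Tau k) where
  smul a φ := (show X.Tr →ₗ[k] k from φ) ∘ₗ Algebra.lsmul k k X.Tr a.unop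
  one_smul φ := LinearMap.ext fun x => congrArg (show X.Tr →ₗ[k] k from φ) (one_smul Λ x)
  mul_smul a b φ := LinearMap.ext fun x =>
    congrArg (show X.Tr →ₗ[k] k from φ) (mul_smul b.unop a.unop x)
  smul_zero _ := rfl
  smul_add _ _ _ := rfl
  add_smul a b φ := LinearMap.ext fun x =>
    (congrArg (show X.Tr →ₗ[k] k from φ) (add_smul a.unop b.unop x)).trans (map_add _ _ _)
  zero_smul φ := LinearMap.ext fun x =>
    (congrArg (show X.Tr →ₗ[k] k from φ) (zero_smul Λ x)).trans (map_zero _)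

/-- `M` is `τ`-rigid: `Hom(M, τ M) = 0`. -/
def IsTauRigid (M : Type v) [AddCommGroup M] [Module Λᵐᵒᵖ M] : Prop :=
  ∃ (X : TwoTerm Λ) (π : X.P₀.obj →ₗ[Λᵐᵒᵖ] M), IsMinimalPresentation X π ∧
    ∀ f : M →ₗ[Λᵐᵒᵖ] X.Tau k, f = 0

lemma isArtinianRing_op [Module.Finite k Λ] : IsArtinianRing Λᵐᵒᵖ :=
  have : Module.Finite k Λᵐᵒᵖ := Module.Finite.equiv (MulOpposite.opLinearEquiv k : Λ ≃ₗ[k] Λᵐᵒᵖ)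
  IsArtinianRing.of_finite k Λᵐᵒᵖ

lemma exists_cover [IsArtinianRing Λᵐᵒᵖ] {M : Type v} [AddCommGroup M] [Module Λᵐᵒᵖ M]
    [Module.Finite Λᵐᵒᵖ M] :
    ∃ (Q : ProjCat Λ) (ρ : Q.obj →ₗ[Λᵐᵒᵖ] M), Function.Surjective ρ ∧
      IsSuperfluous (LinearMap.ker ρ) := by
  obtain ⟨n, π, hπ⟩ := Module.Finite.exists_fin' Λᵐᵒᵖ M
  obtain ⟨L, hL⟩ := (wellFounded_lt (α := Submodule Λᵐᵒᵖ (Fin n → Λᵐᵒᵖ))).has_min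
    {L | L.map π = ⊤} ⟨⊤, show Submodule.map π ⊤ = ⊤ by
      rw [Submodule.map_top, LinearMap.range_eq_top.2 hπ]⟩
  obtain ⟨hL1, hL2⟩ := hL
  have hmin : ∀ N : Submodule Λᵐᵒᵖ (Fin n → Λᵐᵒᵖ), N ≤ L → N.map π = ⊤ → N = L :=
    fun N hN hN' => by
      by_contra hne
      exact hL2 N hN' (lt_of_le_of_ne hN hne)
  have hs : Function.Surjective (π ∘ₗ L.subtype) := by
    rw [← LinearMap.range_eq_top, LinearMap.range_comp, Submodule.range_subtype, hL1]
  have hsub : ∀ K : Submodule Λᵐᵒᵖ L, K.map (π ∘ₗ L.subtype) = ⊤ → K = ⊤ := by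
    intro K hK
    rw [Submodule.map_comp] at hK
    have h := hmin _ (Submodule.map_subtype_le L K) hK
    apply Submodule.map_injective_of_injective L.injective_subtype
    rw [h, Submodule.map_top, Submodule.range_subtype]
  obtain ⟨g, hg⟩ := Module.projective_lifting_property (π ∘ₗ L.subtype) π hs
  have hgs : Function.Surjective (g ∘ₗ L.subtype) := by
    rw [← LinearMap.range_eq_top]
    apply hsub
    rw [← LinearMap.range_comp, ← LinearMap.comp_assoc, hg, LinearMap.range_eq_top]
    exact hs
  have hb : Function.Bijective (g ∘ₗ L.subtype) :=
    ⟨IsNoetherian.injective_of_surjective_endomorphism _ hgs, hgs⟩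
  let E := LinearEquiv.ofBijective _ hb
  have hproj : Module.Projective Λᵐᵒᵖ L := by
    refine Module.Projective.of_split L.subtype (E.symm.toLinearMap ∘ₗ g) ?_
    exact LinearMap.ext fun x => E.symm_apply_apply x
  refine ⟨⟨ModuleCat.of Λᵐᵒᵖ L, inferInstanceAs (Module.Finite Λᵐᵒᵖ L), hproj⟩,
    π ∘ₗ L.subtype, hs, fun K hK => hsub K ?_⟩
  have := congrArg (Submodule.map (π ∘ₗ L.subtype)) hK
  rw [Submodule.map_sup, Submodule.map_top, LinearMap.range_eq_top.2 hs] at this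
  rw [← this, eq_comm]
  refine sup_eq_right.2 ?_
  rintro _ ⟨x, hx, rfl⟩
  rw [SetLike.mem_coe, LinearMap.mem_ker] at hx
  rw [hx]
  exact zero_mem _

/-- Finitely generated modules have minimal projective presentations. -/
lemma exists_isMinimalPresentation [IsArtinianRing Λᵐᵒᵖ] (M : Type v) [AddCommGroup M]
    [Module Λᵐᵒᵖ M] [Module.Finite Λᵐᵒᵖ M] :
    ∃ (X : TwoTerm Λ) (π : X.P₀.obj →ₗ[Λᵐᵒᵖ] M), IsMinimalPresentation X π := by
  obtain ⟨Q, ρ, hρ, hρ'⟩ := exists_cover (Λ := Λ) (M := M)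
  obtain ⟨Q', ρ', hs, hs'⟩ := exists_cover (Λ := Λ) (M := LinearMap.ker ρ)
  refine ⟨⟨Q', Q, (LinearMap.ker ρ).subtype ∘ₗ ρ'⟩, ρ, hρ, ?_, hρ', ?_⟩
  · rw [LinearMap.range_comp, LinearMap.range_eq_top.2 hs, Submodule.map_top,
      Submodule.range_subtype]
  · rwa [LinearMap.ker_comp, Submodule.ker_subtype, Submodule.comap_bot]

lemma IsMinimalPresentation.exists_lift {M N : Type v} [AddCommGroup M] [Module Λᵐᵒᵖ M]
    [AddCommGroup N] [Module Λᵐᵒᵖ N] {X Y : TwoTerm Λ} {π : X.P₀.obj →ₗ[Λᵐᵒᵖ] M}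
    {ρ : Y.P₀.obj →ₗ[Λᵐᵒᵖ] N} (hX : IsMinimalPresentation X π) (hY : IsMinimalPresentation Y ρ)
    (f : M →ₗ[Λᵐᵒᵖ] N) :
    ∃ (a₀ : X.P₀.obj →ₗ[Λᵐᵒᵖ] Y.P₀.obj) (a₁ : X.P₁.obj →ₗ[Λᵐᵒᵖ] Y.P₁.obj),
      ρ ∘ₗ a₀ = f ∘ₗ π ∧ Y.d ∘ₗ a₁ = a₀ ∘ₗ X.d := by
  obtain ⟨a₀, h₀⟩ := Module.projective_lifting_property ρ (f ∘ₗ π) hY.surjective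
  have hr : ∀ x, a₀ (X.d x) ∈ LinearMap.range Y.d := fun x => by
    have hx : X.d x ∈ LinearMap.ker π := hX.exact ▸ LinearMap.mem_range_self _ _
    rw [hY.exact, LinearMap.mem_ker, ← LinearMap.comp_apply, h₀, LinearMap.comp_apply,
      LinearMap.mem_ker.1 hx, map_zero]
  obtain ⟨a₁, h₁⟩ := Module.projective_lifting_property Y.d.rangeRestrict
    ((a₀ ∘ₗ X.d).codRestrict _ hr) Y.d.surjective_rangeRestrict
  exact ⟨a₀, a₁, h₀, LinearMap.ext fun x => congrArg Subtype.val (LinearMap.congr_fun h₁ x)⟩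

/-- An endomorphism of a minimal presentation over the identity is bijective in degree `1`. -/
lemma IsMinimalPresentation.bijective [IsArtinianRing Λᵐᵒᵖ] {M : Type v} [AddCommGroup M]
    [Module Λᵐᵒᵖ M] {X : TwoTerm Λ} {π : X.P₀.obj →ₗ[Λᵐᵒᵖ] M} (hX : IsMinimalPresentation X π)
    (c₀ : X.P₀.obj →ₗ[Λᵐᵒᵖ] X.P₀.obj) (c₁ : X.P₁.obj →ₗ[Λᵐᵒᵖ] X.P₁.obj)
    (h₀ : π ∘ₗ c₀ = π) (h₁ : X.d ∘ₗ c₁ = c₀ ∘ₗ X.d) : Function.Bijective c₁ := by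
  have h₀' : ∀ x, π (c₀ x) = π x := LinearMap.congr_fun h₀
  have h₁' : ∀ x, X.d (c₁ x) = c₀ (X.d x) := LinearMap.congr_fun h₁
  have hc₀ : Function.Surjective c₀ := by
    rw [← LinearMap.range_eq_top]
    apply hX.superfluous₀
    rw [eq_top_iff]
    intro x _
    have : x = (x - c₀ x) + c₀ x := by abel
    rw [this]
    exact Submodule.add_mem_sup (by simp [h₀']) (LinearMap.mem_range_self _ _)
  have hc₁ : Function.Surjective c₁ := by
    rw [← LinearMap.range_eq_top]
    apply hX.superfluous₁
    rw [eq_top_iff]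
    intro x _
    obtain ⟨y, hy⟩ := hc₀ (X.d x)
    have hy' : y ∈ LinearMap.range X.d := by
      rw [hX.exact, LinearMap.mem_ker, ← h₀', hy, ← LinearMap.mem_ker, ← hX.exact]
      exact LinearMap.mem_range_self _ _
    obtain ⟨z, rfl⟩ := hy'
    have : x = (x - c₁ z) + c₁ z := by abel
    rw [this]
    exact Submodule.add_mem_sup (by simp [h₁', hy]) (LinearMap.mem_range_self _ _)
  exact ⟨IsNoetherian.injective_of_surjective_endomorphism _ hc₁, hc₁⟩

/-- The map of transposes induced by a commutative square. -/
def TwoTerm.trMap {X Y : TwoTerm Λ} (a₁ : X.P₁.obj →ₗ[Λᵐᵒᵖ] Y.P₁.obj)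
    (a₀ : X.P₀.obj →ₗ[Λᵐᵒᵖ] Y.P₀.obj) (h : Y.d ∘ₗ a₁ = a₀ ∘ₗ X.d) : Y.Tr →ₗ[Λ] X.Tr :=
  Submodule.mapQ _ _
    ({ toFun := fun g => g ∘ₗ a₁, map_add' := fun _ _ => rfl, map_smul' := fun _ _ => rfl } :
      (Y.P₁.obj →ₗ[Λᵐᵒᵖ] Λ) →ₗ[Λ] (X.P₁.obj →ₗ[Λᵐᵒᵖ] Λ))
    (by
      rintro _ ⟨g, rfl⟩
      refine ⟨g ∘ₗ a₀, ?_⟩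
      simp only [TwoTerm.dStar, LinearMap.coe_mk, AddHom.coe_mk, LinearMap.comp_assoc, h])

/-- The map of translates induced by a commutative square. -/
def TwoTerm.tauMap {X Y : TwoTerm Λ} (a₁ : X.P₁.obj →ₗ[Λᵐᵒᵖ] Y.P₁.obj)
    (a₀ : X.P₀.obj →ₗ[Λᵐᵒᵖ] Y.P₀.obj) (h : Y.d ∘ₗ a₁ = a₀ ∘ₗ X.d) :
    X.Tau k →ₗ[Λᵐᵒᵖ] Y.Tau k where
  toFun φ := (show X.Tr →ₗ[k] k from φ) ∘ₗ (TwoTerm.trMap a₁ a₀ h).restrictScalars k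
  map_add' _ _ := rfl
  map_smul' a φ := LinearMap.ext fun x => congrArg (show X.Tr →ₗ[k] k from φ)
    ((TwoTerm.trMap a₁ a₀ h).map_smul a.unop x).symm

/-- A direct summand of a `τ`-rigid module is `τ`-rigid. -/
lemma IsTauRigid.of_retract [Module.Finite k Λ] {M N : Type v} [AddCommGroup M]
    [Module Λᵐᵒᵖ M] [Module.Finite Λᵐᵒᵖ M] [AddCommGroup N] [Module Λᵐᵒᵖ N]
    (hN : IsTauRigid (Λ := Λ) k N) (i : M →ₗ[Λᵐᵒᵖ] N) (r : N →ₗ[Λᵐᵒᵖ] M)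
    (hir : r ∘ₗ i = LinearMap.id) : IsTauRigid (Λ := Λ) k M := by
  have := isArtinianRing_op (Λ := Λ) k
  obtain ⟨Y, ρ, hY, hτ⟩ := hN
  obtain ⟨X, π, hX⟩ := exists_isMinimalPresentation (Λ := Λ) M
  refine ⟨X, π, hX, fun f => ?_⟩
  obtain ⟨a₀, a₁, ha₀, ha₁⟩ := hX.exists_lift hY i
  obtain ⟨b₀, b₁, hb₀, hb₁⟩ := hY.exists_lift hX r
  have hbij : Function.Bijective (b₁ ∘ₗ a₁) := by
    refine hX.bijective (b₀ ∘ₗ a₀) (b₁ ∘ₗ a₁) ?_ ?_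
    · rw [← LinearMap.comp_assoc, hb₀, LinearMap.comp_assoc, ha₀, ← LinearMap.comp_assoc, hir,
        LinearMap.id_comp]
    · rw [← LinearMap.comp_assoc, hb₁, LinearMap.comp_assoc, ha₁, LinearMap.comp_assoc]
  let E := LinearEquiv.ofBijective _ hbij
  have hsurj : Function.Surjective (TwoTerm.trMap a₁ a₀ ha₁) := by
    intro x
    obtain ⟨g, rfl⟩ := Submodule.Quotient.mk_surjective _ x
    refine ⟨Submodule.Quotient.mk (g ∘ₗ E.symm.toLinearMap ∘ₗ b₁), ?_⟩
    refine congrArg Submodule.Quotient.mk ?_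
    exact LinearMap.ext fun y => congrArg g (E.symm_apply_apply y)
  have h0 := hτ (TwoTerm.tauMap k a₁ a₀ ha₁ ∘ₗ f ∘ₗ r)
  refine LinearMap.ext fun m => LinearMap.ext fun x => ?_
  obtain ⟨y, rfl⟩ := hsurj x
  have h1 : TwoTerm.tauMap k a₁ a₀ ha₁ (f (r (i m))) = 0 := LinearMap.congr_fun h0 (i m)
  have h2 : r (i m) = m := LinearMap.congr_fun hir m
  rw [h2] at h1
  exact LinearMap.congr_fun (f := (TwoTerm.tauMap k a₁ a₀ ha₁ (f m) : Y.Tr →ₗ[k] k)) h1 y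

variable (Λ) in
/-- A pair of a finite-dimensional right module `M` and a finite-dimensional projective right
module `P` (over a finite-dimensional algebra, finite-dimensional means finitely generated). -/
structure TauPair where
  M : ModuleCat.{v} Λᵐᵒᵖ
  finite : Module.Finite Λᵐᵒᵖ M
  P : ProjCat Λ

namespace TauPair

instance (X : TauPair Λ) : Module.Finite Λᵐᵒᵖ X.M := X.finite

/-- `(M, P)` is a `τ`-rigid pair: `M` is `τ`-rigid and `Hom(P, M) = 0`. -/
def IsRigid (X : TauPair Λ) : Prop :=
  IsTauRigid (Λ := Λ) k X.M ∧ ∀ f : X.P.obj →ₗ[Λᵐᵒᵖ] X.M, f = 0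

/-- Isomorphism of pairs. -/
def IsIsomorphic (X Y : TauPair Λ) : Prop :=
  Nonempty (X.M ≃ₗ[Λᵐᵒᵖ] Y.M) ∧ Nonempty (X.P.obj ≃ₗ[Λᵐᵒᵖ] Y.P.obj)

/-- The componentwise direct sum of finitely many pairs. -/
def sum {m : ℕ} (X : Fin m → TauPair Λ) : TauPair Λ where
  M := ModuleCat.of Λᵐᵒᵖ (∀ i, (X i).M)
  finite := inferInstanceAs (Module.Finite Λᵐᵒᵖ (∀ i, (X i).M))
  P := ProjCat.sum fun i => (X i).P

/-- The pair `(0, 0)`. -/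
def IsZero (X : TauPair Λ) : Prop := Subsingleton X.M ∧ Subsingleton X.P.obj

/-- The pair is nonzero and not a direct sum of two nonzero pairs. -/
def IsIndecomposable (X : TauPair Λ) : Prop :=
  ¬ X.IsZero ∧ ∀ Y Z : TauPair Λ, X.IsIsomorphic (sum ![Y, Z]) → Y.IsZero ∨ Z.IsZero

variable {k}

lemma IsRigid.of_retract [Module.Finite k Λ] {X Y : TauPair Λ} (hY : Y.IsRigid k)
    (i : X.M →ₗ[Λᵐᵒᵖ] Y.M) (r : Y.M →ₗ[Λᵐᵒᵖ] X.M) (hir : r ∘ₗ i = LinearMap.id)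
    (i' : X.P.obj →ₗ[Λᵐᵒᵖ] Y.P.obj) (r' : Y.P.obj →ₗ[Λᵐᵒᵖ] X.P.obj)
    (hir' : r' ∘ₗ i' = LinearMap.id) : X.IsRigid k := by
  refine ⟨hY.1.of_retract k i r hir, fun f => ?_⟩
  have h := hY.2 (i ∘ₗ f ∘ₗ r')
  calc f = (r ∘ₗ i) ∘ₗ f ∘ₗ (r' ∘ₗ i') := by rw [hir, hir']; rfl
    _ = r ∘ₗ (i ∘ₗ f ∘ₗ r') ∘ₗ i' := rfl
    _ = 0 := by rw [h, LinearMap.zero_comp, LinearMap.comp_zero]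

lemma IsRigid.sum_comp [Module.Finite k Λ] {m l : ℕ} (X : Fin m → TauPair Λ)
    (hX : (sum X).IsRigid k) (σ : Fin l → Fin m) (hσ : Function.Injective σ) :
    (sum fun i => X (σ i)).IsRigid k :=
  hX.of_retract (piExt (fun i => (X i).M) σ) (piRes (fun i => (X i).M) σ)
    (piRes_piExt (fun i => (X i).M) hσ) (piExt (fun i => (X i).P.obj) σ)
    (piRes (fun i => (X i).P.obj) σ) (piRes_piExt (fun i => (X i).P.obj) hσ)

end TauPair

variable (Λ) in
/-- Isomorphism of indecomposable `τ`-rigid pairs. -/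
def tauSetoid : Setoid {X : TauPair Λ // X.IsIndecomposable ∧ X.IsRigid k} where
  r X Y := X.1.IsIsomorphic Y.1
  iseqv := ⟨fun _ => ⟨⟨LinearEquiv.refl _ _⟩, ⟨LinearEquiv.refl _ _⟩⟩,
    fun ⟨⟨f⟩, ⟨g⟩⟩ => ⟨⟨f.symm⟩, ⟨g.symm⟩⟩,
    fun ⟨⟨f⟩, ⟨g⟩⟩ ⟨⟨f'⟩, ⟨g'⟩⟩ => ⟨⟨f.trans f'⟩, ⟨g.trans g'⟩⟩⟩

variable (Λ) in
/-- The isomorphism classes of indecomposable `τ`-rigid pairs. -/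
def TauVertex := Quotient (tauSetoid Λ k)

variable {k} in
/-- A representative of an isomorphism class. -/
def TauVertex.rep (x : TauVertex Λ k) : TauPair Λ :=
  (Quotient.out (s := tauSetoid Λ k) x).1

variable (Λ) in
/-- The support `τ`-tilting complex of `Λ`: its vertices are the isomorphism classes of
indecomposable `τ`-rigid pairs and its faces are the sets of such pairs whose direct sum is a
`τ`-rigid pair. -/
def tauTiltingComplex [Module.Finite k Λ] : AbstractSimplicialComplex (TauVertex Λ k) where
  faces := {F | F.Nonempty ∧
    (TauPair.sum fun i : Fin F.card => (F.equivFin.symm i).1.rep).IsRigid k}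
  isRelLowerSet_faces := by
    rintro F ⟨hF, hr⟩
    refine ⟨hF, fun G hGF hG => ⟨hG, ?_⟩⟩
    have := TauPair.IsRigid.sum_comp _ hr (subIndex hGF) (subIndex_injective hGF)
    simpa only [equivFin_symm_subIndex] using this
  singleton_mem x := by
    refine ⟨Finset.singleton_nonempty x, ?_⟩
    have h := (Quotient.out (s := tauSetoid Λ k) x).2.2
    have hx : ∀ i, (({x} : Finset (TauVertex Λ k)).equivFin.symm i).1 = x := fun i =>
      Finset.mem_singleton.1 (({x} : Finset (TauVertex Λ k)).equivFin.symm i).2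
    simp only [hx]
    let i₀ : Fin (Finset.card {x}) := ⟨0, by simp⟩
    have hi : ∀ i : Fin (Finset.card {x}), i = i₀ := fun i => by
      have := i.2
      simp only [Finset.card_singleton] at this
      exact Fin.ext (by simp [i₀]; omega)
    refine TauPair.IsRigid.of_retract (Y := x.rep) h (LinearMap.proj i₀)
      (LinearMap.pi fun _ => LinearMap.id) ?_ (LinearMap.proj i₀)
      (LinearMap.pi fun _ => LinearMap.id) ?_
    · exact LinearMap.ext fun y => funext fun i => by rw [hi i]; rfl
    · exact LinearMap.ext fun y => funext fun i => by rw [hi i]; rfl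

end Tau

/-! ### `g`-vectors -/

section GVector

variable {Λ : Type v} [Ring Λ] {n : ℕ} (e : Fin n → Λ)

/-- `P` is isomorphic to the direct sum over `i` of `a i` copies of `e i Λ`. -/
def HasMultiplicities (P : ProjCat Λ) (a : Fin n → ℕ) : Prop :=
  Nonempty (P.obj ≃ₗ[Λᵐᵒᵖ] (∀ i, Fin (a i) → rightIdeal (e i)))

/-- `g` is the `g`-vector of the 2-term object `P₁ ⟶ P₀`: the class `[P₀] - [P₁]`, in the basis
of the classes of the `e i Λ`. -/
def TwoTerm.HasGVector (X : TwoTerm Λ) (g : Fin n → ℤ) : Prop :=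
  ∃ a b : Fin n → ℕ, HasMultiplicities e X.P₀ a ∧ HasMultiplicities e X.P₁ b ∧
    ∀ i, g i = (a i : ℤ) - (b i : ℤ)

/-- `g` is the `g`-vector of the pair `(M, P)`: the `g`-vector `[P₀] - [P₁] - [P]` of the
corresponding 2-term object `(P₁ ⟶ P₀) ⊕ (P ⟶ 0)`, where `P₁ ⟶ P₀` is a minimal projective
presentation of `M`. -/
def TauPair.HasGVector (X : TauPair Λ) (g : Fin n → ℤ) : Prop :=
  ∃ (Y : TwoTerm Λ) (π : Y.P₀.obj →ₗ[Λᵐᵒᵖ] X.M), IsMinimalPresentation Y π ∧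
    ∃ a b c : Fin n → ℕ, HasMultiplicities e Y.P₀ a ∧ HasMultiplicities e Y.P₁ b ∧
      HasMultiplicities e X.P c ∧ ∀ i, g i = (a i : ℤ) - (b i : ℤ) - (c i : ℤ)

variable (J : Finset (Fin n))

/-- The vertices of the support `τ`-tilting complex whose `g`-vectors vanish outside `J`. -/
def tauVerticesOn (k : Type u) [Field k] [Algebra k Λ] : Set (TauVertex Λ k) :=
  {x | ∃ g : Fin n → ℤ, x.rep.HasGVector e g ∧ ∀ i, i ∉ J → g i = 0}

/-- The vertices of the 2-term silting complex whose `g`-vectors vanish outside `J`. -/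
def siltingVerticesOn : Set (SiltingVertex Λ) :=
  {x | ∃ g : Fin n → ℤ, x.rep.HasGVector e g ∧ ∀ i, i ∉ J → g i = 0}

/-- The 2-term objects `P₁ ⟶ P₀` such that `P₁` and `P₀` are direct sums of copies of the
`e j Λ` with `j ∈ J`. -/
def TwoTerm.IsSupportedOn (X : TwoTerm Λ) : Prop :=
  (∃ a : Fin n → ℕ, HasMultiplicities e X.P₀ a ∧ ∀ i, i ∉ J → a i = 0) ∧
    ∃ b : Fin n → ℕ, HasMultiplicities e X.P₁ b ∧ ∀ i, i ∉ J → b i = 0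

/-- The vertices of the 2-term silting complex which are isomorphic to a 2-term object involving
only the `e j Λ` with `j ∈ J`. -/
def siltingVerticesSupportedOn : Set (SiltingVertex Λ) :=
  {x | ∃ Y : TwoTerm Λ, Y.IsSupportedOn e J ∧ x.rep.IsIsomorphic Y}

end GVector

end SiltingCorner

end

-- The 2-term objects are handled by linear algebra. A morphism in the homotopy category is a
-- commutative square modulo homotopies `X.P₀ → Y.P₁`, and `Hom(X, Y[1]) = 0` means that every map
-- `X.P₁ → Y.P₀` has the form `Y.d ∘ h₁ + h₀ ∘ X.d` (`TwoTerm.Map.toK_eq_iff`,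
-- `TwoTerm.forall_eq_zero_iff_extVanishes`). Rigidity of a direct sum is therefore a condition on
-- ordered pairs of summands, the silting complex is a flag complex, and an isomorphism of such
-- complexes is a bijection of vertices that respects `ExtVanishes`.
--
-- Let `ε = e_J`. Sending `P` to `P ε` is an equivalence between the projective `Λ`-modules
-- generated by their `ε`-parts and the projective modules over `ε Λ ε` (`cornerHom_bijective`,
-- `exists_cornerPart_equiv`). It carries squares, homotopies and `ExtVanishes` along, so the
-- silting complex of the corner is the subcomplex on those vertices that are isomorphic to an
-- object with both terms generated by their `ε`-parts.
--
-- These vertices are recognised by their `g`-vectors through the condition `TwoTerm.IsSupported`: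
-- for every simple `S` with `S ε = 0` the map `Hom(P₀, S) → Hom(P₁, S)` is bijective. The condition
-- passes to retracts. When the image of the differential is superfluous this map is zero, so
-- bijectivity says that both spaces vanish, that is, both terms are generated by their `ε`-parts
-- (`TwoTerm.IsSupported.exists_isGenerated`). For a rigid object the map is injective or surjective
-- (`TwoTerm.IsRigid.injective_or_surjective`), and a `g`-vector vanishing outside `J` makes the two
-- dimensions equal, so the map is bijective. Conversely, the simple top of `e i Λ` with `i ∉ J`
-- detects the `i`-th entry of the `g`-vector.
--
-- The statement on pairs follows from the one on 2-term objects: `(M, P) ↦ (P₁ → P₀) ⊕ (P → 0)` is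
-- a bijection on isomorphism classes compatible with direct sums, and `Hom(M, τ M) = 0` says that
-- every map `P₁ → M` factors through `P₁ → P₀` (`forall_hom_tau_eq_zero_iff`), which together with
-- `Hom(P, M) = 0` is rigidity.

universe w

/-! ### Isomorphisms of simplicial complexes, dual graphs and flag complexes. -/

namespace AbstractSimplicialComplex

variable {V W U : Type*} {K : AbstractSimplicialComplex V} {L : AbstractSimplicialComplex W}
  {N : AbstractSimplicialComplex U}

theorem Isomorphic.symm (h : K.Isomorphic L) : L.Isomorphic K := by
  obtain ⟨φ, hφ⟩ := h
  refine ⟨φ.symm, fun s => ?_⟩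
  rw [hφ, Finset.map_map]
  have : φ.symm.toEmbedding.trans φ.toEmbedding = Function.Embedding.refl W := by
    ext x; simp
  rw [this, Finset.map_refl]

theorem Isomorphic.trans (h : K.Isomorphic L) (h' : L.Isomorphic N) : K.Isomorphic N := by
  obtain ⟨φ, hφ⟩ := h
  obtain ⟨ψ, hψ⟩ := h'
  refine ⟨φ.trans ψ, fun s => ?_⟩
  rw [hφ, hψ, Finset.map_map]
  rfl

/-- A bijection of the vertices which identifies the faces and a set of vertices with another one
induces an isomorphism of the induced subcomplexes. -/
theorem Isomorphic.induced (φ : V ≃ W)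
    (hφ : ∀ s : Finset V, s ∈ K.faces ↔ s.map φ.toEmbedding ∈ L.faces)
    {S : Set V} {T : Set W} (hST : ∀ x, x ∈ S ↔ φ x ∈ T) :
    (K.induced S).Isomorphic (L.induced T) := by
  refine ⟨φ.subtypeEquiv hST, fun s => ?_⟩
  change s.map _ ∈ K.faces ↔ Finset.map _ (s.map _) ∈ L.faces
  rw [hφ, Finset.map_map, Finset.map_map]
  rfl

/-- Isomorphic complexes have isomorphic dual graphs. -/
theorem Isomorphic.nonempty_dualGraph_iso (h : K.Isomorphic L) :
    Nonempty (K.dualGraph ≃g L.dualGraph) := by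
  classical
  obtain ⟨φ, hφ⟩ := h
  have hmax : ∀ F : Finset V, Maximal (· ∈ K.faces) F ↔
      Maximal (· ∈ L.faces) (φ.finsetCongr F) := by
    intro F
    constructor
    · rintro ⟨h1, h2⟩
      refine ⟨(hφ F).1 h1, fun G hG hFG => ?_⟩
      obtain ⟨G, rfl⟩ := φ.finsetCongr.surjective G
      exact Finset.map_subset_map.2 (h2 ((hφ G).2 hG) (Finset.map_subset_map.1 hFG))
    · rintro ⟨h1, h2⟩
      refine ⟨(hφ F).2 h1, fun G hG hFG => ?_⟩
      exact Finset.map_subset_map.1 (h2 ((hφ G).1 hG) (Finset.map_subset_map.2 hFG))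
  refine ⟨⟨φ.finsetCongr.subtypeEquiv hmax, ?_⟩⟩
  rintro ⟨F, hF⟩ ⟨G, hG⟩
  change ((F.map φ.toEmbedding \ G.map φ.toEmbedding).card = 1 ∧
    (G.map φ.toEmbedding \ F.map φ.toEmbedding).card = 1) ↔ _
  rw [← Finset.map_sdiff, ← Finset.map_sdiff, Finset.card_map, Finset.card_map]
  rfl

/-- A complex whose faces are the nonempty finite sets of pairwise compatible vertices. -/
def IsFlagFor (K : AbstractSimplicialComplex V) (c : V → V → Prop) : Prop :=
  ∀ F : Finset V, F ∈ K.faces ↔ F.Nonempty ∧ ∀ x ∈ F, ∀ y ∈ F, c x y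

/-- For flag complexes an isomorphism is tested on pairs of vertices; the comparison with the corner
algebra is made in this way. -/
theorem IsFlagFor.mem_faces_iff_map {c : V → V → Prop} {c' : W → W → Prop} (hK : K.IsFlagFor c)
    (hL : L.IsFlagFor c') (φ : V ≃ W) (hφ : ∀ x y, c x y ↔ c' (φ x) (φ y)) (s : Finset V) :
    s ∈ K.faces ↔ s.map φ.toEmbedding ∈ L.faces := by
  rw [hK, hL, Finset.map_nonempty]
  simp only [Finset.forall_mem_map, hφ]
  rfl

theorem IsFlagFor.induced {c : V → V → Prop} (hK : K.IsFlagFor c) (S : Set V) :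
    (K.induced S).IsFlagFor fun x y => c x.1 y.1 := by
  intro F
  change F.map _ ∈ K.faces ↔ _
  rw [hK, Finset.map_nonempty]
  simp only [Finset.forall_mem_map]
  rfl

end AbstractSimplicialComplex

/-! ### The homotopy category of 2-term objects in terms of linear maps. -/

namespace SiltingCorner

open HomologicalComplex in
-- The source is concentrated in degrees `-1` and `0`, so a null-homotopy consists of its components
-- `s` out of degree `0` and `t` out of degree `-1`.
theorem nonempty_homotopy_zero_double_iff {C : Type*} [Category* C] [Preadditive C]
    [HasZeroObject C] {P₁ P₀ : C} (f : P₁ ⟶ P₀)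
    {K : HomologicalComplex C (ComplexShape.up ℤ)} (φ : double f TwoTerm.rel ⟶ K) :
    Nonempty (Homotopy φ 0) ↔ ∃ (s : P₀ ⟶ K.X (-1)) (t : P₁ ⟶ K.X (-2)),
      (doubleXIso₀ f TwoTerm.rel).inv ≫ φ.f (-1) = f ≫ s + t ≫ K.d (-2) (-1) ∧
      (doubleXIso₁ f TwoTerm.rel (by simp)).inv ≫ φ.f 0 = s ≫ K.d (-1) 0 := by
  have r₂ : (ComplexShape.up ℤ).Rel (-2) (-1) := by simp
  constructor
  · rintro ⟨h⟩
    refine ⟨(doubleXIso₁ f TwoTerm.rel (by simp)).inv ≫ h.hom 0 (-1),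
      (doubleXIso₀ f TwoTerm.rel).inv ≫ h.hom (-1) (-2), ?_, ?_⟩
    · rw [h.comm, dNext_eq _ TwoTerm.rel, prevD_eq _ r₂, double_d _ _ (by simp)]
      simp
    · have h1 : (ComplexShape.up ℤ).Rel 0 1 := by simp
      rw [h.comm, dNext_eq _ h1, prevD_eq _ TwoTerm.rel, double_d_eq_zero₀ _ _ _ _ (by simp)]
      simp
  · rintro ⟨s, t, h₁, h₀⟩
    rw [Iso.inv_comp_eq] at h₁ h₀
    refine ⟨⟨fun i j =>
      if h : i = 0 ∧ j = -1 then
        eqToHom (by rw [h.1]) ≫ (doubleXIso₁ f TwoTerm.rel (by simp)).hom ≫ s ≫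
          eqToHom (by rw [h.2])
      else if h : i = -1 ∧ j = -2 then
        eqToHom (by rw [h.1]) ≫ (doubleXIso₀ f TwoTerm.rel).hom ≫ t ≫ eqToHom (by rw [h.2])
      else 0, ?_, ?_⟩⟩
    · intro i j hij
      have hij' : j + 1 ≠ i := hij
      rw [dif_neg (by omega), dif_neg (by omega)]
    · intro i
      by_cases hi₁ : i = -1
      · subst hi₁
        rw [dNext_eq _ TwoTerm.rel, prevD_eq _ r₂, double_d _ _ (by simp), h₁]
        simp
      by_cases hi₀ : i = 0
      · subst hi₀
        have h1 : (ComplexShape.up ℤ).Rel 0 1 := by simp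
        rw [dNext_eq _ h1, prevD_eq _ TwoTerm.rel, double_d_eq_zero₀ _ _ _ _ (by simp), h₀]
        simp
      exact (isZero_double_X f TwoTerm.rel i hi₁ hi₀).eq_of_src _ _

namespace TwoTerm

variable {Λ : Type v} [Ring Λ]

/-- The morphism of `proj Λ` given by a linear map. -/
abbrev homOf {P Q : ProjCat Λ} (f : P.obj →ₗ[Λᵐᵒᵖ] Q.obj) : P ⟶ Q :=
  ObjectProperty.homMk (ModuleCat.ofHom f)

theorem homOf_surjective {P Q : ProjCat Λ} (f : P ⟶ Q) : ∃ g, homOf g = f := ⟨f.hom.hom, rfl⟩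

theorem homOf_injective {P Q : ProjCat Λ} {f g : P.obj →ₗ[Λᵐᵒᵖ] Q.obj} (h : homOf f = homOf g) :
    f = g :=
  congrArg (fun u : P ⟶ Q => u.hom.hom) h

/-- The commutative squares between 2-term objects. -/
structure Map (X Y : TwoTerm Λ) where
  f₁ : X.P₁.obj →ₗ[Λᵐᵒᵖ] Y.P₁.obj
  f₀ : X.P₀.obj →ₗ[Λᵐᵒᵖ] Y.P₀.obj
  comm : Y.d ∘ₗ f₁ = f₀ ∘ₗ X.d

namespace Map

/-- The identity square. -/
@[simps]
def id (X : TwoTerm Λ) : Map X X := ⟨LinearMap.id, LinearMap.id, rfl⟩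

/-- The composition of squares. -/
@[simps]
def comp {X Y Z : TwoTerm Λ} (b : Map Y Z) (a : Map X Y) : Map X Z :=
  ⟨b.f₁ ∘ₗ a.f₁, b.f₀ ∘ₗ a.f₀, by
    rw [← LinearMap.comp_assoc, b.comm, LinearMap.comp_assoc, a.comm, LinearMap.comp_assoc]⟩

/-- The map of complexes of a square. -/
noncomputable abbrev toComplex {X Y : TwoTerm Λ} (a : Map X Y) : X.complex ⟶ Y.complex :=
  complexMap a.f₁ a.f₀ a.comm

/-- The morphism in the homotopy category of a square. -/
noncomputable abbrev toK {X Y : TwoTerm Λ} (a : Map X Y) : X.toK ⟶ Y.toK :=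
  (HomotopyCategory.quotient _ _).map a.toComplex

/-- Homotopic squares. -/
def Homotopic {X Y : TwoTerm Λ} (a b : Map X Y) : Prop :=
  ∃ h : X.P₀.obj →ₗ[Λᵐᵒᵖ] Y.P₁.obj, a.f₁ = b.f₁ + h ∘ₗ X.d ∧ a.f₀ = b.f₀ + Y.d ∘ₗ h

theorem toComplex_f₁ {X Y : TwoTerm Λ} (a : Map X Y) :
    a.toComplex.f (-1) = (HomologicalComplex.doubleXIso₀ (homOf X.d) rel).hom ≫ homOf a.f₁ ≫
      (HomologicalComplex.doubleXIso₀ (homOf Y.d) rel).inv := by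
  simp [complexMap]

theorem toComplex_f₀ {X Y : TwoTerm Λ} (a : Map X Y) :
    a.toComplex.f 0 = (HomologicalComplex.doubleXIso₁ (homOf X.d) rel (by simp)).hom ≫
      homOf a.f₀ ≫ (HomologicalComplex.doubleXIso₁ (homOf Y.d) rel (by simp)).inv := by
  simp [complexMap]

theorem toComplex_surjective {X Y : TwoTerm Λ} (f : X.complex ⟶ Y.complex) :
    ∃ a : Map X Y, a.toComplex = f := by
  obtain ⟨f₁, h₁⟩ := homOf_surjective ((HomologicalComplex.doubleXIso₀ _ rel).inv ≫ f.f (-1) ≫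
    (HomologicalComplex.doubleXIso₀ _ rel).hom)
  obtain ⟨f₀, h₀⟩ := homOf_surjective ((HomologicalComplex.doubleXIso₁ _ rel (by simp)).inv ≫
    f.f 0 ≫ (HomologicalComplex.doubleXIso₁ _ rel (by simp)).hom)
  refine ⟨⟨f₁, f₀, homOf_injective ?_⟩, ?_⟩
  · have hc := f.comm (-1) 0
    rw [HomologicalComplex.double_d _ _ (by simp), HomologicalComplex.double_d _ _ (by simp)] at hc
    change homOf f₁ ≫ homOf Y.d = homOf X.d ≫ homOf f₀
    rw [h₁, h₀]
    have := congrArg (fun u => (HomologicalComplex.doubleXIso₀ _ rel).inv ≫ u ≫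
      (HomologicalComplex.doubleXIso₁ _ rel (by simp)).hom) hc
    simpa using this
  · apply HomologicalComplex.from_double_hom_ext
    · rw [toComplex_f₁, h₁]; simp
    · rw [toComplex_f₀, h₀]; simp

theorem toK_surjective {X Y : TwoTerm Λ} (f : X.toK ⟶ Y.toK) : ∃ a : Map X Y, a.toK = f := by
  obtain ⟨g, rfl⟩ := (HomotopyCategory.quotient _ _).map_surjective f
  obtain ⟨a, rfl⟩ := toComplex_surjective g
  exact ⟨a, rfl⟩

theorem toComplex_comp {X Y Z : TwoTerm Λ} (b : Map Y Z) (a : Map X Y) :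
    (b.comp a).toComplex = a.toComplex ≫ b.toComplex := by
  have e₁ : homOf (b.comp a).f₁ = homOf a.f₁ ≫ homOf b.f₁ := rfl
  have e₀ : homOf (b.comp a).f₀ = homOf a.f₀ ≫ homOf b.f₀ := rfl
  apply HomologicalComplex.from_double_hom_ext
  · rw [HomologicalComplex.comp_f, toComplex_f₁, toComplex_f₁, toComplex_f₁, e₁]; simp
  · rw [HomologicalComplex.comp_f, toComplex_f₀, toComplex_f₀, toComplex_f₀, e₀]; simp

theorem toComplex_id (X : TwoTerm Λ) : (Map.id X).toComplex = 𝟙 _ := by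
  have e₁ : homOf (Map.id X).f₁ = 𝟙 _ := rfl
  have e₀ : homOf (Map.id X).f₀ = 𝟙 _ := rfl
  apply HomologicalComplex.from_double_hom_ext
  · rw [toComplex_f₁, e₁]; simp
  · rw [toComplex_f₀, e₀]; simp

theorem toK_comp {X Y Z : TwoTerm Λ} (b : Map Y Z) (a : Map X Y) :
    (b.comp a).toK = a.toK ≫ b.toK := by
  rw [toK, toComplex_comp, Functor.map_comp]

theorem toK_id (X : TwoTerm Λ) : (Map.id X).toK = 𝟙 _ := by
  rw [toK, toComplex_id, CategoryTheory.Functor.map_id]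

/-- The criterion for null-homotopies is applied to the difference. The component `t` contributes
nothing because the differential of `Y.complex` from degree `-2` to `-1` vanishes, and `s` becomes
the homotopy `h`. -/
theorem toK_eq_iff {X Y : TwoTerm Λ} {a b : Map X Y} : a.toK = b.toK ↔ a.Homotopic b := by
  rw [← sub_eq_zero, ← Functor.map_sub, HomotopyCategory.quotient_map_eq_zero_iff,
    nonempty_homotopy_zero_double_iff]
  rw [HomologicalComplex.sub_f_apply, HomologicalComplex.sub_f_apply, toComplex_f₁, toComplex_f₀,
    toComplex_f₁, toComplex_f₀, HomologicalComplex.double_d _ _ (by simp),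
    HomologicalComplex.double_d_eq_zero₀ _ _ _ _ (by simp)]
  constructor
  · rintro ⟨s, t, h₁, h₀⟩
    obtain ⟨h, hh⟩ := homOf_surjective (s ≫ (HomologicalComplex.doubleXIso₀ _ rel).hom)
    refine ⟨h, ?_, ?_⟩
    · apply homOf_injective
      change _ = homOf b.f₁ + homOf X.d ≫ homOf h
      rw [hh, ← sub_eq_iff_eq_add']
      have := congrArg (· ≫ (HomologicalComplex.doubleXIso₀ _ rel).hom) h₁
      simpa using this
    · apply homOf_injective
      change _ = homOf b.f₀ + homOf h ≫ homOf Y.d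
      rw [hh, ← sub_eq_iff_eq_add']
      have := congrArg (· ≫ (HomologicalComplex.doubleXIso₁ _ rel (by simp)).hom) h₀
      simpa using this
  · rintro ⟨h, h₁, h₀⟩
    have h₁' : homOf a.f₁ = homOf b.f₁ + homOf X.d ≫ homOf h := by rw [h₁]; rfl
    have h₀' : homOf a.f₀ = homOf b.f₀ + homOf h ≫ homOf Y.d := by rw [h₀]; rfl
    refine ⟨homOf h ≫ (HomologicalComplex.doubleXIso₀ _ rel).inv, 0, ?_, ?_⟩
    · rw [h₁']; simp
    · rw [h₀']; simp

end Map

theorem isIsomorphic_iff {X Y : TwoTerm Λ} : X.IsIsomorphic Y ↔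
    ∃ (a : Map X Y) (b : Map Y X), (b.comp a).Homotopic (Map.id X) ∧
      (a.comp b).Homotopic (Map.id Y) := by
  simp only [← Map.toK_eq_iff, Map.toK_comp, Map.toK_id]
  constructor
  · rintro ⟨i⟩
    obtain ⟨a, ha⟩ := Map.toK_surjective i.hom
    obtain ⟨b, hb⟩ := Map.toK_surjective i.inv
    exact ⟨a, b, by simp [ha, hb], by simp [ha, hb]⟩
  · rintro ⟨a, b, h₁, h₂⟩
    exact ⟨⟨a.toK, b.toK, h₁, h₂⟩⟩

/-- An object is zero when its identity is null-homotopic, and such a homotopy is a two-sided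
inverse of the differential. -/
theorem isZero_toK_iff {X : TwoTerm Λ} : IsZero X.toK ↔ Function.Bijective X.d := by
  have h0 : (⟨0, 0, by simp⟩ : Map X X).toK = 0 := by
    rw [Map.toK, show (⟨0, 0, by simp⟩ : Map X X).toComplex = 0 from ?_, Functor.map_zero]
    have e₁ : homOf (0 : X.P₁.obj →ₗ[Λᵐᵒᵖ] X.P₁.obj) = 0 := rfl
    have e₀ : homOf (0 : X.P₀.obj →ₗ[Λᵐᵒᵖ] X.P₀.obj) = 0 := rfl
    apply HomologicalComplex.from_double_hom_ext
    · rw [Map.toComplex_f₁, e₁]; simp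
    · rw [Map.toComplex_f₀, e₀]; simp
  rw [IsZero.iff_id_eq_zero, ← h0, ← Map.toK_id, Map.toK_eq_iff]
  constructor
  · rintro ⟨h, h₁, h₀⟩
    refine Function.bijective_iff_has_inverse.2 ⟨h, fun x => ?_, fun x => ?_⟩
    · simpa using (LinearMap.congr_fun h₁ x).symm
    · simpa using (LinearMap.congr_fun h₀ x).symm
  · intro h
    let E := LinearEquiv.ofBijective _ h
    refine ⟨E.symm.toLinearMap, LinearMap.ext fun x => ?_, LinearMap.ext fun x => ?_⟩
    · change x = 0 + E.symm (E x)
      rw [E.symm_apply_apply, zero_add]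
    · change x = 0 + E (E.symm x)
      rw [E.apply_symm_apply, zero_add]

/-- `Hom(X, Y[1]) = 0`, expressed by linear maps. -/
def ExtVanishes (X Y : TwoTerm Λ) : Prop :=
  ∀ f : X.P₁.obj →ₗ[Λᵐᵒᵖ] Y.P₀.obj, ∃ (h₁ : X.P₁.obj →ₗ[Λᵐᵒᵖ] Y.P₁.obj)
    (h₀ : X.P₀.obj →ₗ[Λᵐᵒᵖ] Y.P₀.obj), f = Y.d ∘ₗ h₁ + h₀ ∘ₗ X.d

/-- Null-homotopic maps from a 2-term object to a complex with `K⁻² ⟶ K⁻¹` given by `Y` and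
`K⁰ = 0`. -/
theorem forall_homotopy_zero_iff_extVanishes {X Y : TwoTerm Λ}
    {K : HomologicalComplex (ProjCat Λ) (ComplexShape.up ℤ)} (e₀ : K.X (-1) ≅ Y.P₀)
    (e₁ : K.X (-2) ≅ Y.P₁) (hd : K.d (-2) (-1) = -(e₁.hom ≫ homOf Y.d ≫ e₀.inv))
    (hK : IsZero (K.X 0)) :
    (∀ g : X.complex ⟶ K, Nonempty (Homotopy g 0)) ↔ ExtVanishes X Y := by
  simp only [nonempty_homotopy_zero_double_iff]
  constructor
  · intro H f
    let g : X.complex ⟶ K := HomologicalComplex.mkHomFromDouble rel (by simp)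
      (homOf f ≫ e₀.inv) 0 (hK.eq_of_tgt _ _) (by simp)
    obtain ⟨s, t, h, -⟩ := H g
    obtain ⟨h₀, hh₀⟩ := homOf_surjective (s ≫ e₀.hom)
    -- The sign cancels the one in `hd`, which comes from the shift.
    obtain ⟨h₁, hh₁⟩ := homOf_surjective (-(t ≫ e₁.hom))
    refine ⟨h₁, h₀, homOf_injective ?_⟩
    change _ = homOf h₁ ≫ homOf Y.d + homOf X.d ≫ homOf h₀
    have := congrArg (· ≫ e₀.hom) h
    simp only [g, HomologicalComplex.mkHomFromDouble_f₀, hd] at this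
    simp only [Iso.inv_hom_id_assoc, Category.assoc, Iso.inv_hom_id, Category.comp_id,
      Preadditive.add_comp, Preadditive.comp_neg, Preadditive.neg_comp] at this
    rw [this, hh₁, hh₀, Preadditive.neg_comp, Category.assoc, add_comm]
  · intro H g
    obtain ⟨f, hf⟩ := homOf_surjective
      ((HomologicalComplex.doubleXIso₀ _ rel).inv ≫ g.f (-1) ≫ e₀.hom)
    obtain ⟨h₁, h₀, h⟩ := H f
    refine ⟨homOf h₀ ≫ e₀.inv, -homOf h₁ ≫ e₁.inv, ?_, hK.eq_of_tgt _ _⟩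
    rw [← cancel_mono e₀.hom, Category.assoc, ← hf, h, hd]
    change homOf h₁ ≫ homOf Y.d + homOf X.d ≫ homOf h₀ = _
    simp [add_comm]

/-- The quotient functor is full and commutes with the shift, so the question is whether all chain
maps to `Y[1]` are null-homotopic. The shift puts `Y.P₀` in degree `-1` and `Y.P₁` in degree `-2`
and changes the sign of the differential. -/
theorem forall_eq_zero_iff_extVanishes {X Y : TwoTerm Λ} :
    (∀ f : X.toK ⟶ Y.toK⟦(1 : ℤ)⟧, f = 0) ↔ ExtVanishes X Y := by
  have h1 : (∀ f : X.toK ⟶ Y.toK⟦(1 : ℤ)⟧, f = 0) ↔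
      ∀ g : X.complex ⟶ Y.complex⟦(1 : ℤ)⟧, Nonempty (Homotopy g 0) := by
    let i := ((HomotopyCategory.quotient (ProjCat Λ) (ComplexShape.up ℤ)).commShiftIso
      (1 : ℤ)).app Y.complex
    simp only [← HomotopyCategory.quotient_map_eq_zero_iff]
    constructor
    · intro h g
      have := h ((HomotopyCategory.quotient (ProjCat Λ) (ComplexShape.up ℤ)).map g ≫ i.hom)
      rwa [Preadditive.IsIso.comp_right_eq_zero] at this
    · intro h f
      obtain ⟨g, hg⟩ := (HomotopyCategory.quotient _ _).map_surjective (f ≫ i.inv)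
      rw [← Preadditive.IsIso.comp_right_eq_zero f i.inv, ← hg, h]
  rw [h1]
  let K : CochainComplex (ProjCat Λ) ℤ := Y.complex
  have h := HomologicalComplex.double_d (homOf Y.d) rel (by simp)
  refine forall_homotopy_zero_iff_extVanishes
    (K.shiftFunctorObjXIso 1 (-1) 0 (by simp) ≪≫
      HomologicalComplex.doubleXIso₁ (homOf Y.d) rel (by simp))
    (K.shiftFunctorObjXIso 1 (-2) (-1) (by simp) ≪≫
      HomologicalComplex.doubleXIso₀ (homOf Y.d) rel) ?_
    (HomologicalComplex.isZero_double_X (homOf Y.d) rel 1 (by simp) (by simp))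
  simp only [Iso.trans_hom, Iso.trans_inv, Category.assoc]
  rw [← reassoc_of% h]
  rw [CochainComplex.shiftFunctor_obj_d']
  simp [K]
  rfl

theorem isRigid_iff_extVanishes {X : TwoTerm Λ} : X.IsRigid ↔ ExtVanishes X X :=
  forall_eq_zero_iff_extVanishes

end TwoTerm

end SiltingCorner

/-! ### Retracts, direct sums and the flag property of the silting complex. -/

namespace SiltingCorner

namespace TwoTerm

variable {Λ : Type v} [Ring Λ]

theorem IsIsomorphic.refl (X : TwoTerm Λ) : X.IsIsomorphic X := ⟨Iso.refl _⟩

theorem IsIsomorphic.symm {X Y : TwoTerm Λ} (h : X.IsIsomorphic Y) : Y.IsIsomorphic X :=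
  h.map Iso.symm

theorem IsIsomorphic.trans {X Y Z : TwoTerm Λ} (h : X.IsIsomorphic Y) (h' : Y.IsIsomorphic Z) :
    X.IsIsomorphic Z :=
  h.elim fun i => h'.elim fun j => ⟨i ≪≫ j⟩

theorem IsIsomorphic.isZero_iff {X Y : TwoTerm Λ} (h : X.IsIsomorphic Y) :
    IsZero X.toK ↔ IsZero Y.toK :=
  h.elim fun i => ⟨fun h => h.of_iso i.symm, fun h => h.of_iso i⟩

theorem Map.Homotopic.of_eq {X Y : TwoTerm Λ} {a b : Map X Y} (h₁ : a.f₁ = b.f₁)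
    (h₀ : a.f₀ = b.f₀) : a.Homotopic b :=
  ⟨0, by simp [h₁], by simp [h₀]⟩

/-- An isomorphism of complexes is an isomorphism in the homotopy category. -/
theorem IsIsomorphic.of_equiv {X Y : TwoTerm Λ} (a₁ : X.P₁.obj ≃ₗ[Λᵐᵒᵖ] Y.P₁.obj)
    (a₀ : X.P₀.obj ≃ₗ[Λᵐᵒᵖ] Y.P₀.obj) (h : ∀ x, Y.d (a₁ x) = a₀ (X.d x)) :
    X.IsIsomorphic Y := by
  refine isIsomorphic_iff.2 ⟨⟨a₁, a₀, LinearMap.ext h⟩, ⟨a₁.symm, a₀.symm, ?_⟩, ?_, ?_⟩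
  · refine LinearMap.ext fun y => a₀.injective ?_
    have := h (a₁.symm y)
    simp only [LinearEquiv.apply_symm_apply] at this
    simp [this]
  · exact .of_eq (LinearMap.ext fun x => a₁.symm_apply_apply x)
      (LinearMap.ext fun x => a₀.symm_apply_apply x)
  · exact .of_eq (LinearMap.ext fun x => a₁.apply_symm_apply x)
      (LinearMap.ext fun x => a₀.apply_symm_apply x)

/-- `X` is a retract of `Y` in the homotopy category. -/
def IsRetract (X Y : TwoTerm Λ) : Prop :=
  ∃ (a : Map X Y) (b : Map Y X), (b.comp a).Homotopic (Map.id X)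

theorem IsIsomorphic.isRetract {X Y : TwoTerm Λ} (h : X.IsIsomorphic Y) : X.IsRetract Y := by
  obtain ⟨a, b, h, -⟩ := isIsomorphic_iff.1 h
  exact ⟨a, b, h⟩

/-- `Hom(-, -[1])` is functorial in both arguments, and `f` is recovered from the vanishing map `b ≫
f ≫ c[1]`. -/
theorem ExtVanishes.of_isRetract {X X' Y Y' : TwoTerm Λ} (h : ExtVanishes X Y)
    (hX : X'.IsRetract X) (hY : Y'.IsRetract Y) : ExtVanishes X' Y' := by
  rw [← forall_eq_zero_iff_extVanishes] at h ⊢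
  obtain ⟨a, b, hab⟩ := hX
  obtain ⟨c, d, hcd⟩ := hY
  rw [← Map.toK_eq_iff, Map.toK_comp, Map.toK_id] at hab hcd
  intro f
  have key := h (b.toK ≫ f ≫ c.toK⟦(1 : ℤ)⟧')
  calc f = (a.toK ≫ b.toK) ≫ f ≫ (c.toK ≫ d.toK)⟦(1 : ℤ)⟧' := by simp [hab, hcd]
    _ = a.toK ≫ (b.toK ≫ f ≫ c.toK⟦(1 : ℤ)⟧') ≫ d.toK⟦(1 : ℤ)⟧' := by
      rw [Functor.map_comp]; simp only [Category.assoc]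
    _ = 0 := by rw [key]; simp

theorem extVanishes_congr {X X' Y Y' : TwoTerm Λ} (hX : X.IsIsomorphic X')
    (hY : Y.IsIsomorphic Y') : ExtVanishes X Y ↔ ExtVanishes X' Y' :=
  ⟨fun h => h.of_isRetract hX.symm.isRetract hY.symm.isRetract,
    fun h => h.of_isRetract hX.isRetract hY.isRetract⟩

theorem IsIsomorphic.isRigid_iff {X Y : TwoTerm Λ} (h : X.IsIsomorphic Y) :
    X.IsRigid ↔ Y.IsRigid := by
  rw [isRigid_iff_extVanishes, isRigid_iff_extVanishes, extVanishes_congr h h]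

section Sum

variable {m : ℕ}

/-- The inclusion of a summand. -/
def single (X : Fin m → TwoTerm Λ) (i : Fin m) : Map (X i) (sum X) where
  f₁ := LinearMap.single Λᵐᵒᵖ (fun i => (X i).P₁.obj) i
  f₀ := LinearMap.single Λᵐᵒᵖ (fun i => (X i).P₀.obj) i
  comm := LinearMap.ext fun x => funext fun j =>
    Pi.apply_single (fun i => (X i).d) (fun i => map_zero (X i).d) i x j

/-- The projection to a summand. -/
def proj (X : Fin m → TwoTerm Λ) (i : Fin m) : Map (sum X) (X i) where
  f₁ := LinearMap.proj (R := Λᵐᵒᵖ) (φ := fun i => (X i).P₁.obj) i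
  f₀ := LinearMap.proj (R := Λᵐᵒᵖ) (φ := fun i => (X i).P₀.obj) i
  comm := rfl

theorem isRetract_sum (X : Fin m → TwoTerm Λ) (i : Fin m) : (X i).IsRetract (sum X) :=
  ⟨single X i, proj X i, .of_eq
    (LinearMap.ext fun x => Pi.single_eq_same (M := fun i => (X i).P₁.obj) i x)
    (LinearMap.ext fun x => Pi.single_eq_same (M := fun i => (X i).P₀.obj) i x)⟩

/-- The direct sum of maps. -/
def Map.sum {X Y : Fin m → TwoTerm Λ} (a : ∀ i, Map (X i) (Y i)) :
    Map (TwoTerm.sum X) (TwoTerm.sum Y) where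
  f₁ := LinearMap.pi (φ := fun i => (Y i).P₁.obj) fun i =>
    (a i).f₁ ∘ₗ LinearMap.proj (φ := fun i => (X i).P₁.obj) i
  f₀ := LinearMap.pi (φ := fun i => (Y i).P₀.obj) fun i =>
    (a i).f₀ ∘ₗ LinearMap.proj (φ := fun i => (X i).P₀.obj) i
  comm := LinearMap.ext fun x => funext fun i => LinearMap.congr_fun (a i).comm (x i)

theorem IsIsomorphic.sum {X Y : Fin m → TwoTerm Λ} (h : ∀ i, (X i).IsIsomorphic (Y i)) :
    (TwoTerm.sum X).IsIsomorphic (TwoTerm.sum Y) := by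
  simp only [isIsomorphic_iff] at h ⊢
  choose a b hba hab using h
  choose s hs₁ hs₀ using hba
  choose t ht₁ ht₀ using hab
  refine ⟨Map.sum a, Map.sum b,
    ⟨LinearMap.pi (φ := fun i => (X i).P₁.obj) fun i =>
      s i ∘ₗ LinearMap.proj (φ := fun i => (X i).P₀.obj) i, ?_, ?_⟩,
    ⟨LinearMap.pi (φ := fun i => (Y i).P₁.obj) fun i =>
      t i ∘ₗ LinearMap.proj (φ := fun i => (Y i).P₀.obj) i, ?_, ?_⟩⟩
  · exact LinearMap.ext fun x => funext fun i => LinearMap.congr_fun (hs₁ i) (x i)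
  · exact LinearMap.ext fun x => funext fun i => LinearMap.congr_fun (hs₀ i) (x i)
  · exact LinearMap.ext fun x => funext fun i => LinearMap.congr_fun (ht₁ i) (x i)
  · exact LinearMap.ext fun x => funext fun i => LinearMap.congr_fun (ht₀ i) (x i)

/-- A map between direct sums is the sum of its matrix entries, so solutions for the entries add up
to a solution; conversely the summands are retracts. -/
theorem extVanishes_sum_iff {l : ℕ} (X : Fin m → TwoTerm Λ) (Y : Fin l → TwoTerm Λ) :
    ExtVanishes (sum X) (sum Y) ↔ ∀ i j, ExtVanishes (X i) (Y j) := by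
  constructor
  · exact fun h i j => h.of_isRetract (isRetract_sum X i) (isRetract_sum Y j)
  · intro h f
    choose h₁ h₀ hh using fun i j => h i j ((proj Y j).f₀ ∘ₗ f ∘ₗ (single X i).f₁)
    refine ⟨∑ i, ∑ j, (single Y j).f₁ ∘ₗ h₁ i j ∘ₗ (proj X i).f₁,
      ∑ i, ∑ j, (single Y j).f₀ ∘ₗ h₀ i j ∘ₗ (proj X i).f₀, ?_⟩
    have key : f = ∑ i, ∑ j, (single Y j).f₀ ∘ₗ ((proj Y j).f₀ ∘ₗ f ∘ₗ (single X i).f₁) ∘ₗ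
        (proj X i).f₁ := by
      refine LinearMap.ext fun x => ?_
      have hx : x = ∑ i, (single X i).f₁ ((proj X i).f₁ x) :=
        (LinearMap.sum_single_apply (φ := fun i => (X i).P₁.obj) x).symm
      conv_lhs => rw [hx, map_sum]
      simp only [LinearMap.sum_apply]
      refine Finset.sum_congr rfl fun i _ => ?_
      exact (LinearMap.sum_single_apply (φ := fun i => (Y i).P₀.obj) _).symm
    rw [key]
    simp only [hh, LinearMap.comp_add, LinearMap.add_comp, Finset.sum_add_distrib]
    congr 1
    · refine LinearMap.ext fun x => ?_
      simp only [LinearMap.sum_apply, LinearMap.comp_apply, map_sum]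
      exact Finset.sum_congr rfl fun i _ => Finset.sum_congr rfl fun j _ =>
        (LinearMap.congr_fun (single Y j).comm _).symm
    · refine LinearMap.ext fun x => ?_
      simp only [LinearMap.sum_apply, LinearMap.comp_apply]
      rfl

theorem isRigid_sum_iff (X : Fin m → TwoTerm Λ) :
    (sum X).IsRigid ↔ ∀ i j, ExtVanishes (X i) (X j) := by
  rw [isRigid_iff_extVanishes, extVanishes_sum_iff]

end Sum

end TwoTerm

/-- Two classes are compatible if there are no nonzero maps from the one to the shift of the
other. -/
def SiltingVertex.Compatible {Λ : Type v} [Ring Λ] (x y : SiltingVertex Λ) : Prop :=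
  TwoTerm.ExtVanishes x.rep y.rep

theorem forall_equivFin_symm {V : Type*} (F : Finset V) (p : V → V → Prop) :
    (∀ i j, p (F.equivFin.symm i).1 (F.equivFin.symm j).1) ↔ ∀ x ∈ F, ∀ y ∈ F, p x y := by
  constructor
  · intro h x hx y hy
    simpa using h (F.equivFin ⟨x, hx⟩) (F.equivFin ⟨y, hy⟩)
  · exact fun h i j => h _ (F.equivFin.symm i).2 _ (F.equivFin.symm j).2

/-- Rigidity of a direct sum is a condition on ordered pairs of summands, including the pairs of
equal ones. -/
theorem siltingComplex_isFlagFor (Λ : Type v) [Ring Λ] :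
    (siltingComplex Λ).IsFlagFor SiltingVertex.Compatible := by
  intro F
  change F.Nonempty ∧ TwoTerm.IsRigid _ ↔ _
  rw [TwoTerm.isRigid_sum_iff, ← forall_equivFin_symm]
  rfl

/-- The class of an indecomposable rigid object. -/
def SiltingVertex.mk {Λ : Type v} [Ring Λ] (X : TwoTerm Λ) (h : X.IsIndecomposable)
    (h' : X.IsRigid) : SiltingVertex Λ :=
  Quotient.mk (rigidSetoid Λ) ⟨X, h, h'⟩

theorem SiltingVertex.rep_mk {Λ : Type v} [Ring Λ] {X : TwoTerm Λ} (h : X.IsIndecomposable)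
    (h' : X.IsRigid) : (SiltingVertex.mk X h h').rep.IsIsomorphic X :=
  Quotient.mk_out (s := rigidSetoid Λ) ⟨X, h, h'⟩

theorem SiltingVertex.isIndecomposable {Λ : Type v} [Ring Λ] (x : SiltingVertex Λ) :
    x.rep.IsIndecomposable :=
  (Quotient.out (s := rigidSetoid Λ) x).2.1

theorem SiltingVertex.isRigid {Λ : Type v} [Ring Λ] (x : SiltingVertex Λ) : x.rep.IsRigid :=
  (Quotient.out (s := rigidSetoid Λ) x).2.2

theorem SiltingVertex.ext {Λ : Type v} [Ring Λ] {x y : SiltingVertex Λ}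
    (h : x.rep.IsIsomorphic y.rep) : x = y := by
  rw [← Quotient.out_eq (s := rigidSetoid Λ) x, ← Quotient.out_eq (s := rigidSetoid Λ) y]
  exact Quotient.sound h

end SiltingCorner

/-! ### Superfluous submodules, minimal presentations, and pairs versus 2-term objects. -/

namespace SiltingCorner

section Superfluous

variable {R : Type*} [Ring R] {A B : Type*} [AddCommGroup A] [Module R A] [AddCommGroup B]
  [Module R B]

/-- If `f(N) + L` is everything then so is `N + f⁻¹(L)`. Hence `f⁻¹(L)` is everything, and `L`
contains `f(N)`. -/
theorem IsSuperfluous.map {N : Submodule R A} (hN : IsSuperfluous N) (f : A →ₗ[R] B) :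
    IsSuperfluous (N.map f) := by
  intro L hL
  have h : L.comap f = ⊤ := by
    apply hN
    rw [eq_top_iff]
    intro x _
    obtain ⟨_, ⟨n, hn, rfl⟩, l, hl, hx⟩ := Submodule.mem_sup.1
      (show f x ∈ N.map f ⊔ L by rw [hL]; trivial)
    have : x = n + (x - n) := by abel
    rw [this]
    refine Submodule.add_mem_sup hn ?_
    rw [Submodule.mem_comap, map_sub, ← hx, add_sub_cancel_left]
    exact hl
  rw [← hL, eq_comm, sup_eq_right]
  rintro _ ⟨n, -, rfl⟩
  have : n ∈ L.comap f := h ▸ Submodule.mem_top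
  exact this

theorem IsSuperfluous.mono {N N' : Submodule R A} (hN : IsSuperfluous N) (h : N' ≤ N) :
    IsSuperfluous N' := fun L hL =>
  hN L (eq_top_iff.2 (hL ▸ sup_le_sup_right h L))

theorem IsSuperfluous.finset_sup {ι : Type*} (s : Finset ι) {N : ι → Submodule R A}
    (hN : ∀ i, IsSuperfluous (N i)) : IsSuperfluous (s.sup N) := by
  classical
  induction s using Finset.induction_on with
  | empty => intro L hL; simpa using hL
  | insert i s hi ih =>
    intro L hL
    rw [Finset.sup_insert, sup_assoc] at hL
    exact ih L (hN i _ hL)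

/-- The product lies in the finite sum of the images of the `N i`; images and finite sums preserve
superfluity. -/
theorem IsSuperfluous.pi {ι : Type*} [Fintype ι] {A : ι → Type*} [∀ i, AddCommGroup (A i)]
    [∀ i, Module R (A i)] {N : ∀ i, Submodule R (A i)} (hN : ∀ i, IsSuperfluous (N i)) :
    IsSuperfluous (Submodule.pi Set.univ N) := by
  classical
  refine (IsSuperfluous.finset_sup Finset.univ fun i =>
    (hN i).map (LinearMap.single R A i)).mono fun x hx => ?_
  rw [← show ∑ i, Pi.single i (x i) = x from LinearMap.sum_single_apply _ x]
  refine Submodule.sum_mem _ fun i hi => ?_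
  exact (Finset.le_sup (f := fun i => (N i).map (LinearMap.single R A i)) hi)
    ⟨x i, hx i trivial, rfl⟩

/-- `f` is the identity modulo `N`, so `N` and the range of `f` together are everything. This is how
minimality produces isomorphisms. -/
theorem IsSuperfluous.surjective {N : Submodule R A} (hN : IsSuperfluous N) (f : A →ₗ[R] A)
    (h : ∀ x, x - f x ∈ N) : Function.Surjective f := by
  rw [← LinearMap.range_eq_top]
  apply hN
  rw [eq_top_iff]
  intro x _
  have : x = (x - f x) + f x := by abel
  rw [this]
  exact Submodule.add_mem_sup (h x) (LinearMap.mem_range_self _ _)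

theorem IsSuperfluous.bijective [IsNoetherian R A] {N : Submodule R A} (hN : IsSuperfluous N)
    (f : A →ₗ[R] A) (h : ∀ x, x - f x ∈ N) : Function.Bijective f :=
  ⟨IsNoetherian.injective_of_surjective_endomorphism _ (hN.surjective f h), hN.surjective f h⟩

/-- Two maps whose compositions are bijective are bijective. -/
theorem bijective_of_comp {f : A →ₗ[R] B} {g : B →ₗ[R] A} (h : Function.Bijective (g ∘ₗ f))
    (h' : Function.Bijective (f ∘ₗ g)) : Function.Bijective f :=
  ⟨Function.Injective.of_comp h.1, Function.Surjective.of_comp h'.2⟩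

theorem exists_comp_eq_of_ker_le {M N : Type*} [AddCommGroup M] [Module R M] [AddCommGroup N]
    [Module R N] {π : A →ₗ[R] M} (hπ : Function.Surjective π) {g : A →ₗ[R] N}
    (h : LinearMap.ker π ≤ LinearMap.ker g) : ∃ f : M →ₗ[R] N, f ∘ₗ π = g := by
  refine ⟨(LinearMap.ker π).liftQ g h ∘ₗ (π.quotKerEquivOfSurjective hπ).symm.toLinearMap, ?_⟩
  refine LinearMap.ext fun x => ?_
  have : (π.quotKerEquivOfSurjective hπ).symm (π x) = Submodule.Quotient.mk x := by
    rw [LinearEquiv.symm_apply_eq]; rfl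
  simp [this]

/-- If `(b ∘ a) (0, x) = (0, x)` and `a` maps `0 × P` to `ker d × Q` with `ker d` superfluous, then
the composition of the components `P ⟶ Q ⟶ P` is bijective. -/
theorem bijective_comp_components {A' P Q : Type*} [AddCommGroup A'] [Module R A']
    [AddCommGroup P] [Module R P] [AddCommGroup Q] [Module R Q] [IsNoetherian R P]
    {d : B →ₗ[R] A'} (hd : IsSuperfluous (LinearMap.ker d)) (a : A × P →ₗ[R] B × Q)
    (b : B × Q →ₗ[R] A × P) (ha : ∀ x, d (a (0, x)).1 = 0) (hba : ∀ x, b (a (0, x)) = (0, x)) :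
    Function.Bijective ((LinearMap.snd R A P ∘ₗ b ∘ₗ LinearMap.inr R B Q) ∘ₗ
      (LinearMap.snd R B Q ∘ₗ a ∘ₗ LinearMap.inr R A P)) := by
  -- The composition differs from the identity by the contribution of the component of `a (0, x)` in
  -- `B`. That component lies in `ker d`, so the difference lies in the image of `ker d` in `P`,
  -- which is superfluous.
  refine (hd.map (LinearMap.snd R A P ∘ₗ b ∘ₗ LinearMap.inl R B Q)).bijective _ fun x => ?_
  refine ⟨(a (0, x)).1, ha x, ?_⟩
  rw [eq_sub_iff_add_eq]
  simp only [LinearMap.comp_apply, LinearMap.inl_apply, LinearMap.inr_apply, LinearMap.snd_apply]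
  rw [← Prod.snd_add, ← map_add, Prod.mk_add_mk, add_zero, zero_add, Prod.mk.eta, hba]

/-- Lifting along a map whose image contains the given one. -/
theorem exists_lift_of_range_le {P : Type*} [AddCommGroup P] [Module R P] [Module.Projective R P]
    (d : A →ₗ[R] B) (f : P →ₗ[R] B) (h : LinearMap.range f ≤ LinearMap.range d) :
    ∃ g : P →ₗ[R] A, d ∘ₗ g = f := by
  obtain ⟨g, hg⟩ := Module.projective_lifting_property d.rangeRestrict
    (f.codRestrict (LinearMap.range d) fun x => h ⟨x, rfl⟩) d.surjective_rangeRestrict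
  exact ⟨g, LinearMap.ext fun x => congrArg Subtype.val (LinearMap.congr_fun hg x)⟩

end Superfluous

variable {Λ : Type v} [Ring Λ]

/-- The direct sum of two finitely generated projective modules. -/
abbrev ProjCat.prod (P Q : ProjCat Λ) : ProjCat Λ where
  obj := ModuleCat.of Λᵐᵒᵖ (P.obj × Q.obj)
  property := ⟨inferInstanceAs (Module.Finite Λᵐᵒᵖ (P.obj × Q.obj)),
    inferInstanceAs (Module.Projective Λᵐᵒᵖ (P.obj × Q.obj))⟩

/-- The 2-term object `(P₁ ⟶ P₀) ⊕ (P ⟶ 0)`. -/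
abbrev TwoTerm.addShift (Y : TwoTerm Λ) (P : ProjCat Λ) : TwoTerm Λ where
  P₁ := Y.P₁.prod P
  P₀ := Y.P₀
  d := Y.d ∘ₗ LinearMap.fst Λᵐᵒᵖ Y.P₁.obj P.obj

/-- Squares lifting a map of cokernels. -/
theorem TwoTerm.exists_map_lift {X Y : TwoTerm Λ} {M N : Type*} [AddCommGroup M] [Module Λᵐᵒᵖ M]
    [AddCommGroup N] [Module Λᵐᵒᵖ N] {π : X.P₀.obj →ₗ[Λᵐᵒᵖ] M} {ρ : Y.P₀.obj →ₗ[Λᵐᵒᵖ] N}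
    (hπ : LinearMap.range X.d ≤ LinearMap.ker π) (hρ : Function.Surjective ρ)
    (hY : LinearMap.range Y.d = LinearMap.ker ρ) (f : M →ₗ[Λᵐᵒᵖ] N) :
    ∃ a : Map X Y, ρ ∘ₗ a.f₀ = f ∘ₗ π := by
  obtain ⟨a₀, h₀⟩ := Module.projective_lifting_property ρ (f ∘ₗ π) hρ
  obtain ⟨a₁, h₁⟩ := exists_lift_of_range_le Y.d (a₀ ∘ₗ X.d) (by
    rintro _ ⟨x, rfl⟩
    have hx : π (X.d x) = 0 := hπ ⟨x, rfl⟩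
    rw [hY, LinearMap.mem_ker, LinearMap.comp_apply, ← LinearMap.comp_apply, h₀,
      LinearMap.comp_apply, hx, map_zero])
  exact ⟨⟨a₁, a₀, h₁⟩, h₀⟩

section MinimalPresentation

variable {M N : Type*} [AddCommGroup M] [Module Λᵐᵒᵖ M] [AddCommGroup N] [Module Λᵐᵒᵖ N]

theorem IsMinimalPresentation.map_d {X : TwoTerm Λ} {π : X.P₀.obj →ₗ[Λᵐᵒᵖ] M}
    (hX : IsMinimalPresentation X π) (x : X.P₁.obj) : π (X.d x) = 0 := by
  rw [← LinearMap.mem_ker, ← hX.exact]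
  exact ⟨x, rfl⟩

/-- An endomorphism of a minimal presentation over the identity is bijective. -/
theorem IsMinimalPresentation.bijective_map [IsArtinianRing Λᵐᵒᵖ] {X : TwoTerm Λ}
    {π : X.P₀.obj →ₗ[Λᵐᵒᵖ] M} (hX : IsMinimalPresentation X π) (c : TwoTerm.Map X X)
    (hc : π ∘ₗ c.f₀ = π) : Function.Bijective c.f₁ ∧ Function.Bijective c.f₀ := by
  have h0 : Function.Bijective c.f₀ := hX.superfluous₀.bijective c.f₀ fun x => by
    rw [LinearMap.mem_ker, map_sub, sub_eq_zero]
    exact (LinearMap.congr_fun hc x).symm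
  refine ⟨?_, h0⟩
  have hs : Function.Surjective c.f₁ := by
    rw [← LinearMap.range_eq_top]
    apply hX.superfluous₁
    rw [eq_top_iff]
    intro x _
    obtain ⟨y, hy⟩ := h0.2 (X.d x)
    have hy' : y ∈ LinearMap.range X.d := by
      rw [hX.exact, LinearMap.mem_ker, ← hc, LinearMap.comp_apply, hy, ← LinearMap.mem_ker,
        ← hX.exact]
      exact LinearMap.mem_range_self _ _
    obtain ⟨z, rfl⟩ := hy'
    have hz : X.d (c.f₁ z) = c.f₀ (X.d z) := LinearMap.congr_fun c.comm z
    have : x = (x - c.f₁ z) + c.f₁ z := by abel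
    rw [this]
    exact Submodule.add_mem_sup (by simp [hz, hy]) (LinearMap.mem_range_self _ _)
  exact ⟨IsNoetherian.injective_of_surjective_endomorphism _ hs, hs⟩

/-- Minimal presentations are unique up to isomorphism. -/
theorem IsMinimalPresentation.exists_equiv [IsArtinianRing Λᵐᵒᵖ] {X Y : TwoTerm Λ}
    {π : X.P₀.obj →ₗ[Λᵐᵒᵖ] M} {ρ : Y.P₀.obj →ₗ[Λᵐᵒᵖ] N} (hX : IsMinimalPresentation X π)
    (hY : IsMinimalPresentation Y ρ) (f : M ≃ₗ[Λᵐᵒᵖ] N) :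
    ∃ (a₁ : X.P₁.obj ≃ₗ[Λᵐᵒᵖ] Y.P₁.obj) (a₀ : X.P₀.obj ≃ₗ[Λᵐᵒᵖ] Y.P₀.obj),
      ∀ x, Y.d (a₁ x) = a₀ (X.d x) := by
  obtain ⟨a, ha⟩ := TwoTerm.exists_map_lift hX.exact.le hY.surjective hY.exact f.toLinearMap
  obtain ⟨b, hb⟩ := TwoTerm.exists_map_lift hY.exact.le hX.surjective hX.exact f.symm.toLinearMap
  have ha' : ∀ x, ρ (a.f₀ x) = f (π x) := LinearMap.congr_fun ha
  have hb' : ∀ x, π (b.f₀ x) = f.symm (ρ x) := LinearMap.congr_fun hb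
  have hba := hX.bijective_map (b.comp a) (LinearMap.ext fun x => by simp [ha', hb'])
  have hab := hY.bijective_map (a.comp b) (LinearMap.ext fun x => by simp [ha', hb'])
  exact ⟨.ofBijective _ (bijective_of_comp hba.1 hab.1),
    .ofBijective _ (bijective_of_comp hba.2 hab.2), LinearMap.congr_fun a.comm⟩

theorem IsMinimalPresentation.sum {m : ℕ} {X : Fin m → TwoTerm Λ} {M : Fin m → Type*}
    [∀ i, AddCommGroup (M i)] [∀ i, Module Λᵐᵒᵖ (M i)]
    {π : ∀ i, (X i).P₀.obj →ₗ[Λᵐᵒᵖ] M i} (hX : ∀ i, IsMinimalPresentation (X i) (π i)) :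
    IsMinimalPresentation (TwoTerm.sum X)
      (LinearMap.pi fun i => π i ∘ₗ LinearMap.proj (φ := fun i => (X i).P₀.obj) i) where
  surjective y := by
    choose x hx using fun i => (hX i).surjective (y i)
    exact ⟨x, funext hx⟩
  exact := by
    ext x
    constructor
    · rintro ⟨y, rfl⟩
      refine funext fun i => ?_
      have : (X i).d (y i) ∈ LinearMap.ker (π i) := (hX i).exact ▸ ⟨y i, rfl⟩
      exact this
    · intro hx
      have : ∀ i, ∃ y, (X i).d y = x i := fun i => by
        have h : x i ∈ LinearMap.ker (π i) := congrFun hx i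
        rwa [← (hX i).exact] at h
      choose y hy using this
      exact ⟨y, funext hy⟩
  superfluous₀ := (IsSuperfluous.pi fun i => (hX i).superfluous₀).mono fun x hx i _ =>
    congrFun (f := fun i => π i (x i)) hx i
  superfluous₁ := (IsSuperfluous.pi fun i => (hX i).superfluous₁).mono fun x hx i _ =>
    congrFun (f := fun i => (X i).d (x i)) hx i

end MinimalPresentation

namespace TauPair

/-- The 2-term object `X` corresponds to the pair `V = (M, P)`: it is isomorphic to
`(P₁ ⟶ P₀) ⊕ (P ⟶ 0)` with `P₁ ⟶ P₀` a minimal projective presentation of `M`. -/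
def Corresponds (V : TauPair Λ) (X : TwoTerm Λ) : Prop :=
  ∃ (Y : TwoTerm Λ) (π : Y.P₀.obj →ₗ[Λᵐᵒᵖ] V.M), IsMinimalPresentation Y π ∧
    X.IsIsomorphic (Y.addShift V.P)

theorem exists_corresponds [IsArtinianRing Λᵐᵒᵖ] (V : TauPair Λ) : ∃ X, V.Corresponds X := by
  obtain ⟨Y, π, h⟩ := exists_isMinimalPresentation (Λ := Λ) V.M
  exact ⟨_, Y, π, h, .refl _⟩

theorem Corresponds.isIsomorphic [IsArtinianRing Λᵐᵒᵖ] {V V' : TauPair Λ} {X X' : TwoTerm Λ}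
    (h : V.Corresponds X)
    (h' : V'.Corresponds X') (hV : V.IsIsomorphic V') : X.IsIsomorphic X' := by
  obtain ⟨Y, π, hY, hX⟩ := h
  obtain ⟨Y', π', hY', hX'⟩ := h'
  obtain ⟨⟨f⟩, ⟨g⟩⟩ := hV
  obtain ⟨a₁, a₀, ha⟩ := hY.exists_equiv hY' f
  refine (hX.trans ?_).trans hX'.symm
  refine .of_equiv (X := Y.addShift V.P) (Y := Y'.addShift V'.P) (a₁.prodCongr g) a₀ ?_
  exact fun x => ha x.1

theorem Corresponds.of_isIsomorphic {V : TauPair Λ} {X X' : TwoTerm Λ} (h : V.Corresponds X)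
    (h' : X.IsIsomorphic X') : V.Corresponds X' := by
  obtain ⟨Y, π, hY, hX⟩ := h
  exact ⟨Y, π, hY, h'.symm.trans hX⟩

/-- Homotopies change maps in degree `0` by elements of the image of the differential, so the
cokernel `M` is determined. In degree `-1` they factor through the differential and hence vanish on
`0 × P`; the interference of `P₁` with `P` passes through `ker Y.d`, which is superfluous, so `P` is
determined as well. -/
theorem Corresponds.isIsomorphic_of [IsArtinianRing Λᵐᵒᵖ] {V V' : TauPair Λ} {X X' : TwoTerm Λ}
    (h : V.Corresponds X)
    (h' : V'.Corresponds X') (hX : X.IsIsomorphic X') : V.IsIsomorphic V' := by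
  obtain ⟨Y, π, hY, hXY⟩ := h
  obtain ⟨Y', π', hY', hXY'⟩ := h'
  obtain ⟨⟨a₁, a₀, ha⟩, ⟨b₁, b₀, hb⟩, ⟨s, hs₁, hs₀⟩, ⟨t, ht₁, ht₀⟩⟩ :=
    TwoTerm.isIsomorphic_iff.1 ((hXY.symm.trans hX).trans hXY')
  change Y.P₁.obj × V.P.obj →ₗ[Λᵐᵒᵖ] Y'.P₁.obj × V'.P.obj at a₁
  change Y'.P₁.obj × V'.P.obj →ₗ[Λᵐᵒᵖ] Y.P₁.obj × V.P.obj at b₁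
  change Y.P₀.obj →ₗ[Λᵐᵒᵖ] Y'.P₀.obj at a₀
  change Y'.P₀.obj →ₗ[Λᵐᵒᵖ] Y.P₀.obj at b₀
  have ha' : ∀ x, Y'.d (a₁ x).1 = a₀ (Y.d x.1) := LinearMap.congr_fun ha
  have hb' : ∀ x, Y.d (b₁ x).1 = b₀ (Y'.d x.1) := LinearMap.congr_fun hb
  have hs₁' : ∀ x, b₁ (a₁ x) = x + s (Y.d x.1) := LinearMap.congr_fun hs₁
  have hs₀' : ∀ x, b₀ (a₀ x) = x + Y.d (s x).1 := LinearMap.congr_fun hs₀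
  have ht₁' : ∀ x, a₁ (b₁ x) = x + t (Y'.d x.1) := LinearMap.congr_fun ht₁
  have ht₀' : ∀ x, a₀ (b₀ x) = x + Y'.d (t x).1 := LinearMap.congr_fun ht₀
  constructor
  · obtain ⟨f, hf⟩ := exists_comp_eq_of_ker_le hY.surjective (g := π' ∘ₗ a₀) (by
      intro x hx
      rw [← hY.exact] at hx
      obtain ⟨y, rfl⟩ := hx
      have := ha' (y, 0)
      rw [LinearMap.mem_ker, LinearMap.comp_apply, ← this, hY'.map_d])
    obtain ⟨g, hg⟩ := exists_comp_eq_of_ker_le hY'.surjective (g := π ∘ₗ b₀) (by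
      intro x hx
      rw [← hY'.exact] at hx
      obtain ⟨y, rfl⟩ := hx
      have := hb' (y, 0)
      rw [LinearMap.mem_ker, LinearMap.comp_apply, ← this, hY.map_d])
    have hf' : ∀ x, f (π x) = π' (a₀ x) := LinearMap.congr_fun hf
    have hg' : ∀ x, g (π' x) = π (b₀ x) := LinearMap.congr_fun hg
    refine ⟨LinearEquiv.ofLinearMap f g ?_ ?_⟩
    · refine LinearMap.ext fun y => ?_
      obtain ⟨x, rfl⟩ := hY'.surjective y
      rw [LinearMap.comp_apply, hg', hf', ht₀', map_add, hY'.map_d, add_zero, LinearMap.id_apply]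
    · refine LinearMap.ext fun y => ?_
      obtain ⟨x, rfl⟩ := hY.surjective y
      rw [LinearMap.comp_apply, hf', hg', hs₀', map_add, hY.map_d, add_zero, LinearMap.id_apply]
  · refine ⟨.ofBijective _ (bijective_of_comp
      (bijective_comp_components hY'.superfluous₁ a₁ b₁ (fun x => ?_) (fun x => ?_))
      (bijective_comp_components hY.superfluous₁ b₁ a₁ (fun x => ?_) (fun x => ?_)))⟩
    · rw [ha', map_zero, map_zero]
    · rw [hs₁', map_zero, map_zero, add_zero]
    · rw [hb', map_zero, map_zero]
    · rw [ht₁', map_zero, map_zero, add_zero]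

/-- If `M = 0` then `ker π` is everything and superfluous, so `P₀ = 0`, and then `P₁ = 0` for the
same reason. Conversely, bijectivity of `P₁ ⊕ P → P₀` forces `P = 0` and makes `P₁ → P₀` surjective,
so its cokernel `M` vanishes. -/
theorem Corresponds.isZero_iff {V : TauPair Λ} {X : TwoTerm Λ} (h : V.Corresponds X) :
    V.IsZero ↔ Limits.IsZero X.toK := by
  obtain ⟨Y, π, hY, hX⟩ := h
  rw [hX.isZero_iff, TwoTerm.isZero_toK_iff]
  constructor
  · rintro ⟨h, h'⟩
    have h₀ : Subsingleton Y.P₀.obj := by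
      have : LinearMap.ker π = ⊤ := eq_top_iff.2 fun x _ => Subsingleton.elim _ _
      have h2 := hY.superfluous₀ ⊥ (by rw [this, top_sup_eq])
      exact (Submodule.subsingleton_iff Λᵐᵒᵖ).1 (subsingleton_of_bot_eq_top h2)
    have h₁ : Subsingleton Y.P₁.obj := by
      have : LinearMap.ker Y.d = ⊤ := eq_top_iff.2 fun x _ => Subsingleton.elim _ _
      have h2 := hY.superfluous₁ ⊥ (by rw [this, top_sup_eq])
      exact (Submodule.subsingleton_iff Λᵐᵒᵖ).1 (subsingleton_of_bot_eq_top h2)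
    exact ⟨fun x y _ => Prod.ext (h₁.elim _ _) (h'.elim _ _), fun x => ⟨0, h₀.elim _ _⟩⟩
  · rintro ⟨hi, hs⟩
    constructor
    · refine ⟨fun x y => ?_⟩
      have : ∀ x : V.M, x = 0 := fun x => by
        obtain ⟨x, rfl⟩ := hY.surjective x
        obtain ⟨y, rfl⟩ := hs x
        exact hY.map_d y.1
      rw [this x, this y]
    · exact ⟨fun x y => congrArg Prod.snd (@hi ((0 : Y.P₁.obj), x) ((0 : Y.P₁.obj), y) rfl)⟩

theorem Corresponds.sum {m : ℕ} {V : Fin m → TauPair Λ} {X : Fin m → TwoTerm Λ}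
    (h : ∀ i, (V i).Corresponds (X i)) : (TauPair.sum V).Corresponds (TwoTerm.sum X) := by
  choose Y π hY hX using h
  refine ⟨TwoTerm.sum Y, _, IsMinimalPresentation.sum hY, (TwoTerm.IsIsomorphic.sum hX).trans ?_⟩
  refine TwoTerm.IsIsomorphic.of_equiv ?_ (LinearEquiv.refl _ _) ?_
  · exact
      { toFun := fun x => (fun i => (x i).1, fun i => (x i).2)
        invFun := fun x i => (x.1 i, x.2 i)
        map_add' := fun _ _ => rfl
        map_smul' := fun _ _ => rfl
        left_inv := fun _ => rfl
        right_inv := fun _ => rfl }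
  · exact fun x => rfl

/-- Every 2-term object corresponds to a pair. -/
theorem exists_corresponds_of_twoTerm [IsArtinianRing Λᵐᵒᵖ] (X : TwoTerm Λ) :
    ∃ V : TauPair Λ, V.Corresponds X := by
  -- `M` is the cokernel of `X.d`. Its minimal presentation `Y` splits off from `X`, and the
  -- complement turns out to be a contractible object plus some `P → 0`.
  let π : X.P₀.obj →ₗ[Λᵐᵒᵖ] X.P₀.obj ⧸ LinearMap.range X.d := (LinearMap.range X.d).mkQ
  have hπ : LinearMap.range X.d = LinearMap.ker π := (Submodule.ker_mkQ _).symm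
  obtain ⟨Y, ρ, hY⟩ := exists_isMinimalPresentation (Λ := Λ) (X.P₀.obj ⧸ LinearMap.range X.d)
  obtain ⟨a, ha⟩ := TwoTerm.exists_map_lift hY.exact.le (Submodule.mkQ_surjective _) hπ
    LinearMap.id
  obtain ⟨b', hb'⟩ := TwoTerm.exists_map_lift hπ.le hY.surjective hY.exact LinearMap.id
  have hc := hY.bijective_map (b'.comp a) (by
    rw [TwoTerm.Map.comp_f₀, ← LinearMap.comp_assoc, hb', LinearMap.id_comp, ha,
      LinearMap.id_comp])
  let E₁ := LinearEquiv.ofBijective _ hc.1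
  let E₀ := LinearEquiv.ofBijective _ hc.2
  have hE₁ : ∀ x, E₁ x = b'.f₁ (a.f₁ x) := fun x => rfl
  have hE₀ : ∀ x, E₀ x = b'.f₀ (a.f₀ x) := fun x => rfl
  have ha' : ∀ x, X.d (a.f₁ x) = a.f₀ (Y.d x) := LinearMap.congr_fun a.comm
  have hb'' : ∀ x, Y.d (b'.f₁ x) = b'.f₀ (X.d x) := LinearMap.congr_fun b'.comm
  have hEd : ∀ x, Y.d (E₁ x) = E₀ (Y.d x) := fun x => by rw [hE₁, hE₀, hb'', ha']
  -- Dividing by the automorphism `b' ∘ a` of `Y` turns `b'` into a strict left inverse of `a`.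
  let b₁ : X.P₁.obj →ₗ[Λᵐᵒᵖ] Y.P₁.obj := E₁.symm.toLinearMap ∘ₗ b'.f₁
  let b₀ : X.P₀.obj →ₗ[Λᵐᵒᵖ] Y.P₀.obj := E₀.symm.toLinearMap ∘ₗ b'.f₀
  have hba₁ : ∀ x, b₁ (a.f₁ x) = x := fun x => E₁.symm_apply_apply x
  have hba₀ : ∀ x, b₀ (a.f₀ x) = x := fun x => E₀.symm_apply_apply x
  have hb : ∀ x, Y.d (b₁ x) = b₀ (X.d x) := fun x => by
    change _ = E₀.symm _
    rw [LinearEquiv.eq_symm_apply, ← hEd]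
    change Y.d (E₁ (E₁.symm _)) = _
    rw [LinearEquiv.apply_symm_apply, hb'']
  -- The complement of `Y` is `ker b₁ → ker b₀`. It is surjective because `X` and `Y` have the same
  -- cokernel, so the projection `1 - a₀ b₀` lifts along it; the lift `σ` serves as the contracting
  -- homotopy.
  obtain ⟨σ, hσ⟩ := exists_lift_of_range_le (X.d ∘ₗ (LinearMap.ker b₁).subtype)
    (LinearMap.id - a.f₀ ∘ₗ b₀) (by
      rintro _ ⟨p, rfl⟩
      have h0 : b₀ (p - a.f₀ (b₀ p)) = 0 := by rw [map_sub, hba₀, sub_self]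
      have h1 : π (p - a.f₀ (b₀ p)) = 0 := by
        have h2 : ρ (b'.f₀ (p - a.f₀ (b₀ p))) = π (p - a.f₀ (b₀ p)) :=
          LinearMap.congr_fun hb' _
        have h3 : b'.f₀ (p - a.f₀ (b₀ p)) = 0 := by
          have : E₀.symm (b'.f₀ (p - a.f₀ (b₀ p))) = 0 := h0
          rwa [LinearEquiv.map_eq_zero_iff] at this
        rw [← h2, h3, map_zero]
      rw [← LinearMap.mem_ker, ← hπ] at h1
      obtain ⟨x, hx⟩ := h1
      have h4 : Y.d (b₁ x) = 0 := by rw [hb, hx, h0]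
      refine ⟨⟨x - a.f₁ (b₁ x), ?_⟩, ?_⟩
      · rw [LinearMap.mem_ker, map_sub, hba₁, sub_self]
      · change X.d (x - a.f₁ (b₁ x)) = p - a.f₀ (b₀ p)
        rw [map_sub, ha', h4, map_zero, sub_zero, hx])
  have hσ₀ : ∀ p, X.d (σ p).1 = p - a.f₀ (b₀ p) := LinearMap.congr_fun hσ
  have hσ₁ : ∀ p, b₁ (σ p).1 = 0 := fun p => (σ p).2
  -- `K` is the kernel of `ker b₁ → ker b₀`, a direct summand of `X.P₁` by means of `q`. It is the
  -- projective module of the pair.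
  let K : Submodule Λᵐᵒᵖ X.P₁.obj := LinearMap.ker b₁ ⊓ LinearMap.ker X.d
  let q : X.P₁.obj →ₗ[Λᵐᵒᵖ] K := LinearMap.codRestrict K
    (LinearMap.id - a.f₁ ∘ₗ b₁ - (LinearMap.ker b₁).subtype ∘ₗ σ ∘ₗ X.d) (fun x => by
      constructor
      · change b₁ (x - a.f₁ (b₁ x) - (σ (X.d x)).1) = 0
        rw [map_sub, map_sub, hba₁, hσ₁, sub_self, sub_zero]
      · change X.d (x - a.f₁ (b₁ x) - (σ (X.d x)).1) = 0
        rw [map_sub, map_sub, ha', hσ₀, hb, sub_self])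
  have hq : ∀ x, (q x : X.P₁.obj) = x - a.f₁ (b₁ x) - (σ (X.d x)).1 := fun x => rfl
  have hqK : ∀ x : K, q x = x := fun x => by
    have h1 : b₁ x.1 = 0 := x.2.1
    have h2 : X.d x.1 = 0 := x.2.2
    refine Subtype.ext ?_
    rw [hq, h1, h2, map_zero, map_zero, sub_zero]
    simp
  have hKp : Module.Projective Λᵐᵒᵖ K :=
    Module.Projective.of_split K.subtype q (LinearMap.ext hqK)
  let P : ProjCat Λ := ⟨ModuleCat.of Λᵐᵒᵖ K, inferInstanceAs (Module.Finite Λᵐᵒᵖ K), hKp⟩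
  refine ⟨⟨ModuleCat.of Λᵐᵒᵖ (X.P₀.obj ⧸ LinearMap.range X.d),
    inferInstanceAs (Module.Finite Λᵐᵒᵖ (X.P₀.obj ⧸ LinearMap.range X.d)), P⟩, Y, ρ, hY, ?_⟩
  refine TwoTerm.isIsomorphic_iff.2
    ⟨⟨b₁.prod q, b₀, LinearMap.ext hb⟩, ⟨a.f₁.coprod K.subtype, a.f₀, ?_⟩,
      ⟨-((LinearMap.ker b₁).subtype ∘ₗ σ), ?_, ?_⟩,
      -- The homotopy `σ ∘ a₀` takes values in `K`, since `d σ a₀ = a₀ - a₀ b₀ a₀ = 0`.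
      ⟨(0 : Y.P₀.obj →ₗ[Λᵐᵒᵖ] Y.P₁.obj).prod (-LinearMap.codRestrict K
        ((LinearMap.ker b₁).subtype ∘ₗ σ ∘ₗ a.f₀) fun p => ⟨hσ₁ _, ?_⟩), ?_, ?_⟩⟩
  · refine LinearMap.ext fun x => ?_
    change X.d (a.f₁ x.1 + x.2.1) = a.f₀ (Y.d x.1)
    have h2 : X.d x.2.1 = 0 := x.2.2.2
    rw [map_add, h2, add_zero, ha']
  · refine LinearMap.ext fun x => ?_
    change a.f₁ (b₁ x) + (q x).1 = x + -(σ (X.d x)).1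
    rw [hq]
    abel
  · refine LinearMap.ext fun x => ?_
    change a.f₀ (b₀ x) = x + X.d (-(σ x).1)
    rw [map_neg, hσ₀]
    abel
  · change X.d (σ (a.f₀ p)).1 = 0
    rw [hσ₀, hba₀, sub_self]
  · refine LinearMap.ext fun x => Prod.ext ?_ (Subtype.ext ?_)
    · change b₁ (a.f₁ x.1 + x.2.1) = x.1 + 0
      have h1 : b₁ x.2.1 = 0 := x.2.2.1
      rw [map_add, h1, hba₁]
    · change (q (a.f₁ x.1 + x.2.1) : X.P₁.obj) = x.2.1 + -(σ (a.f₀ (Y.d x.1))).1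
      rw [map_add, hqK, Submodule.coe_add, hq, hba₁, ha', sub_self, zero_sub, add_comm]
  · refine LinearMap.ext fun x => ?_
    change b₀ (a.f₀ x) = x + Y.d 0
    rw [hba₀, map_zero, add_zero]

/-- A pair is indecomposable if and only if the corresponding 2-term object is. -/
theorem Corresponds.isIndecomposable_iff [IsArtinianRing Λᵐᵒᵖ] {V : TauPair Λ} {X : TwoTerm Λ}
    (h : V.Corresponds X) :
    V.IsIndecomposable ↔ X.IsIndecomposable := by
  have hsum : ∀ {V₁ V₂ : TauPair Λ} {X₁ X₂ : TwoTerm Λ}, V₁.Corresponds X₁ → V₂.Corresponds X₂ →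
      (TauPair.sum ![V₁, V₂]).Corresponds (TwoTerm.sum ![X₁, X₂]) := fun h₁ h₂ =>
    Corresponds.sum (by
      intro i
      fin_cases i
      · exact h₁
      · exact h₂)
  unfold IsIndecomposable TwoTerm.IsIndecomposable
  rw [h.isZero_iff]
  -- Decompositions translate in both directions, because every 2-term object and every pair has a
  -- partner.
  refine and_congr_right fun _ => ⟨fun H Y Z hYZ => ?_, fun H V₁ V₂ hV => ?_⟩
  · obtain ⟨V₁, h₁⟩ := exists_corresponds_of_twoTerm Y
    obtain ⟨V₂, h₂⟩ := exists_corresponds_of_twoTerm Z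
    rw [← h₁.isZero_iff, ← h₂.isZero_iff]
    exact H _ _ (h.isIsomorphic_of (hsum h₁ h₂) hYZ)
  · obtain ⟨Y, h₁⟩ := V₁.exists_corresponds
    obtain ⟨Z, h₂⟩ := V₂.exists_corresponds
    rw [h₁.isZero_iff, h₂.isZero_iff]
    exact H _ _ (h.isIsomorphic (hsum h₁ h₂) hV)

end TauPair

end SiltingCorner

/-! ### Rigidity of pairs and of 2-term objects. -/

namespace SiltingCorner

section DualBasis

variable {Λ : Type v} [Ring Λ]

/-- Finitely generated projective right modules have finite dual bases. -/
theorem exists_dualBasis (P : Type*) [AddCommGroup P] [Module Λᵐᵒᵖ P] [Module.Finite Λᵐᵒᵖ P]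
    [Module.Projective Λᵐᵒᵖ P] : ∃ (m : ℕ) (x : Fin m → P) (φ : Fin m → P →ₗ[Λᵐᵒᵖ] Λ),
      ∀ p, p = ∑ i, op (φ i p) • x i := by
  obtain ⟨m, π, hπ⟩ := Module.Finite.exists_fin' Λᵐᵒᵖ P
  obtain ⟨s, hs⟩ := Module.projective_lifting_property π LinearMap.id hπ
  refine ⟨m, fun i => π (Pi.single i 1), fun i =>
    { toFun := fun p => unop (s p i)
      map_add' := fun p q => by rw [map_add]; rfl
      map_smul' := fun a p => by rw [map_smul]; rfl }, fun p => ?_⟩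
  have h : π (s p) = p := LinearMap.congr_fun hs p
  conv_lhs => rw [← h, pi_eq_sum_univ' (s p), map_sum]
  refine Finset.sum_congr rfl fun i _ => ?_
  rw [map_smul]
  rfl

/-- The map `x ↦ m · φ(x)`. -/
def rankOne {P M : Type*} [AddCommGroup P] [Module Λᵐᵒᵖ P] [AddCommGroup M] [Module Λᵐᵒᵖ M]
    (m : M) (φ : P →ₗ[Λᵐᵒᵖ] Λ) : P →ₗ[Λᵐᵒᵖ] M where
  toFun x := op (φ x) • m
  map_add' x y := by rw [map_add, MulOpposite.op_add, add_smul]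
  map_smul' a x := by
    rw [map_smul, RingHom.id_apply, ← mul_smul]
    rfl

end DualBasis

section Tau

variable {Λ : Type v} [Ring Λ] (k : Type u) [Field k] [Algebra k Λ]

/-- `Hom(M, D Tr X) = 0` if and only if all maps `P₁ ⟶ M` factor through `P₁ ⟶ P₀`. -/
theorem forall_hom_tau_eq_zero_iff (X : TwoTerm Λ) (M : Type*) [AddCommGroup M]
    [Module Λᵐᵒᵖ M] : (∀ f : M →ₗ[Λᵐᵒᵖ] X.Tau k, f = 0) ↔
      ∀ g : X.P₁.obj →ₗ[Λᵐᵒᵖ] M, ∃ h : X.P₀.obj →ₗ[Λᵐᵒᵖ] M, h ∘ₗ X.d = g := by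
  let _ : Module k M := Module.compHom M (algebraMap k Λᵐᵒᵖ)
  have : IsScalarTower k Λᵐᵒᵖ M := IsScalarTower.of_algebraMap_smul fun _ _ => rfl
  obtain ⟨m₁, y, ψ, hψ⟩ := exists_dualBasis (Λ := Λ) X.P₁.obj
  constructor
  · intro H g
    let W : Submodule k (X.P₁.obj →ₗ[Λᵐᵒᵖ] M) := LinearMap.range
      ({ toFun := fun h => h ∘ₗ X.d, map_add' := fun _ _ => rfl, map_smul' := fun _ _ => rfl } :
        (X.P₀.obj →ₗ[Λᵐᵒᵖ] M) →ₗ[k] (X.P₁.obj →ₗ[Λᵐᵒᵖ] M))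
    by_contra hg
    have hgW : g ∉ W := fun ⟨h, hh⟩ => hg ⟨h, hh⟩
    -- A `k`-linear form `θ` separates `g` from the maps that factor. Then `m ↦ (φ ↦ θ(m · φ))` is a
    -- map from `M` to the dual of the transpose, hence zero. Since `g` is a sum of rank-one maps,
    -- `θ(g) = 0`, a contradiction.
    obtain ⟨θ, hθg, hθW⟩ := Submodule.exists_le_ker_of_notMem hgW
    let T : M → (X.P₁.obj →ₗ[Λᵐᵒᵖ] Λ) →ₗ[k] k := fun m => θ ∘ₗ
      ({ toFun := fun φ => rankOne m φ
         map_add' := fun φ φ' => LinearMap.ext fun x => add_smul (op (φ x)) (op (φ' x)) m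
         map_smul' := fun c φ => LinearMap.ext fun x => smul_assoc c (op (φ x)) m } :
        (X.P₁.obj →ₗ[Λᵐᵒᵖ] Λ) →ₗ[k] (X.P₁.obj →ₗ[Λᵐᵒᵖ] M))
    have hT : ∀ m, (LinearMap.range X.dStar).restrictScalars k ≤ LinearMap.ker (T m) := by
      rintro m _ ⟨φ, rfl⟩
      exact hθW ⟨rankOne m φ, rfl⟩
    let F₀ : M → X.Tau k := fun m =>
      (Submodule.liftQ _ (T m) (hT m)) ∘ₗ
        (Submodule.Quotient.restrictScalarsEquiv k (LinearMap.range X.dStar)).symm.toLinearMap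
    have hF₀ : ∀ m φ, (show X.Tr →ₗ[k] k from F₀ m) (Submodule.Quotient.mk φ) =
        θ (rankOne m φ) := fun m φ => rfl
    let F : M →ₗ[Λᵐᵒᵖ] X.Tau k :=
      { toFun := F₀
        map_add' := fun m m' => by
          refine LinearMap.ext fun t => ?_
          obtain ⟨φ, rfl⟩ := Submodule.Quotient.mk_surjective _ t
          change θ (rankOne (m + m') φ) = θ (rankOne m φ) + θ (rankOne m' φ)
          rw [← map_add]
          exact congrArg θ (LinearMap.ext fun x => smul_add (op (φ x)) m m')
        map_smul' := fun a m => by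
          refine LinearMap.ext fun t => ?_
          obtain ⟨φ, rfl⟩ := Submodule.Quotient.mk_surjective _ t
          change θ (rankOne (a • m) φ) = θ (rankOne m (a.unop • φ))
          exact congrArg θ (LinearMap.ext fun x => (mul_smul (op (φ x)) a m).symm) }
    have hF : ∀ m φ, θ (rankOne m φ) = 0 := fun m φ =>
      LinearMap.congr_fun (f := (show X.Tr →ₗ[k] k from F m)) (LinearMap.congr_fun (H F) m)
        (Submodule.Quotient.mk φ)
    refine hθg ?_
    have hsum : g = ∑ j, rankOne (g (y j)) (ψ j) := by
      refine LinearMap.ext fun p => ?_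
      conv_lhs => rw [hψ p, map_sum]
      rw [LinearMap.sum_apply]
      exact Finset.sum_congr rfl fun j _ => map_smul _ _ _
    rw [hsum, map_sum]
    exact Finset.sum_eq_zero fun j _ => hF _ _
  · intro H f
    obtain ⟨m₀, x, φ, hφ⟩ := exists_dualBasis (Λ := Λ) X.P₀.obj
    -- The pairing `b` is balanced over `Λ`. Expanding `χ` in the dual basis of `P₁`, replacing `m ·
    -- χ` by `h ∘ d` and expanding in the dual basis of `P₀` leaves only the classes of `φ i ∘ d`,
    -- which are zero in the transpose.
    let b : M → X.Tr → k := fun m t => (show X.Tr →ₗ[k] k from f m) t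
    have hb_smul : ∀ (a : Λ) m t, b (op a • m) t = b m (a • t) := fun a m t => by
      simp only [b, map_smul]
      rfl
    have hb_sum : ∀ {ι : Type} (s : Finset ι) (m : ι → M) t,
        b (∑ i ∈ s, m i) t = ∑ i ∈ s, b (m i) t := fun s m t => by
      simp only [b, map_sum]
      exact LinearMap.sum_apply s (fun i => (show X.Tr →ₗ[k] k from f (m i))) t
    have hb_sum' : ∀ {ι : Type} (s : Finset ι) m (t : ι → X.Tr),
        b m (∑ i ∈ s, t i) = ∑ i ∈ s, b m (t i) := fun s m t =>
      map_sum (show X.Tr →ₗ[k] k from f m) t s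
    have hexp : ∀ χ : X.P₁.obj →ₗ[Λᵐᵒᵖ] Λ, (Submodule.Quotient.mk χ : X.Tr) =
        ∑ j, χ (y j) • (Submodule.Quotient.mk (ψ j) : X.Tr) := fun χ => by
      have : χ = ∑ j, χ (y j) • ψ j := by
        refine LinearMap.ext fun p => ?_
        conv_lhs => rw [hψ p, map_sum]
        rw [LinearMap.sum_apply]
        exact Finset.sum_congr rfl fun j _ => map_smul _ _ _
      conv_lhs => rw [this]
      exact map_sum (Submodule.mkQ (LinearMap.range X.dStar)) _ _
    refine LinearMap.ext fun m => LinearMap.ext fun t => ?_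
    obtain ⟨χ, rfl⟩ := Submodule.Quotient.mk_surjective _ t
    change b m (Submodule.Quotient.mk χ) = 0
    obtain ⟨h, hh⟩ := H (rankOne m χ)
    have hh' : ∀ p, op (χ p) • m = ∑ i, op (φ i (X.d p)) • h (x i) := fun p => by
      have : h (X.d p) = op (χ p) • m := LinearMap.congr_fun hh p
      rw [← this]
      conv_lhs => rw [hφ (X.d p), map_sum]
      exact Finset.sum_congr rfl fun j _ => map_smul _ _ _
    calc b m (Submodule.Quotient.mk χ)
        = ∑ j, ∑ i, b (h (x i)) (φ i (X.d (y j)) • Submodule.Quotient.mk (ψ j)) := by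
          rw [hexp, hb_sum']
          refine Finset.sum_congr rfl fun j _ => ?_
          rw [← hb_smul, hh', hb_sum]
          exact Finset.sum_congr rfl fun i _ => hb_smul _ _ _
      _ = ∑ i, b (h (x i)) (Submodule.Quotient.mk (φ i ∘ₗ X.d)) := by
          rw [Finset.sum_comm]
          refine Finset.sum_congr rfl fun i _ => ?_
          rw [hexp (φ i ∘ₗ X.d), hb_sum']
          rfl
      _ = 0 := Finset.sum_eq_zero fun i _ => by
          have : (Submodule.Quotient.mk (φ i ∘ₗ X.d) : X.Tr) = 0 :=
            (Submodule.Quotient.mk_eq_zero _).2 ⟨φ i, rfl⟩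
          rw [this]
          exact map_zero (show X.Tr →ₗ[k] k from f (h (x i)))

end Tau

namespace TauPair

variable {Λ : Type v} [Ring Λ]

/-- Rigidity of `(P₁ ⟶ P₀) ⊕ (P ⟶ 0)` in terms of the cokernel of `P₁ ⟶ P₀`. -/
theorem isRigid_addShift_iff {Y : TwoTerm Λ} {M : Type*} [AddCommGroup M] [Module Λᵐᵒᵖ M]
    {π : Y.P₀.obj →ₗ[Λᵐᵒᵖ] M} (hπ : Function.Surjective π)
    (hY : LinearMap.range Y.d = LinearMap.ker π) (P : ProjCat Λ) : (Y.addShift P).IsRigid ↔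
      (∀ g : Y.P₁.obj →ₗ[Λᵐᵒᵖ] M, ∃ h : Y.P₀.obj →ₗ[Λᵐᵒᵖ] M, h ∘ₗ Y.d = g) ∧
      ∀ f : P.obj →ₗ[Λᵐᵒᵖ] M, f = 0 := by
  have hd : ∀ x, π (Y.d x) = 0 := fun x => by
    rw [← LinearMap.mem_ker, ← hY]; exact ⟨x, rfl⟩
  rw [TwoTerm.isRigid_iff_extVanishes]
  constructor
  · intro H
    constructor
    · intro g
      obtain ⟨f, hf⟩ := Module.projective_lifting_property π g hπ
      -- Rigidity is used for a lift of `g` extended by zero; after composing with `π` the term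
      -- through `Y.d` disappears.
      obtain ⟨h₁, h₀, h⟩ := H (f ∘ₗ LinearMap.fst Λᵐᵒᵖ Y.P₁.obj P.obj)
      refine ⟨π ∘ₗ h₀, LinearMap.ext fun x => ?_⟩
      have h' : f x = Y.d (h₁ (x, 0)).1 + h₀ (Y.d x) := LinearMap.congr_fun h (x, 0)
      rw [← hf, LinearMap.comp_apply, LinearMap.comp_apply, LinearMap.comp_apply, h', map_add, hd,
        zero_add]
    · intro g
      obtain ⟨f, hf⟩ := Module.projective_lifting_property π g hπ
      obtain ⟨h₁, h₀, h⟩ := H (f ∘ₗ LinearMap.snd Λᵐᵒᵖ Y.P₁.obj P.obj)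
      refine LinearMap.ext fun x => ?_
      have h' : f x = Y.d (h₁ (0, x)).1 + h₀ (Y.d 0) := LinearMap.congr_fun h (0, x)
      rw [← hf, LinearMap.comp_apply, h', map_add, hd, map_zero, map_zero, map_zero, zero_add,
        LinearMap.zero_apply]
  · rintro ⟨H₁, H₂⟩ f
    change Y.P₁.obj × P.obj →ₗ[Λᵐᵒᵖ] Y.P₀.obj at f
    -- Subtracting `h₀ ∘ Y.d` makes the component on `P₁` vanish in `M`; the component on `P` does
    -- so by `H₂`. Both then lift along `Y.d`.
    obtain ⟨u, hu⟩ := H₁ (π ∘ₗ f ∘ₗ LinearMap.inl Λᵐᵒᵖ Y.P₁.obj P.obj)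
    obtain ⟨h₀, hh₀⟩ := Module.projective_lifting_property π u hπ
    obtain ⟨k₁, hk₁⟩ := exists_lift_of_range_le Y.d
      (f ∘ₗ LinearMap.inl Λᵐᵒᵖ Y.P₁.obj P.obj - h₀ ∘ₗ Y.d) (by
        rintro _ ⟨x, rfl⟩
        rw [hY, LinearMap.mem_ker, LinearMap.sub_apply, map_sub, sub_eq_zero]
        change (π ∘ₗ f ∘ₗ LinearMap.inl Λᵐᵒᵖ Y.P₁.obj P.obj) x = (π ∘ₗ h₀) (Y.d x)
        rw [← hu, hh₀, LinearMap.comp_apply])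
    obtain ⟨k₂, hk₂⟩ := exists_lift_of_range_le Y.d (f ∘ₗ LinearMap.inr Λᵐᵒᵖ Y.P₁.obj P.obj) (by
        rintro _ ⟨x, rfl⟩
        rw [hY, LinearMap.mem_ker]
        exact LinearMap.congr_fun (H₂ (π ∘ₗ f ∘ₗ LinearMap.inr Λᵐᵒᵖ Y.P₁.obj P.obj)) x)
    have hk₁' : ∀ x, Y.d (k₁ x) = f (x, 0) - h₀ (Y.d x) := LinearMap.congr_fun hk₁
    have hk₂' : ∀ x, Y.d (k₂ x) = f (0, x) := LinearMap.congr_fun hk₂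
    refine ⟨(k₁.coprod k₂).prod 0, h₀, LinearMap.ext fun x => ?_⟩
    change f x = Y.d (k₁ x.1 + k₂ x.2) + h₀ (Y.d x.1)
    rw [map_add, hk₁', hk₂', sub_add_eq_add_sub, sub_add_cancel, ← map_add, Prod.mk_add_mk,
      add_zero, zero_add]

/-- A pair is `τ`-rigid if and only if the corresponding 2-term object is rigid. -/
theorem Corresponds.isRigid_iff (k : Type u) [Field k] [Algebra k Λ] [IsArtinianRing Λᵐᵒᵖ]
    {V : TauPair Λ} {X : TwoTerm Λ} (h : V.Corresponds X) : V.IsRigid k ↔ X.IsRigid := by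
  constructor
  · rintro ⟨⟨Y, π, hY, hτ⟩, hP⟩
    -- The presentation provided by `τ`-rigidity need not be the one behind `h`, but both yield
    -- objects corresponding to the same pair.
    have h' : V.Corresponds (Y.addShift V.P) := ⟨Y, π, hY, .refl _⟩
    rw [(h.isIsomorphic h' ⟨⟨.refl _ _⟩, ⟨.refl _ _⟩⟩).isRigid_iff,
      isRigid_addShift_iff hY.surjective hY.exact]
    exact ⟨(forall_hom_tau_eq_zero_iff k Y V.M).1 hτ, hP⟩
  · intro hX
    obtain ⟨Y, π, hY, hXY⟩ := h
    rw [hXY.isRigid_iff, isRigid_addShift_iff hY.surjective hY.exact] at hX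
    exact ⟨⟨Y, π, hY, (forall_hom_tau_eq_zero_iff k Y V.M).2 hX.1⟩, hX.2⟩

end TauPair

end SiltingCorner

/-! ### The support `τ`-tilting complex is the 2-term silting complex. -/

namespace SiltingCorner

variable {Λ : Type v} [Ring Λ] {k : Type u} [Field k] [Algebra k Λ]

/-- The class of an indecomposable `τ`-rigid pair. -/
def TauVertex.mk (V : TauPair Λ) (h : V.IsIndecomposable) (h' : V.IsRigid k) : TauVertex Λ k :=
  Quotient.mk (tauSetoid Λ k) ⟨V, h, h'⟩

theorem TauVertex.rep_mk {V : TauPair Λ} (h : V.IsIndecomposable) (h' : V.IsRigid k) :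
    (TauVertex.mk V h h').rep.IsIsomorphic V :=
  Quotient.mk_out (s := tauSetoid Λ k) ⟨V, h, h'⟩

theorem TauVertex.isIndecomposable (x : TauVertex Λ k) : x.rep.IsIndecomposable :=
  (Quotient.out (s := tauSetoid Λ k) x).2.1

theorem TauVertex.isRigid (x : TauVertex Λ k) : x.rep.IsRigid k :=
  (Quotient.out (s := tauSetoid Λ k) x).2.2

theorem TauVertex.ext {x y : TauVertex Λ k} (h : x.rep.IsIsomorphic y.rep) : x = y := by
  rw [← Quotient.out_eq (s := tauSetoid Λ k) x, ← Quotient.out_eq (s := tauSetoid Λ k) y]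
  exact Quotient.sound h

variable (Λ k) in
/-- The support `τ`-tilting complex is isomorphic to the 2-term silting complex, the pair `(M, P)`
corresponding to `(P₁ ⟶ P₀) ⊕ (P ⟶ 0)` where `P₁ ⟶ P₀` is a minimal projective presentation
of `M`. -/
theorem exists_tauVertex_equiv_siltingVertex [Module.Finite k Λ] :
    ∃ φ : TauVertex Λ k ≃ SiltingVertex Λ, (∀ x : TauVertex Λ k, x.rep.Corresponds (φ x).rep) ∧
      ∀ F, F ∈ (tauTiltingComplex Λ k).faces ↔
        F.map φ.toEmbedding ∈ (siltingComplex Λ).faces := by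
  have := isArtinianRing_op (Λ := Λ) k
  choose X hX using fun x : TauVertex Λ k => x.rep.exists_corresponds
  let f : TauVertex Λ k → SiltingVertex Λ := fun x => SiltingVertex.mk (X x)
    ((hX x).isIndecomposable_iff.1 x.isIndecomposable) (((hX x).isRigid_iff k).1 x.isRigid)
  have hf : ∀ x : TauVertex Λ k, x.rep.Corresponds (f x).rep := fun x =>
    (hX x).of_isIsomorphic (SiltingVertex.rep_mk _ _).symm
  have hinj : Function.Injective f := fun x y hxy =>
    TauVertex.ext ((hf x).isIsomorphic_of (hf y) (hxy ▸ .refl _))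
  have hsurj : Function.Surjective f := fun z => by
    obtain ⟨V, hV⟩ := TauPair.exists_corresponds_of_twoTerm z.rep
    let x : TauVertex Λ k := TauVertex.mk V (hV.isIndecomposable_iff.2 z.isIndecomposable)
      ((hV.isRigid_iff k).2 z.isRigid)
    exact ⟨x, SiltingVertex.ext ((hf x).isIsomorphic hV (TauVertex.rep_mk _ _))⟩
  refine ⟨Equiv.ofBijective f ⟨hinj, hsurj⟩, hf, fun F => ?_⟩
  rw [siltingComplex_isFlagFor Λ, Finset.map_nonempty]
  simp only [Finset.forall_mem_map]
  change F.Nonempty ∧ TauPair.IsRigid k _ ↔ _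
  rw [(TauPair.Corresponds.sum fun i => hf (F.equivFin.symm i).1).isRigid_iff k,
    TwoTerm.isRigid_sum_iff,
    forall_equivFin_symm F fun x y => TwoTerm.ExtVanishes (f x).rep (f y).rep]
  rfl

end SiltingCorner

/-! ### Projective modules over a corner algebra. -/

namespace SiltingCorner

section CornerModule

variable {Λ : Type v} [Ring Λ] {ε : Λ}

/-- The part `M ε` of a right module. -/
def cornerPart (ε : Λ) (M : Type*) [AddCommGroup M] [Module Λᵐᵒᵖ M] : AddSubgroup M where
  carrier := {m | op ε • m = m}
  zero_mem' := smul_zero _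
  add_mem' {a b} ha hb := by
    rw [Set.mem_ofPred_eq] at *
    rw [smul_add, ha, hb]
  neg_mem' {a} ha := by
    rw [Set.mem_ofPred_eq] at *
    rw [smul_neg, ha]

variable (hε : IsIdempotentElem ε) {M N L : Type*} [AddCommGroup M] [Module Λᵐᵒᵖ M]
  [AddCommGroup N] [Module Λᵐᵒᵖ N] [AddCommGroup L] [Module Λᵐᵒᵖ L]

theorem mul_corner (b : hε.Corner) : ε * b.1 = b.1 := ((Subsemigroup.mem_corner_iff hε).1 b.2).1

theorem corner_mul (b : hε.Corner) : b.1 * ε = b.1 := ((Subsemigroup.mem_corner_iff hε).1 b.2).2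

/-- The elements `a` of `Λ` with `ε a = a = a ε`. -/
def cornerMk (a : Λ) (hleft : ε * a = a) (hright : a * ε = a) : hε.Corner :=
  ⟨a, (Subsemigroup.mem_corner_iff hε).2 ⟨hleft, hright⟩⟩

/-- The inclusion of the corner. -/
def cornerVal : hε.Corner →+ Λ where
  toFun b := b.1
  map_zero' := rfl
  map_add' _ _ := rfl

theorem cornerPart_smul (m : cornerPart ε M) : op ε • m.1 = m.1 := m.2

theorem smul_mem_cornerPart (hε : IsIdempotentElem ε) (m : M) : op ε • m ∈ cornerPart ε M := by
  change op ε • op ε • m = op ε • m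
  rw [← mul_smul, ← op_mul, hε]

/-- The right module structure of `M ε` over `ε Λ ε`. -/
instance cornerPartModule : Module hε.Cornerᵐᵒᵖ (cornerPart ε M) where
  smul b m := ⟨op b.unop.1 • m.1, by
    change op ε • op b.unop.1 • m.1 = op b.unop.1 • m.1
    rw [← mul_smul, ← op_mul, corner_mul]⟩
  one_smul m := Subtype.ext m.2
  mul_smul a b m := Subtype.ext (mul_smul (op a.unop.1) (op b.unop.1) m.1)
  smul_zero b := Subtype.ext (smul_zero (op b.unop.1))
  smul_add b m n := Subtype.ext (smul_add (op b.unop.1) m.1 n.1)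
  add_smul a b m := Subtype.ext (add_smul (op a.unop.1) (op b.unop.1) m.1)
  zero_smul m := Subtype.ext (zero_smul Λᵐᵒᵖ m.1)

/-- The restriction `M ε ⟶ N ε` of a linear map `M ⟶ N`. -/
def cornerHom (f : M →ₗ[Λᵐᵒᵖ] N) : cornerPart ε M →ₗ[hε.Cornerᵐᵒᵖ] cornerPart ε N where
  toFun m := ⟨f m.1, by
    change op ε • f m.1 = f m.1
    rw [← map_smul, cornerPart_smul]⟩
  map_add' m n := Subtype.ext (map_add f m.1 n.1)
  map_smul' b m := Subtype.ext (map_smul f (op b.unop.1) m.1)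

theorem coe_cornerHom (f : M →ₗ[Λᵐᵒᵖ] N) (m : cornerPart ε M) :
    (cornerHom hε f m : N) = f m.1 := rfl

theorem cornerHom_comp (g : N →ₗ[Λᵐᵒᵖ] L) (f : M →ₗ[Λᵐᵒᵖ] N) :
    cornerHom hε (g ∘ₗ f) = cornerHom hε g ∘ₗ cornerHom hε f := rfl

/-- `M` is generated by `M ε`. -/
def IsGeneratedBy (ε : Λ) (M : Type*) [AddCommGroup M] [Module Λᵐᵒᵖ M] : Prop :=
  Submodule.span Λᵐᵒᵖ (cornerPart ε M : Set M) = ⊤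

theorem IsGeneratedBy.map (h : IsGeneratedBy ε M) {f : M →ₗ[Λᵐᵒᵖ] N}
    (hf : Function.Surjective f) : IsGeneratedBy ε N := by
  refine eq_top_iff.2 ?_
  rw [← LinearMap.range_eq_top.2 hf, LinearMap.range_eq_map, ← h, Submodule.map_span]
  refine Submodule.span_mono ?_
  rintro _ ⟨m, hm, rfl⟩
  have hm' : op ε • m = m := hm
  change op ε • f m = f m
  rw [← map_smul, hm']

theorem IsGeneratedBy.pi {ι : Type*} [Fintype ι] {A : ι → Type*} [∀ i, AddCommGroup (A i)]
    [∀ i, Module Λᵐᵒᵖ (A i)] (h : ∀ i, IsGeneratedBy ε (A i)) : IsGeneratedBy ε (∀ i, A i) := by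
  classical
  refine eq_top_iff.2 fun x _ => ?_
  rw [← show ∑ i, Pi.single i (x i) = x from LinearMap.sum_single_apply _ x]
  refine Submodule.sum_mem _ fun i _ => ?_
  have hx : x i ∈ Submodule.span Λᵐᵒᵖ (cornerPart ε (A i) : Set (A i)) := by
    rw [h i]; trivial
  have := Submodule.mem_map_of_mem (f := LinearMap.single Λᵐᵒᵖ A i) hx
  rw [Submodule.map_span] at this
  refine Submodule.span_mono ?_ this
  rintro _ ⟨m, hm, rfl⟩
  have hm' : op ε • m = m := hm
  change op ε • LinearMap.single Λᵐᵒᵖ A i m = _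
  rw [← map_smul, hm']

theorem IsGeneratedBy.hom_ext (h : IsGeneratedBy ε M) {f g : M →ₗ[Λᵐᵒᵖ] N}
    (hfg : cornerHom hε f = cornerHom hε g) : f = g := by
  refine LinearMap.ext_on h fun m hm => ?_
  exact congrArg Subtype.val (LinearMap.congr_fun hfg ⟨m, hm⟩)

/-- Dual bases with elements of `P ε`. -/
theorem IsGeneratedBy.exists_dualBasis {P : Type w} [AddCommGroup P] [Module Λᵐᵒᵖ P]
    [Module.Finite Λᵐᵒᵖ P] [Module.Projective Λᵐᵒᵖ P] (h : IsGeneratedBy ε P)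
    (hε : IsIdempotentElem ε) :
    ∃ (ι : Type w) (_ : Fintype ι) (x : ι → cornerPart ε P) (φ : ι → P →ₗ[Λᵐᵒᵖ] Λ),
      (∀ i p, ε * φ i p = φ i p) ∧ ∀ p, p = ∑ i, op (φ i p) • (x i : P) := by
  have hfg : (Submodule.span Λᵐᵒᵖ (cornerPart ε P : Set P)).FG := by
    have h' : Submodule.span Λᵐᵒᵖ (cornerPart ε P : Set P) = ⊤ := h
    rw [h']
    exact Module.Finite.fg_top
  obtain ⟨S, hS, hspan⟩ := (Submodule.fg_span_iff_fg_span_finset_subset _).1 hfg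
  have hsurj : Function.Surjective (Fintype.linearCombination Λᵐᵒᵖ (fun s : S => (s : P))) := by
    rw [← LinearMap.range_eq_top, Fintype.range_linearCombination, Subtype.range_coe_subtype]
    exact hspan.symm.trans h
  obtain ⟨s, hs⟩ := Module.projective_lifting_property _ LinearMap.id hsurj
  -- Coefficients may be multiplied by `ε` from the left, because the generators in `S` are fixed by
  -- `ε`.
  refine ⟨S, inferInstance, fun i => ⟨i.1, hS i.2⟩, fun i =>
    { toFun := fun p => ε * unop (s p i)
      map_add' := fun p q => by rw [map_add, Pi.add_apply, MulOpposite.unop_add, mul_add]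
      map_smul' := fun a p => by
        rw [map_smul, Pi.smul_apply, smul_eq_mul, unop_mul, ← mul_assoc]
        rfl }, fun i p => ?_, fun p => ?_⟩
  · change ε * (ε * _) = ε * _
    rw [← mul_assoc, hε]
  · have h1 : Fintype.linearCombination Λᵐᵒᵖ (fun s : S => (s : P)) (s p) = p :=
      LinearMap.congr_fun hs p
    conv_lhs => rw [← h1, Fintype.linearCombination_apply]
    refine Finset.sum_congr rfl fun i _ => ?_
    have hi : op ε • i.1 = i.1 := hS i.2
    change s p i • i.1 = op (ε * unop (s p i)) • i.1
    rw [op_mul, op_unop, mul_smul, hi]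

/-- Taking `ε`-parts is fully faithful on projectives generated by their `ε`-parts. -/
theorem cornerHom_bijective {P : Type w} [AddCommGroup P] [Module Λᵐᵒᵖ P]
    [Module.Finite Λᵐᵒᵖ P] [Module.Projective Λᵐᵒᵖ P] (h : IsGeneratedBy ε P) :
    Function.Bijective (cornerHom hε : (P →ₗ[Λᵐᵒᵖ] N) → _) := by
  refine ⟨fun f g hfg => h.hom_ext hε hfg, fun u => ?_⟩
  obtain ⟨ι, _, x, φ, hφ, hx⟩ := h.exists_dualBasis hε
  -- The extension of `u` is `p ↦ ∑ u(x i) φ i(p)`. For `p` in `P ε` the coefficients lie in the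
  -- corner, where `u` is linear, so it restricts to `u`.
  refine ⟨∑ i, rankOne (u (x i) : N) (φ i), LinearMap.ext fun p => Subtype.ext ?_⟩
  have hp : ∀ i, φ i p.1 * ε = φ i p.1 := fun i => by
    have : φ i (op ε • p.1) = φ i p.1 * ε := map_smul _ _ _
    rw [← this, cornerPart_smul]
  have h2 : p = ∑ i, op (cornerMk hε (φ i p.1) (hφ i _) (hp i)) • x i := by
    refine Subtype.ext ?_
    rw [AddSubgroup.val_finsetSum]
    exact hx p.1
  rw [coe_cornerHom, LinearMap.sum_apply]
  conv_rhs => rw [h2, map_sum, AddSubgroup.val_finsetSum]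
  refine Finset.sum_congr rfl fun i _ => ?_
  rw [map_smul]
  rfl

/-- A module with a finite dual basis is finitely generated and projective. -/
theorem finite_projective_of_dualBasis {R : Type*} [Ring R] {Q : Type*} [AddCommGroup Q]
    [Module Rᵐᵒᵖ Q] {ι : Type*} [Fintype ι] (x : ι → Q) (φ : ι → Q →ₗ[Rᵐᵒᵖ] R)
    (h : ∀ q, q = ∑ i, op (φ i q) • x i) :
    Module.Finite Rᵐᵒᵖ Q ∧ Module.Projective Rᵐᵒᵖ Q := by
  let s : Q →ₗ[Rᵐᵒᵖ] (ι → Rᵐᵒᵖ) :=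
    { toFun := fun q i => op (φ i q)
      map_add' := fun p q => funext fun i => by rw [map_add]; rfl
      map_smul' := fun a q => funext fun i => by rw [map_smul]; rfl }
  have hs : Fintype.linearCombination Rᵐᵒᵖ x ∘ₗ s = LinearMap.id :=
    LinearMap.ext fun q => (h q).symm
  refine ⟨Module.Finite.of_surjective (Fintype.linearCombination Rᵐᵒᵖ x) fun q =>
    ⟨s q, LinearMap.congr_fun hs q⟩, Module.Projective.of_split s _ hs⟩

/-- A dual basis with elements in `P ε` restricts to `P ε`: there its coefficients are fixed by `ε`
on both sides, so they lie in the corner. -/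
theorem IsGeneratedBy.finite_projective {P : Type w} [AddCommGroup P] [Module Λᵐᵒᵖ P]
    [Module.Finite Λᵐᵒᵖ P] [Module.Projective Λᵐᵒᵖ P] (h : IsGeneratedBy ε P) :
    Module.Finite hε.Cornerᵐᵒᵖ (cornerPart ε P) ∧
      Module.Projective hε.Cornerᵐᵒᵖ (cornerPart ε P) := by
  obtain ⟨ι, _, x, φ, hφ, hx⟩ := h.exists_dualBasis hε
  have hp : ∀ i (p : cornerPart ε P), φ i p.1 * ε = φ i p.1 := fun i p => by
    have : φ i (op ε • p.1) = φ i p.1 * ε := map_smul _ _ _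
    rw [← this, cornerPart_smul]
  refine finite_projective_of_dualBasis x (fun i =>
    { toFun := fun p => cornerMk hε (φ i p.1) (hφ i _) (hp i p)
      map_add' := fun p q => Subtype.ext (map_add (φ i) p.1 q.1)
      map_smul' := fun b p => Subtype.ext (map_smul (φ i) (op b.unop.1) p.1) }) fun p => ?_
  refine Subtype.ext ?_
  rw [AddSubgroup.val_finsetSum]
  exact hx p.1

/-- Every finitely generated projective module over the corner is the `ε`-part of a finitely
generated projective module which is generated by its `ε`-part. -/
theorem exists_cornerPart_equiv (Q : ProjCat hε.Corner) : ∃ P : ProjCat Λ,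
    IsGeneratedBy ε P.obj ∧ Nonempty (Q.obj ≃ₗ[hε.Cornerᵐᵒᵖ] cornerPart ε P.obj) := by
  obtain ⟨m, y, ψ, hψ⟩ := exists_dualBasis (Λ := hε.Corner) Q.obj
  have hψ' : ∀ i q, ∑ j, (ψ i (y j)).1 * (ψ j q).1 = (ψ i q).1 := fun i q => by
    have h1 : ψ i q = ∑ j, ψ i (y j) * ψ j q := by
      conv_lhs => rw [hψ q, map_sum]
      exact Finset.sum_congr rfl fun j _ => map_smul _ _ _
    exact ((congrArg (cornerVal hε) h1).trans (map_sum (cornerVal hε) _ _)).symm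
  -- The entries `ψ i (y j)` form an idempotent matrix over the corner, and `P` consists of the
  -- column vectors over `Λ` fixed by it. The columns `c j` and the coordinate functions are a dual
  -- basis of `P`; the columns lie in the `ε`-part, and `Q` is identified with the vectors whose
  -- entries are in the corner.
  let P : Submodule Λᵐᵒᵖ (Fin m → Λ) :=
    { carrier := {x | ∀ i, ∑ j, (ψ i (y j)).1 * x j = x i}
      zero_mem' := fun i => by simp
      add_mem' := fun {a b} ha hb i => by
        simp only [Pi.add_apply, mul_add, Finset.sum_add_distrib]
        rw [ha i, hb i]
      smul_mem' := fun c a ha i => by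
        change ∑ j, _ * (a j * c.unop) = a i * c.unop
        rw [← ha i, Finset.sum_mul]
        exact Finset.sum_congr rfl fun j _ => (mul_assoc _ _ _).symm }
  have hP : ∀ x : P, ∀ i, ∑ j, (ψ i (y j)).1 * x.1 j = x.1 i := fun x => x.2
  let c : Fin m → P := fun j => ⟨fun i => (ψ i (y j)).1, fun i => hψ' i (y j)⟩
  have hc : ∀ x : P, x = ∑ j, op (x.1 j) • c j := fun x => by
    refine Subtype.ext (funext fun i => ?_)
    rw [Submodule.coe_sum, Finset.sum_apply]
    exact (hP x i).symm
  obtain ⟨hP₁, hP₂⟩ := finite_projective_of_dualBasis c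
    (fun j => LinearMap.proj (φ := fun _ : Fin m => Λ) j ∘ₗ P.subtype) hc
  refine ⟨⟨ModuleCat.of Λᵐᵒᵖ P, hP₁, hP₂⟩, ?_, ?_⟩
  · refine eq_top_iff.2 fun x _ => ?_
    rw [hc x]
    refine Submodule.sum_mem _ fun j _ => Submodule.smul_mem _ _ (Submodule.subset_span ?_)
    exact Subtype.ext (funext fun i => corner_mul hε (ψ i (y j)))
  · let g : Q.obj →ₗ[hε.Cornerᵐᵒᵖ] cornerPart ε P :=
      { toFun := fun q => ⟨⟨fun i => (ψ i q).1, fun i => hψ' i q⟩,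
          Subtype.ext (funext fun i => corner_mul hε (ψ i q))⟩
        map_add' := fun p q => Subtype.ext (Subtype.ext (funext fun i =>
          congrArg (cornerVal hε) (map_add (ψ i) p q)))
        map_smul' := fun b q => Subtype.ext (Subtype.ext (funext fun i =>
          congrArg (cornerVal hε) (map_smul (ψ i) b q))) }
    have hg : ∀ q i, (g q).1.1 i = (ψ i q).1 := fun q i => rfl
    refine ⟨LinearEquiv.ofBijective g ⟨?_, ?_⟩⟩
    · rw [injective_iff_map_eq_zero]
      intro q hq
      rw [hψ q]
      refine Finset.sum_eq_zero fun i _ => ?_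
      have : ψ i q = 0 := Subtype.ext (by rw [← hg, hq]; rfl)
      rw [this]
      exact zero_smul hε.Cornerᵐᵒᵖ (y i)
    · intro x
      have hx1 : ∀ j, x.1.1 j * ε = x.1.1 j := fun j =>
        congrFun (congrArg Subtype.val (cornerPart_smul x)) j
      have hx2 : ∀ j, ε * x.1.1 j = x.1.1 j := fun j => by
        rw [← hP x.1 j, Finset.mul_sum]
        exact Finset.sum_congr rfl fun l _ => by rw [← mul_assoc, mul_corner]
      let b : Fin m → hε.Corner := fun j => cornerMk hε (x.1.1 j) (hx2 j) (hx1 j)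
      refine ⟨∑ j, op (b j) • y j, Subtype.ext (Subtype.ext (funext fun i => ?_))⟩
      rw [hg, map_sum, ← hP x.1 i]
      have : ∑ j, ψ i (op (b j) • y j) = ∑ j, ψ i (y j) * b j :=
        Finset.sum_congr rfl fun j _ => map_smul _ _ _
      rw [this]
      exact map_sum (cornerVal hε) _ _

end CornerModule

end SiltingCorner

/-! ### 2-term objects over a corner algebra and support. -/

namespace SiltingCorner

section Corner

variable {Λ : Type v} [Ring Λ] {ε : Λ}

/-- The `ε`-part of a projective module generated by it. -/
abbrev ProjCat.corner (hε : IsIdempotentElem ε) (P : ProjCat Λ) (h : IsGeneratedBy ε P.obj) :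
    ProjCat hε.Corner where
  obj := ModuleCat.of hε.Cornerᵐᵒᵖ (cornerPart ε P.obj)
  property := h.finite_projective hε

namespace TwoTerm

/-- Both terms are generated by their `ε`-parts. -/
structure IsGenerated (ε : Λ) (X : TwoTerm Λ) : Prop where
  gen₁ : IsGeneratedBy ε X.P₁.obj
  gen₀ : IsGeneratedBy ε X.P₀.obj

/-- The `ε`-part of a 2-term object. -/
abbrev corner (hε : IsIdempotentElem ε) (X : TwoTerm Λ) (h : X.IsGenerated ε) :
    TwoTerm hε.Corner where
  P₁ := X.P₁.corner hε h.gen₁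
  P₀ := X.P₀.corner hε h.gen₀
  d := cornerHom hε X.d

variable (hε : IsIdempotentElem ε) {X Y : TwoTerm Λ} (hX : X.IsGenerated ε)
  (hY : Y.IsGenerated ε)

/-- The `ε`-part of a commutative square. -/
abbrev Map.corner (a : Map X Y) : Map (X.corner hε hX) (Y.corner hε hY) where
  f₁ := cornerHom hε a.f₁
  f₀ := cornerHom hε a.f₀
  comm := by rw [← cornerHom_comp, a.comm, cornerHom_comp]

/-- Every map occurring in a square or a homotopy starts at a projective module generated by its
`ε`-part, where passing to `ε`-parts is bijective on maps. The comparisons of homotopies,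
isomorphisms and `ExtVanishes` rest on this fact. -/
theorem Map.corner_surjective (b : Map (X.corner hε hX) (Y.corner hε hY)) :
    ∃ a : Map X Y, a.corner hε hX hY = b := by
  obtain ⟨b₁, b₀, hb⟩ := b
  obtain ⟨a₁, rfl⟩ := (cornerHom_bijective hε (N := Y.P₁.obj) hX.gen₁).2 b₁
  obtain ⟨a₀, rfl⟩ := (cornerHom_bijective hε (N := Y.P₀.obj) hX.gen₀).2 b₀
  exact ⟨⟨a₁, a₀, hX.gen₁.hom_ext hε hb⟩, rfl⟩

theorem Map.homotopic_corner_iff {a b : Map X Y} :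
    (a.corner hε hX hY).Homotopic (b.corner hε hX hY) ↔ a.Homotopic b := by
  constructor
  · rintro ⟨h, h₁, h₀⟩
    obtain ⟨h, rfl⟩ := (cornerHom_bijective hε (N := Y.P₁.obj) hX.gen₀).2 h
    exact ⟨h, hX.gen₁.hom_ext hε h₁, hX.gen₀.hom_ext hε h₀⟩
  · rintro ⟨h, h₁, h₀⟩
    exact ⟨cornerHom hε h, congrArg (cornerHom hε) h₁, congrArg (cornerHom hε) h₀⟩

theorem isIsomorphic_corner_iff :
    (X.corner hε hX).IsIsomorphic (Y.corner hε hY) ↔ X.IsIsomorphic Y := by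
  rw [isIsomorphic_iff, isIsomorphic_iff]
  constructor
  · rintro ⟨a, b, h, h'⟩
    obtain ⟨a, rfl⟩ := Map.corner_surjective hε hX hY a
    obtain ⟨b, rfl⟩ := Map.corner_surjective hε hY hX b
    exact ⟨a, b, (Map.homotopic_corner_iff hε hX hX (a := b.comp a) (b := Map.id X)).1 h,
      (Map.homotopic_corner_iff hε hY hY (a := a.comp b) (b := Map.id Y)).1 h'⟩
  · rintro ⟨a, b, h, h'⟩
    exact ⟨a.corner hε hX hY, b.corner hε hY hX,
      (Map.homotopic_corner_iff hε hX hX (a := b.comp a) (b := Map.id X)).2 h,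
      (Map.homotopic_corner_iff hε hY hY (a := a.comp b) (b := Map.id Y)).2 h'⟩

theorem extVanishes_corner_iff :
    ExtVanishes (X.corner hε hX) (Y.corner hε hY) ↔ ExtVanishes X Y := by
  constructor
  · intro H f
    obtain ⟨h₁, h₀, h⟩ := H (cornerHom hε f)
    obtain ⟨h₁, rfl⟩ := (cornerHom_bijective hε (N := Y.P₁.obj) hX.gen₁).2 h₁
    obtain ⟨h₀, rfl⟩ := (cornerHom_bijective hε (N := Y.P₀.obj) hX.gen₀).2 h₀
    exact ⟨h₁, h₀, hX.gen₁.hom_ext hε h⟩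
  · intro H f
    obtain ⟨f, rfl⟩ := (cornerHom_bijective hε (N := Y.P₀.obj) hX.gen₁).2 f
    obtain ⟨h₁, h₀, h⟩ := H f
    exact ⟨cornerHom hε h₁, cornerHom hε h₀, congrArg (cornerHom hε) h⟩

theorem isZero_corner_iff : IsZero (X.corner hε hX).toK ↔ IsZero X.toK := by
  rw [isZero_toK_iff, isZero_toK_iff]
  constructor
  · intro h
    let E := LinearEquiv.ofBijective _ h
    obtain ⟨u, hu⟩ := (cornerHom_bijective hε (N := X.P₁.obj) hX.gen₀).2 E.symm.toLinearMap
    have h₁ : u ∘ₗ X.d = LinearMap.id := by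
      refine hX.gen₁.hom_ext hε ?_
      rw [cornerHom_comp, hu]
      exact LinearMap.ext fun x => E.symm_apply_apply x
    have h₀ : X.d ∘ₗ u = LinearMap.id := by
      refine hX.gen₀.hom_ext hε ?_
      rw [cornerHom_comp, hu]
      exact LinearMap.ext fun x => E.apply_symm_apply x
    exact Function.bijective_iff_has_inverse.2
      ⟨u, LinearMap.congr_fun h₁, LinearMap.congr_fun h₀⟩
  · rintro ⟨hi, hs⟩
    refine ⟨fun x y hxy => Subtype.ext (hi (congrArg Subtype.val hxy)), fun y => ?_⟩
    obtain ⟨x, hx⟩ := hs y.1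
    refine ⟨⟨op ε • x, smul_mem_cornerPart hε x⟩, Subtype.ext ?_⟩
    change X.d (op ε • x) = y.1
    rw [map_smul, hx, cornerPart_smul]

theorem IsGenerated.sum {m : ℕ} {X : Fin m → TwoTerm Λ} (h : ∀ i, (X i).IsGenerated ε) :
    (TwoTerm.sum X).IsGenerated ε :=
  ⟨IsGeneratedBy.pi fun i => (h i).gen₁, IsGeneratedBy.pi fun i => (h i).gen₀⟩

/-- The `ε`-part of a product. -/
def cornerPartPi {ι : Type*} (A : ι → Type*) [∀ i, AddCommGroup (A i)]
    [∀ i, Module Λᵐᵒᵖ (A i)] :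
    cornerPart ε (∀ i, A i) ≃ₗ[hε.Cornerᵐᵒᵖ] ∀ i, cornerPart ε (A i) where
  toFun x i := ⟨x.1 i, congrFun (cornerPart_smul x) i⟩
  invFun x := ⟨fun i => (x i).1, funext fun i => cornerPart_smul (x i)⟩
  map_add' _ _ := rfl
  map_smul' _ _ := rfl
  left_inv _ := rfl
  right_inv _ := rfl

theorem isIsomorphic_corner_sum {m : ℕ} {X : Fin m → TwoTerm Λ}
    (h : ∀ i, (X i).IsGenerated ε) : ((TwoTerm.sum X).corner hε (.sum h)).IsIsomorphic
      (TwoTerm.sum fun i => (X i).corner hε (h i)) :=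
  .of_equiv (X := (TwoTerm.sum X).corner hε (.sum h))
    (Y := TwoTerm.sum fun i => (X i).corner hε (h i))
    (cornerPartPi hε fun i => (X i).P₁.obj) (cornerPartPi hε fun i => (X i).P₀.obj) fun _ => rfl

theorem exists_corner_isIsomorphic (Z : TwoTerm hε.Corner) :
    ∃ (X : TwoTerm Λ) (hX : X.IsGenerated ε), (X.corner hε hX).IsIsomorphic Z := by
  obtain ⟨P₁, h₁, ⟨E₁⟩⟩ := exists_cornerPart_equiv hε Z.P₁
  obtain ⟨P₀, h₀, ⟨E₀⟩⟩ := exists_cornerPart_equiv hε Z.P₀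
  obtain ⟨d, hd⟩ := (cornerHom_bijective hε (N := P₀.obj) h₁).2
    (E₀.toLinearMap ∘ₗ Z.d ∘ₗ E₁.symm.toLinearMap)
  refine ⟨⟨P₁, P₀, d⟩, ⟨h₁, h₀⟩, .symm (.of_equiv E₁ E₀ fun x => ?_)⟩
  change cornerHom hε d (E₁ x) = E₀ (Z.d x)
  rw [hd]
  simp

/-- For all simple modules `S` with `S ε = 0`, the maps from `X` to `S` and to `S[1]` in the
homotopy category vanish. -/
def IsSupported (ε : Λ) (X : TwoTerm Λ) : Prop :=
  ∀ (S : Type v) [AddCommGroup S] [Module Λᵐᵒᵖ S] [IsSimpleModule Λᵐᵒᵖ S],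
    (∀ s : S, op ε • s = 0) →
      Function.Bijective fun h : X.P₀.obj →ₗ[Λᵐᵒᵖ] S => h ∘ₗ X.d

/-- Homotopies do not act on the kernel and the cokernel of `Hom(P₀, S) → Hom(P₁, S)`, so a retract
in the homotopy category induces genuine retracts of these. -/
theorem IsSupported.of_isRetract (h : X.IsSupported ε) (hYX : Y.IsRetract X) :
    Y.IsSupported ε := by
  obtain ⟨a, b, s, hs₁, hs₀⟩ := hYX
  intro S _ _ _ hS
  obtain ⟨hi, hsurj⟩ := h S hS
  have hs₁' : b.f₁ ∘ₗ a.f₁ = LinearMap.id + s ∘ₗ Y.d := hs₁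
  have hs₀' : b.f₀ ∘ₗ a.f₀ = LinearMap.id + Y.d ∘ₗ s := hs₀
  constructor
  · intro φ φ' hφ
    have hφ' : φ ∘ₗ Y.d = φ' ∘ₗ Y.d := hφ
    have h1 : φ ∘ₗ b.f₀ = φ' ∘ₗ b.f₀ := by
      apply hi
      simp only [LinearMap.comp_assoc, ← b.comm]
      rw [← LinearMap.comp_assoc, hφ', LinearMap.comp_assoc]
    have h2 := congrArg (· ∘ₗ a.f₀) h1
    simp only [LinearMap.comp_assoc, hs₀', LinearMap.comp_add, LinearMap.comp_id] at h2
    rw [← LinearMap.comp_assoc, ← LinearMap.comp_assoc, hφ'] at h2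
    exact add_right_cancel h2
  · intro ψ
    obtain ⟨φ, hφ⟩ := hsurj (ψ ∘ₗ b.f₁)
    have hφ' : φ ∘ₗ X.d = ψ ∘ₗ b.f₁ := hφ
    -- Subtracting `ψ ∘ s` removes the error by which `b ∘ a` differs from the identity.
    refine ⟨φ ∘ₗ a.f₀ - ψ ∘ₗ s, ?_⟩
    change (φ ∘ₗ a.f₀ - ψ ∘ₗ s) ∘ₗ Y.d = ψ
    rw [LinearMap.sub_comp, LinearMap.comp_assoc, ← a.comm, ← LinearMap.comp_assoc, hφ',
      LinearMap.comp_assoc, hs₁', LinearMap.comp_add, LinearMap.comp_id, LinearMap.comp_assoc,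
      add_sub_cancel_right]

theorem _root_.SiltingCorner.IsGeneratedBy.hom_eq_zero {M S : Type*} [AddCommGroup M]
    [Module Λᵐᵒᵖ M] [AddCommGroup S] [Module Λᵐᵒᵖ S] (h : IsGeneratedBy ε M)
    (hS : ∀ s : S, op ε • s = 0) (f : M →ₗ[Λᵐᵒᵖ] S) : f = 0 := by
  refine LinearMap.ext_on h fun m hm => ?_
  have hm' : op ε • m = m := hm
  rw [← hm', map_smul, hS, LinearMap.zero_apply]

/-- A finitely generated module without maps to the simple modules `S` with `S ε = 0` is generated
by its `ε`-part. -/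
theorem _root_.SiltingCorner.isGeneratedBy_of_forall {M : Type v} [AddCommGroup M]
    [Module Λᵐᵒᵖ M] [Module.Finite Λᵐᵒᵖ M] (hε : IsIdempotentElem ε)
    (h : ∀ (S : Type v) [AddCommGroup S] [Module Λᵐᵒᵖ S] [IsSimpleModule Λᵐᵒᵖ S],
      (∀ s : S, op ε • s = 0) → ∀ f : M →ₗ[Λᵐᵒᵖ] S, f = 0) : IsGeneratedBy ε M := by
  by_contra hne
  -- The quotient by a maximal submodule containing `M ε` is simple and annihilated by `ε`.
  obtain ⟨N, hN, hle⟩ := (eq_top_or_exists_le_coatom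
    (Submodule.span Λᵐᵒᵖ (cornerPart ε M : Set M))).resolve_left hne
  have : IsSimpleModule Λᵐᵒᵖ (M ⧸ N) := isSimpleModule_iff_isCoatom.2 hN
  have h0 := h (M ⧸ N) (fun s => by
    obtain ⟨m, rfl⟩ := N.mkQ_surjective s
    rw [← map_smul, ← LinearMap.mem_ker, Submodule.ker_mkQ]
    exact hle (Submodule.subset_span (smul_mem_cornerPart hε m))) N.mkQ
  apply hN.1
  rw [← Submodule.ker_mkQ N, h0, LinearMap.ker_zero]

theorem IsGenerated.isSupported (h : X.IsGenerated ε) : X.IsSupported ε := by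
  intro S _ _ _ hS
  refine ⟨fun f g _ => ?_, fun f => ⟨0, ?_⟩⟩
  · rw [h.gen₀.hom_eq_zero hS f, h.gen₀.hom_eq_zero hS g]
  · rw [h.gen₁.hom_eq_zero hS f]
    exact LinearMap.zero_comp _

/-- In the form `Y ⊕ (P → 0)` with `Y` a minimal presentation, the image of the differential is
superfluous and is killed by every map to a simple module. So `Hom(P₀, S) → Hom(P₁, S)` is zero;
being bijective when `S ε = 0`, it has zero source and target, and neither term maps nontrivially to
such an `S`. -/
theorem IsSupported.exists_isGenerated [IsArtinianRing Λᵐᵒᵖ] (hε : IsIdempotentElem ε)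
    (h : X.IsSupported ε) : ∃ Y : TwoTerm Λ, Y.IsGenerated ε ∧ X.IsIsomorphic Y := by
  obtain ⟨V, Y, π, hY, hXY⟩ := TauPair.exists_corresponds_of_twoTerm X
  refine ⟨_, ?_, hXY⟩
  have hW := h.of_isRetract hXY.symm.isRetract
  set W := Y.addShift V.P with hWdef
  have hd : IsSuperfluous (LinearMap.range W.d) := by
    refine hY.superfluous₀.mono ?_
    rintro _ ⟨x, rfl⟩
    exact hY.map_d x.1
  have key : ∀ (S : Type v) [AddCommGroup S] [Module Λᵐᵒᵖ S] [IsSimpleModule Λᵐᵒᵖ S]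
      (f : W.P₀.obj →ₗ[Λᵐᵒᵖ] S), f ∘ₗ W.d = 0 := by
    intro S _ _ _ f
    rw [← LinearMap.range_eq_bot, LinearMap.range_comp]
    -- The image of a superfluous submodule is superfluous, so it cannot be all of `S`.
    refine (eq_bot_or_eq_top _).resolve_right fun htop => ?_
    have := hd.map f ⊥ (by rw [htop, top_sup_eq])
    exact bot_ne_top this
  constructor
  · refine isGeneratedBy_of_forall hε fun S _ _ _ hS f => ?_
    obtain ⟨g, rfl⟩ := (hW S hS).2 f
    exact key S g
  · refine isGeneratedBy_of_forall hε fun S _ _ _ hS f => (hW S hS).1 ?_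
    change f ∘ₗ W.d = 0 ∘ₗ W.d
    rw [key, LinearMap.zero_comp]

/-- The 2-term object `Z` over the corner corresponds to the 2-term object `X`: it is isomorphic
to the `ε`-part of an object isomorphic to `X` which is generated by its `ε`-part. -/
def CornerCorresponds (X : TwoTerm Λ) (Z : TwoTerm hε.Corner) : Prop :=
  ∃ (Y : TwoTerm Λ) (hY : Y.IsGenerated ε), X.IsIsomorphic Y ∧ (Y.corner hε hY).IsIsomorphic Z

variable {hε} {X' : TwoTerm Λ} {Z Z' : TwoTerm hε.Corner}

theorem CornerCorresponds.isIsomorphic_iff (h : X.CornerCorresponds hε Z)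
    (h' : X'.CornerCorresponds hε Z') : X.IsIsomorphic X' ↔ Z.IsIsomorphic Z' := by
  obtain ⟨Y, hY, h₁, h₂⟩ := h
  obtain ⟨Y', hY', h₁', h₂'⟩ := h'
  have := isIsomorphic_corner_iff hε hY hY'
  exact ⟨fun H => (h₂.symm.trans (this.2 ((h₁.symm.trans H).trans h₁'))).trans h₂',
    fun H => (h₁.trans (this.1 ((h₂.trans H).trans h₂'.symm))).trans h₁'.symm⟩

theorem CornerCorresponds.of_isIsomorphic (h : X.CornerCorresponds hε Z)
    (hX : X.IsIsomorphic X') (hZ : Z.IsIsomorphic Z') : X'.CornerCorresponds hε Z' := by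
  obtain ⟨Y, hY, h₁, h₂⟩ := h
  exact ⟨Y, hY, hX.symm.trans h₁, h₂.trans hZ⟩

theorem CornerCorresponds.extVanishes_iff (h : X.CornerCorresponds hε Z)
    (h' : X'.CornerCorresponds hε Z') : ExtVanishes X X' ↔ ExtVanishes Z Z' := by
  obtain ⟨Y, hY, h₁, h₂⟩ := h
  obtain ⟨Y', hY', h₁', h₂'⟩ := h'
  rw [extVanishes_congr h₁ h₁', ← extVanishes_congr h₂ h₂', extVanishes_corner_iff]

theorem CornerCorresponds.isRigid_iff (h : X.CornerCorresponds hε Z) :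
    X.IsRigid ↔ Z.IsRigid := by
  rw [isRigid_iff_extVanishes, isRigid_iff_extVanishes, h.extVanishes_iff h]

theorem CornerCorresponds.isZero_iff (h : X.CornerCorresponds hε Z) :
    IsZero X.toK ↔ IsZero Z.toK := by
  obtain ⟨Y, hY, h₁, h₂⟩ := h
  rw [h₁.isZero_iff, ← h₂.isZero_iff, isZero_corner_iff]

theorem CornerCorresponds.sum {m : ℕ} {X : Fin m → TwoTerm Λ} {Z : Fin m → TwoTerm hε.Corner}
    (h : ∀ i, (X i).CornerCorresponds hε (Z i)) :
    (TwoTerm.sum X).CornerCorresponds hε (TwoTerm.sum Z) := by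
  choose Y hY h₁ h₂ using h
  exact ⟨TwoTerm.sum Y, .sum hY, .sum h₁, (isIsomorphic_corner_sum hε hY).trans (.sum h₂)⟩

variable (hε) in
theorem exists_cornerCorresponds (Z : TwoTerm hε.Corner) :
    ∃ X : TwoTerm Λ, X.CornerCorresponds hε Z := by
  obtain ⟨X, hX, h⟩ := exists_corner_isIsomorphic hε Z
  exact ⟨X, X, hX, .refl _, h⟩

theorem CornerCorresponds.isSupported (h : X.CornerCorresponds hε Z) : X.IsSupported ε := by
  obtain ⟨Y, hY, h₁, -⟩ := h
  exact hY.isSupported.of_isRetract h₁.isRetract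

theorem IsSupported.exists_cornerCorresponds [IsArtinianRing Λᵐᵒᵖ] (hε : IsIdempotentElem ε)
    (h : X.IsSupported ε) : ∃ Z : TwoTerm hε.Corner, X.CornerCorresponds hε Z := by
  obtain ⟨Y, hY, h₁⟩ := h.exists_isGenerated hε
  exact ⟨_, Y, hY, h₁, .refl _⟩

/-- Summands of `X` are retracts of `X`, hence again supported, and have partners over the corner.
So decompositions on the two sides match. -/
theorem CornerCorresponds.isIndecomposable_iff [IsArtinianRing Λᵐᵒᵖ]
    (h : X.CornerCorresponds hε Z) : X.IsIndecomposable ↔ Z.IsIndecomposable := by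
  have hsum : ∀ {X₁ X₂ : TwoTerm Λ} {Z₁ Z₂ : TwoTerm hε.Corner}, X₁.CornerCorresponds hε Z₁ →
      X₂.CornerCorresponds hε Z₂ →
      (TwoTerm.sum ![X₁, X₂]).CornerCorresponds hε (TwoTerm.sum ![Z₁, Z₂]) := fun h₁ h₂ =>
    CornerCorresponds.sum (by
      intro i
      fin_cases i
      · exact h₁
      · exact h₂)
  unfold IsIndecomposable
  rw [h.isZero_iff]
  refine and_congr_right fun _ => ⟨fun H Z₁ Z₂ hZ => ?_, fun H X₁ X₂ hX => ?_⟩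
  · obtain ⟨X₁, h₁⟩ := TwoTerm.exists_cornerCorresponds hε Z₁
    obtain ⟨X₂, h₂⟩ := TwoTerm.exists_cornerCorresponds hε Z₂
    rw [← h₁.isZero_iff, ← h₂.isZero_iff]
    exact H _ _ ((h.isIsomorphic_iff (hsum h₁ h₂)).2 hZ)
  · have hs : (TwoTerm.sum ![X₁, X₂]).IsSupported ε :=
      h.isSupported.of_isRetract hX.symm.isRetract
    obtain ⟨Z₁, h₁⟩ := (hs.of_isRetract (isRetract_sum ![X₁, X₂] 0)).exists_cornerCorresponds hε
    obtain ⟨Z₂, h₂⟩ := (hs.of_isRetract (isRetract_sum ![X₁, X₂] 1)).exists_cornerCorresponds hε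
    change X₁.CornerCorresponds hε Z₁ at h₁
    change X₂.CornerCorresponds hε Z₂ at h₂
    rw [h₁.isZero_iff, h₂.isZero_iff]
    exact H _ _ ((h.isIsomorphic_iff (hsum h₁ h₂)).1 hX)

end TwoTerm

/-- The 2-term silting complex of the corner `ε Λ ε` is isomorphic to the subcomplex of the 2-term
silting complex of `Λ` induced by the vertices supported on `ε`. -/
theorem siltingComplex_corner_isomorphic [IsArtinianRing Λᵐᵒᵖ] (hε : IsIdempotentElem ε) :
    (siltingComplex hε.Corner).Isomorphic
      ((siltingComplex Λ).induced {x | x.rep.IsSupported ε}) := by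
  choose X hX using fun z : SiltingVertex hε.Corner => TwoTerm.exists_cornerCorresponds hε z.rep
  let f₀ : SiltingVertex hε.Corner → SiltingVertex Λ := fun z => SiltingVertex.mk (X z)
    ((hX z).isIndecomposable_iff.2 z.isIndecomposable) ((hX z).isRigid_iff.2 z.isRigid)
  have hf₀ : ∀ z : SiltingVertex hε.Corner, (f₀ z).rep.CornerCorresponds hε z.rep := fun z =>
    (hX z).of_isIsomorphic (SiltingVertex.rep_mk _ _).symm (.refl _)
  let f : SiltingVertex hε.Corner → {x : SiltingVertex Λ | x.rep.IsSupported ε} := fun z =>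
    ⟨f₀ z, (hf₀ z).isSupported⟩
  have hinj : Function.Injective f := fun z z' hzz' => by
    have h : f₀ z = f₀ z' := congrArg Subtype.val hzz'
    exact SiltingVertex.ext (((hf₀ z).isIsomorphic_iff (hf₀ z')).1 (h ▸ .refl _))
  have hsurj : Function.Surjective f := fun x => by
    obtain ⟨Z, hZ⟩ := TwoTerm.IsSupported.exists_cornerCorresponds hε x.2
    let z : SiltingVertex hε.Corner := SiltingVertex.mk Z
      (hZ.isIndecomposable_iff.1 x.1.isIndecomposable) (hZ.isRigid_iff.1 x.1.isRigid)
    exact ⟨z, Subtype.ext (SiltingVertex.ext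
      (((hf₀ z).isIsomorphic_iff hZ).2 (SiltingVertex.rep_mk _ _)))⟩
  exact ⟨Equiv.ofBijective f ⟨hinj, hsurj⟩, (siltingComplex_isFlagFor _).mem_faces_iff_map
    ((siltingComplex_isFlagFor Λ).induced _) _
    fun z z' => ((hf₀ z).extVanishes_iff (hf₀ z')).symm⟩

end Corner

end SiltingCorner

/-! ### Primitive idempotents and multiplicities. -/

namespace SiltingCorner

section Local

variable {R : Type*} [Ring R] {A : Type*} [AddCommGroup A] [Module R A]

/-- In an indecomposable projective module of finite length, the proper submodules are
superfluous. -/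
theorem isSuperfluous_of_ne_top [IsNoetherian R A] [IsArtinian R A] [Module.Projective R A]
    (hA : ∀ N L : Submodule R A, IsCompl N L → N = ⊥ ∨ L = ⊥) {N : Submodule R A} (hN : N ≠ ⊤) :
    IsSuperfluous N := by
  intro L hL
  have hsurj : Function.Surjective (N.subtype.coprod L.subtype) := by
    rw [← LinearMap.range_eq_top, LinearMap.range_coprod, Submodule.range_subtype,
      Submodule.range_subtype, hL]
  -- A splitting of `N ⊕ L → A` writes the identity as `f + g` with `f` into `N` and `g` into `L`.
  obtain ⟨s, hs⟩ := Module.projective_lifting_property _ LinearMap.id hsurj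
  let f : Module.End R A := N.subtype ∘ₗ LinearMap.fst R N L ∘ₗ s
  let g : Module.End R A := L.subtype ∘ₗ LinearMap.snd R N L ∘ₗ s
  have hfg : f + g = 1 := hs
  have hf : ∀ x, f x ∈ N := fun x => (s x).1.2
  have hg : ∀ x, g x ∈ L := fun x => (s x).2.2
  -- Fitting's lemma: either some power of `f` is surjective, contradicting `N ≠ ⊤` (here `n ≥ 1`
  -- matters), or `f` is nilpotent, `g = 1 - f` is invertible and `L = ⊤`.
  obtain ⟨n, hn, hn1⟩ := (f.eventually_isCompl_ker_pow_range_pow.and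
    (Filter.eventually_ge_atTop 1)).exists
  rcases hA _ _ hn with h | h
  · exfalso
    apply hN
    rw [h] at hn
    have htop : LinearMap.range (f ^ n) = ⊤ := by simpa using hn.sup_eq_top
    rw [eq_top_iff, ← htop]
    rintro _ ⟨x, rfl⟩
    obtain ⟨m, rfl⟩ := Nat.exists_eq_add_of_le hn1
    rw [pow_add, pow_one]
    exact hf _
  · have hnil : IsNilpotent f := ⟨n, LinearMap.range_eq_bot.1 h⟩
    have hu : IsUnit g := by
      rw [← sub_eq_iff_eq_add'.2 hfg.symm]
      exact hnil.isUnit_one_sub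
    rw [eq_top_iff]
    intro x _
    obtain ⟨y, rfl⟩ := ((Module.End.isUnit_iff g).1 hu).2 x
    exact hg y

end Local

section Idempotent

variable {Λ : Type v} [Ring Λ] {e : Λ}

theorem mem_rightIdeal_iff (he : IsIdempotentElem e) {x : Λ} : x ∈ rightIdeal e ↔ e * x = x := by
  rw [Submodule.mem_span_singleton]
  constructor
  · rintro ⟨a, rfl⟩
    change e * (e * a.unop) = e * a.unop
    rw [← mul_assoc, he]
  · intro h
    exact ⟨op x, h⟩

theorem rightIdeal_mul (he : IsIdempotentElem e) (x : rightIdeal e) : e * x.1 = x.1 :=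
  (mem_rightIdeal_iff he).1 x.2

/-- The generator of `e Λ`. -/
def rightIdealGen (e : Λ) : rightIdeal e := ⟨e, Submodule.mem_span_singleton_self e⟩

theorem rightIdeal_eq_smul (he : IsIdempotentElem e) (x : rightIdeal e) :
    x = op x.1 • rightIdealGen e :=
  Subtype.ext (rightIdeal_mul he x).symm

theorem rightIdeal_finite_projective (he : IsIdempotentElem e) :
    Module.Finite Λᵐᵒᵖ (rightIdeal e) ∧ Module.Projective Λᵐᵒᵖ (rightIdeal e) :=
  finite_projective_of_dualBasis (fun _ : Unit => rightIdealGen e)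
    (fun _ => (rightIdeal e).subtype) fun q => by
      simpa using rightIdeal_eq_smul he q

theorem rightIdeal_isGeneratedBy {ε : Λ} (he : IsIdempotentElem e) (h : e * ε = e) :
    IsGeneratedBy ε (rightIdeal e) := by
  refine eq_top_iff.2 fun x _ => ?_
  rw [rightIdeal_eq_smul he x]
  exact Submodule.smul_mem _ _ (Submodule.subset_span (Subtype.ext h))

/-- The map `e Λ ⟶ M` given by `m : M`. -/
def rightIdealHom (e : Λ) {M : Type*} [AddCommGroup M] [Module Λᵐᵒᵖ M] (m : M) :
    rightIdeal e →ₗ[Λᵐᵒᵖ] M :=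
  rankOne m (rightIdeal e).subtype

theorem rightIdealHom_gen {M : Type*} [AddCommGroup M] [Module Λᵐᵒᵖ M] (m : M) :
    rightIdealHom e m (rightIdealGen e) = op e • m := rfl

/-- For a primitive idempotent `e`, the module `e Λ` is indecomposable. -/
theorem IsPrimitiveIdempotent.eq_bot_or (he : IsPrimitiveIdempotent e)
    (N L : Submodule Λᵐᵒᵖ (rightIdeal e)) (h : IsCompl N L) : N = ⊥ ∨ L = ⊥ := by
  -- Left multiplications by the components `a` and `b` of `e` are the projections to `N` and `L`,
  -- so `a` and `b` are orthogonal idempotents with sum `e`.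
  obtain ⟨a, ha, b, hb, hab⟩ := Submodule.mem_sup.1
    (show rightIdealGen e ∈ N ⊔ L by rw [h.sup_eq_top]; trivial)
  have hab' : a.1 + b.1 = e := congrArg Subtype.val hab
  have key : ∀ x : rightIdeal e, op x.1 • a + op x.1 • b = x := fun x => by
    rw [← smul_add, hab, ← rightIdeal_eq_smul he.idem]
  have hN : ∀ x ∈ N, op x.1 • a = x ∧ op x.1 • b = 0 := fun x hx => by
    have h1 : op x.1 • b ∈ N := by
      rw [← add_sub_cancel_left (op x.1 • a) (op x.1 • b), key]
      exact N.sub_mem hx (N.smul_mem _ ha)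
    have h2 : op x.1 • b = 0 :=
      Submodule.disjoint_def.1 h.disjoint _ h1 (L.smul_mem _ hb)
    exact ⟨by rw [← add_zero (op x.1 • a), ← h2, key], h2⟩
  have hL : ∀ x ∈ L, op x.1 • b = x ∧ op x.1 • a = 0 := fun x hx => by
    have h1 : op x.1 • a ∈ L := by
      rw [← add_sub_cancel_right (op x.1 • a) (op x.1 • b), key]
      exact L.sub_mem hx (L.smul_mem _ hb)
    have h2 : op x.1 • a = 0 :=
      Submodule.disjoint_def.1 h.disjoint _ (N.smul_mem _ ha) h1
    exact ⟨by rw [← zero_add (op x.1 • b), ← h2, key], h2⟩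
  rcases he.eq_zero_or a.1 b.1 (congrArg Subtype.val (hN a ha).1) (congrArg Subtype.val (hL b hb).1)
    (congrArg Subtype.val (hL b hb).2) (congrArg Subtype.val (hN a ha).2) hab' with h0 | h0
  · left
    rw [eq_bot_iff]
    intro x hx
    have ha0 : a = 0 := Subtype.ext h0
    rw [Submodule.mem_bot, ← (hN x hx).1, ha0, smul_zero]
  · right
    rw [eq_bot_iff]
    intro x hx
    have hb0 : b = 0 := Subtype.ext h0
    rw [Submodule.mem_bot, ← (hL x hx).1, hb0, smul_zero]

theorem IsPrimitiveIdempotent.isSuperfluous [IsArtinianRing Λᵐᵒᵖ] (he : IsPrimitiveIdempotent e)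
    {N : Submodule Λᵐᵒᵖ (rightIdeal e)} (hN : N ≠ ⊤) : IsSuperfluous N := by
  have := (rightIdeal_finite_projective he.idem).1
  have := (rightIdeal_finite_projective he.idem).2
  exact isSuperfluous_of_ne_top he.eq_bot_or hN

theorem IsPrimitiveIdempotent.nontrivial (he : IsPrimitiveIdempotent e) :
    Nontrivial (rightIdeal e) :=
  ⟨rightIdealGen e, 0, fun h => he.ne_zero (congrArg Subtype.val h)⟩

/-- A map from a projective module to a simple module `S` with `S e ≠ 0` lifts to a surjective map
to `e Λ`. -/
theorem IsPrimitiveIdempotent.exists_surjective [IsArtinianRing Λᵐᵒᵖ]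
    (he : IsPrimitiveIdempotent e) {P S : Type*} [AddCommGroup P] [Module Λᵐᵒᵖ P]
    [Module.Projective Λᵐᵒᵖ P] [AddCommGroup S] [Module Λᵐᵒᵖ S] [IsSimpleModule Λᵐᵒᵖ S]
    {f : P →ₗ[Λᵐᵒᵖ] S} (hf : Function.Surjective f) {s : S} (hs : op e • s ≠ 0) :
    ∃ h : P →ₗ[Λᵐᵒᵖ] rightIdeal e, Function.Surjective h := by
  have hne : rightIdealHom e s ≠ 0 := fun h0 =>
    hs (by rw [← rightIdealHom_gen, h0, LinearMap.zero_apply])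
  have hg : Function.Surjective (rightIdealHom e s) := LinearMap.surjective_of_ne_zero hne
  -- The range of the lift and the kernel of `e Λ → S` together are everything, and this kernel is
  -- proper, hence superfluous.
  obtain ⟨h, hh⟩ := Module.projective_lifting_property _ f hg
  refine ⟨h, ?_⟩
  rw [← LinearMap.range_eq_top]
  apply he.isSuperfluous (N := LinearMap.ker (rightIdealHom e s))
    (fun h => hne (LinearMap.ker_eq_top.1 h))
  rw [eq_top_iff]
  intro x _
  obtain ⟨p, hp⟩ := hf (rightIdealHom e s x)
  have : x = (x - h p) + h p := by abel
  rw [this]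
  refine Submodule.add_mem_sup ?_ ⟨p, rfl⟩
  rw [LinearMap.mem_ker, map_sub, sub_eq_zero, ← hp, ← hh, LinearMap.comp_apply]

end Idempotent

section System

variable {Λ : Type v} [Ring Λ] {n : ℕ} {e : Fin n → Λ}

/-- The simple top of `e i Λ`. -/
theorem IsBasicSystem.exists_simple [IsArtinianRing Λᵐᵒᵖ] (he : IsBasicSystem e) (i : Fin n) :
    ∃ N : Submodule Λᵐᵒᵖ (rightIdeal (e i)), IsCoatom N ∧
      ∀ j, j ≠ i → ∀ s : rightIdeal (e i) ⧸ N, op (e j) • s = 0 := by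
  have := (he.primitive i).nontrivial
  have hfi := rightIdeal_finite_projective (he.primitive i).idem
  have := hfi.1
  have := hfi.2
  obtain ⟨N, hN, -⟩ := (eq_top_or_exists_le_coatom
    (⊥ : Submodule Λᵐᵒᵖ (rightIdeal (e i)))).resolve_left bot_ne_top
  refine ⟨N, hN, fun j hj s => ?_⟩
  -- Otherwise `e i Λ` maps onto `e j Λ`. The surjection splits, so it is an isomorphism by
  -- indecomposability, which basicness excludes.
  by_contra hs
  have : IsSimpleModule Λᵐᵒᵖ (rightIdeal (e i) ⧸ N) := isSimpleModule_iff_isCoatom.2 hN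
  obtain ⟨h, hsurj⟩ := (he.primitive j).exists_surjective N.mkQ_surjective hs
  have hfj := (rightIdeal_finite_projective (he.primitive j).idem).2
  obtain ⟨t, ht⟩ := Module.projective_lifting_property h LinearMap.id hsurj
  have hc : IsCompl (LinearMap.ker h) (LinearMap.range t) := by
    have ht' : ∀ x, h (t x) = x := LinearMap.congr_fun ht
    refine IsCompl.of_eq (eq_bot_iff.2 ?_) (eq_top_iff.2 fun x _ => ?_)
    · rintro _ ⟨hx, ⟨y, rfl⟩⟩
      have hy : h (t y) = 0 := hx
      rw [Submodule.mem_bot, ← ht' y, hy, map_zero]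
    · rw [← sub_add_cancel x (t (h x))]
      exact Submodule.add_mem_sup (by simp [ht']) ⟨_, rfl⟩
  have hinj : LinearMap.ker h = ⊥ := by
    refine ((he.primitive i).eq_bot_or _ _ hc).resolve_right fun h0 => ?_
    have := (he.primitive j).nontrivial
    obtain ⟨x, hx⟩ := exists_ne (0 : rightIdeal (e j))
    apply hx
    rw [LinearMap.range_eq_bot] at h0
    rw [← LinearMap.id_apply (R := Λᵐᵒᵖ) x, ← ht, h0, LinearMap.comp_zero, LinearMap.zero_apply]
  exact hj (he.basic i j ⟨LinearEquiv.ofBijective h ⟨LinearMap.ker_eq_bot.1 hinj, hsurj⟩⟩).symm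

theorem IsBasicSystem.exists_smul_ne_zero (he : IsBasicSystem e) {S : Type*} [AddCommGroup S]
    [Module Λᵐᵒᵖ S] [Nontrivial S] : ∃ i, ∃ s : S, op (e i) • s ≠ 0 := by
  by_contra! h
  obtain ⟨s, hs⟩ := exists_ne (0 : S)
  apply hs
  rw [← one_smul Λᵐᵒᵖ s, ← op_one, ← he.complete.complete, Finset.op_sum, Finset.sum_smul]
  exact Finset.sum_eq_zero fun i _ => h i s

theorem hasMultiplicities_prod {P Q : ProjCat Λ} {a b : Fin n → ℕ}
    (hP : HasMultiplicities e P a) (hQ : HasMultiplicities e Q b) :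
    HasMultiplicities e (P.prod Q) fun i => a i + b i := by
  obtain ⟨f⟩ := hP
  obtain ⟨g⟩ := hQ
  let E : ∀ i, ((Fin (a i) → rightIdeal (e i)) × (Fin (b i) → rightIdeal (e i))) ≃ₗ[Λᵐᵒᵖ]
      (Fin (a i + b i) → rightIdeal (e i)) := fun i =>
    (LinearEquiv.sumArrowLequivProdArrow _ _ Λᵐᵒᵖ _).symm.trans
      (LinearEquiv.funCongrLeft Λᵐᵒᵖ _ finSumFinEquiv.symm)
  let E' : ((∀ i, Fin (a i) → rightIdeal (e i)) × (∀ i, Fin (b i) → rightIdeal (e i))) ≃ₗ[Λᵐᵒᵖ]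
      (∀ i, Fin (a i + b i) → rightIdeal (e i)) :=
    { toFun := fun x i => E i (x.1 i, x.2 i)
      invFun := fun y => (fun i => ((E i).symm (y i)).1, fun i => ((E i).symm (y i)).2)
      map_add' := fun x y => funext fun i => map_add (E i) (x.1 i, x.2 i) (y.1 i, y.2 i)
      map_smul' := fun c x => funext fun i => map_smul (E i) c (x.1 i, x.2 i)
      left_inv := fun x => by simp
      right_inv := fun y => by simp }
  exact ⟨(f.prodCongr g).trans E'⟩

theorem HasMultiplicities.congr {P Q : ProjCat Λ} {a : Fin n → ℕ} (h : HasMultiplicities e P a)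
    (f : Q.obj ≃ₗ[Λᵐᵒᵖ] P.obj) : HasMultiplicities e Q a :=
  h.map f.trans

/-- `e i Λ` as an object of `proj Λ`. -/
def IsBasicSystem.proj (he : IsBasicSystem e) (i : Fin n) : ProjCat Λ :=
  ⟨ModuleCat.of Λᵐᵒᵖ (rightIdeal (e i)), rightIdeal_finite_projective (he.primitive i).idem⟩

theorem IsBasicSystem.hasMultiplicities_proj (he : IsBasicSystem e) (i : Fin n) :
    HasMultiplicities e (he.proj i) (Pi.single i 1) := by
  refine ⟨(?_ : rightIdeal (e i) ≃ₗ[Λᵐᵒᵖ] _)⟩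
  exact
    { toFun := fun x j _ => Pi.single (M := fun j => rightIdeal (e j)) i x j
      invFun := fun y => y i ⟨0, by simp⟩
      map_add' := fun x y => funext fun j => funext fun _ => by rw [Pi.single_add]; rfl
      map_smul' := fun c x => funext fun j => funext fun _ => by rw [Pi.single_smul]; rfl
      left_inv := fun x => by simp
      right_inv := fun y => funext fun j => funext fun l => by
        by_cases hj : j = i
        · subst hj
          have : l = ⟨0, by simp⟩ := by
            have := l.2
            simp only [Pi.single_eq_same] at this
            exact Fin.ext (by simp; omega)
          simp [this]
        · have := l.2
          simp [Pi.single_eq_of_ne hj] at this }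

/-- Every finitely generated projective module is a direct sum of copies of the `e i Λ`. -/
theorem IsBasicSystem.exists_hasMultiplicities [IsArtinianRing Λᵐᵒᵖ] (he : IsBasicSystem e)
    (P : ProjCat Λ) : ∃ a, HasMultiplicities e P a := by
  -- Induction on the length: a simple quotient of `P` not annihilated by `e i` gives a surjection
  -- `P → e i Λ`, whose kernel is a shorter direct summand.
  obtain ⟨l, hl⟩ := ENat.ne_top_iff_exists.1 (Module.length_ne_top (R := Λᵐᵒᵖ) (M := P.obj))
  induction l using Nat.strong_induction_on generalizing P with
  | _ l ih =>
    rcases subsingleton_or_nontrivial P.obj with hP | hP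
    · refine ⟨fun _ => 0, ⟨⟨0, 0, fun x => ?_, fun x => ?_⟩⟩⟩
      · exact Subsingleton.elim _ _
      · exact Subsingleton.elim _ _
    · obtain ⟨N, hN, -⟩ := (eq_top_or_exists_le_coatom
        (⊥ : Submodule Λᵐᵒᵖ P.obj)).resolve_left bot_ne_top
      have : IsSimpleModule Λᵐᵒᵖ (P.obj ⧸ N) := isSimpleModule_iff_isCoatom.2 hN
      have := IsSimpleModule.nontrivial Λᵐᵒᵖ (P.obj ⧸ N)
      obtain ⟨i, s, hs⟩ := he.exists_smul_ne_zero (S := P.obj ⧸ N)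
      obtain ⟨h, hsurj⟩ := (he.primitive i).exists_surjective N.mkQ_surjective hs
      have := (rightIdeal_finite_projective (he.primitive i).idem).2
      obtain ⟨t, ht⟩ := Module.projective_lifting_property h LinearMap.id hsurj
      have ht' : ∀ x, h (t x) = x := LinearMap.congr_fun ht
      let q : P.obj →ₗ[Λᵐᵒᵖ] LinearMap.ker h := LinearMap.codRestrict _
        (LinearMap.id - t ∘ₗ h) fun x => by simp [ht']
      have hq : ∀ x, (q x : P.obj) = x - t (h x) := fun x => rfl
      have hqK : ∀ x : LinearMap.ker h, q x = x := fun x => Subtype.ext (by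
        rw [hq, LinearMap.mem_ker.1 x.2, map_zero, sub_zero])
      have hKp : Module.Projective Λᵐᵒᵖ (LinearMap.ker h) :=
        Module.Projective.of_split (LinearMap.ker h).subtype q (LinearMap.ext hqK)
      let K : ProjCat Λ := ⟨ModuleCat.of Λᵐᵒᵖ (LinearMap.ker h),
        inferInstanceAs (Module.Finite Λᵐᵒᵖ (LinearMap.ker h)), hKp⟩
      have hne : LinearMap.ker h ≠ ⊤ := fun h0 => by
        rw [LinearMap.ker_eq_top] at h0
        obtain ⟨x, hx⟩ := hsurj (rightIdealGen (e i))
        rw [h0] at hx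
        exact (he.primitive i).ne_zero (congrArg Subtype.val hx).symm
      have hlt : Module.length Λᵐᵒᵖ (LinearMap.ker h) < Module.length Λᵐᵒᵖ P.obj :=
        Submodule.length_lt hne
      obtain ⟨l', hl'⟩ := ENat.ne_top_iff_exists.1
        (Module.length_ne_top (R := Λᵐᵒᵖ) (M := LinearMap.ker h))
      rw [← hl, ← hl', Nat.cast_lt] at hlt
      obtain ⟨a, ha⟩ := ih l' hlt K hl'
      refine ⟨_, (hasMultiplicities_prod ha (he.hasMultiplicities_proj i)).congr
        (?_ : P.obj ≃ₗ[Λᵐᵒᵖ] LinearMap.ker h × rightIdeal (e i))⟩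
      exact LinearEquiv.ofLinearMap (q.prod h) ((LinearMap.ker h).subtype.coprod t)
        (LinearMap.ext fun x => Prod.ext
          (Subtype.ext (by simp [hq, ht']))
          (by simp [ht']))
        (LinearMap.ext fun x => by simp [hq])

end System

end SiltingCorner

/-! ### Dimensions of Hom spaces, `g`-vectors and support. -/

namespace SiltingCorner

section Dimension

variable {k : Type u} [Field k] {Λ : Type v} [Ring Λ] [Algebra k Λ] {n : ℕ} {e : Fin n → Λ}
  {S : Type*} [AddCommGroup S] [Module Λᵐᵒᵖ S] [Module k S] [IsScalarTower k Λᵐᵒᵖ S]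

theorem finite_hom (P : Type*) [AddCommGroup P] [Module Λᵐᵒᵖ P] [Module.Finite Λᵐᵒᵖ P]
    [Module.Finite k S] : Module.Finite k (P →ₗ[Λᵐᵒᵖ] S) := by
  obtain ⟨m, π, hπ⟩ := Module.Finite.exists_fin' Λᵐᵒᵖ P
  let F : (P →ₗ[Λᵐᵒᵖ] S) →ₗ[k] (Fin m → S) :=
    { toFun := fun f i => f (π (Pi.single i 1))
      map_add' := fun _ _ => rfl
      map_smul' := fun _ _ => rfl }
  refine Module.Finite.of_injective F fun f g hfg => ?_
  have h : f ∘ₗ π = g ∘ₗ π := LinearMap.pi_ext' fun i => LinearMap.ext_ring (congrFun hfg i)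
  refine LinearMap.ext fun p => ?_
  obtain ⟨x, rfl⟩ := hπ p
  exact LinearMap.congr_fun h x

variable (k) in
theorem finrank_hom_eq_sum {P : ProjCat Λ} {a : Fin n → ℕ} (h : HasMultiplicities e P a)
    [Module.Finite k S] :
    Module.finrank k (P.obj →ₗ[Λᵐᵒᵖ] S) =
      ∑ i, a i * Module.finrank k (rightIdeal (e i) →ₗ[Λᵐᵒᵖ] S) := by
  obtain ⟨f⟩ := h
  have hfin : ∀ i, Module.Finite k (rightIdeal (e i) →ₗ[Λᵐᵒᵖ] S) := fun i => finite_hom _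
  let E₁ : (P.obj →ₗ[Λᵐᵒᵖ] S) ≃ₗ[k] ((∀ i, Fin (a i) → rightIdeal (e i)) →ₗ[Λᵐᵒᵖ] S) :=
    { toFun := fun g => g ∘ₗ f.symm.toLinearMap
      invFun := fun g => g ∘ₗ f.toLinearMap
      map_add' := fun _ _ => rfl
      map_smul' := fun _ _ => rfl
      left_inv := fun g => LinearMap.ext fun x => by simp
      right_inv := fun g => LinearMap.ext fun x => by simp }
  let E₂ : (∀ i, Fin (a i) → (rightIdeal (e i) →ₗ[Λᵐᵒᵖ] S)) ≃ₗ[k]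
      ((∀ i, Fin (a i) → rightIdeal (e i)) →ₗ[Λᵐᵒᵖ] S) :=
    (LinearEquiv.piCongrRight fun i => LinearMap.lsum Λᵐᵒᵖ (fun _ : Fin (a i) =>
      rightIdeal (e i)) k).trans (LinearMap.lsum Λᵐᵒᵖ (fun i => Fin (a i) → rightIdeal (e i)) k)
  rw [(E₁.trans E₂.symm).finrank_eq, Module.finrank_pi_fintype]
  refine Finset.sum_congr rfl fun i _ => ?_
  rw [Module.finrank_pi_fintype, Finset.sum_const, Finset.card_univ, Fintype.card_fin,
    smul_eq_mul]

theorem finrank_rightIdeal_hom_eq_zero {e : Λ} (he : IsIdempotentElem e)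
    (h : ∀ s : S, op e • s = 0) : Module.finrank k (rightIdeal e →ₗ[Λᵐᵒᵖ] S) = 0 := by
  have : Subsingleton (rightIdeal e →ₗ[Λᵐᵒᵖ] S) := ⟨fun f g => by
    rw [(rightIdeal_isGeneratedBy he he).hom_eq_zero h f,
      (rightIdeal_isGeneratedBy he he).hom_eq_zero h g]⟩
  exact Module.finrank_zero_of_subsingleton

variable (k) in
/-- Composition with the differential. -/
def TwoTerm.precomp (X : TwoTerm Λ) (S : Type*) [AddCommGroup S] [Module Λᵐᵒᵖ S] [Module k S]
    [IsScalarTower k Λᵐᵒᵖ S] : (X.P₀.obj →ₗ[Λᵐᵒᵖ] S) →ₗ[k] (X.P₁.obj →ₗ[Λᵐᵒᵖ] S) where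
  toFun h := h ∘ₗ X.d
  map_add' _ _ := rfl
  map_smul' _ _ := rfl

/-- For a rigid object `P₁ ⟶ P₀` and a simple module `S`, the map `Hom(P₀, S) ⟶ Hom(P₁, S)` is
injective or surjective. -/
theorem TwoTerm.IsRigid.injective_or_surjective {X : TwoTerm Λ} (hX : X.IsRigid)
    [IsSimpleModule Λᵐᵒᵖ S] :
    Function.Injective (X.precomp k S) ∨ Function.Surjective (X.precomp k S) := by
  rw [or_iff_not_imp_left]
  intro hinj ψ
  rw [injective_iff_map_eq_zero] at hinj
  push Not at hinj
  obtain ⟨φ, hφ, hφ0⟩ := hinj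
  have hφ' : φ ∘ₗ X.d = 0 := hφ
  -- A nonzero `φ` with `φ ∘ d = 0` is onto `S`, so `ψ` lifts to a map `f` into `P₀`. Rigidity
  -- decomposes `f`, and `φ` kills the part through `d ∘ h₁`.
  obtain ⟨f, hf⟩ := Module.projective_lifting_property φ ψ (LinearMap.surjective_of_ne_zero hφ0)
  obtain ⟨h₁, h₀, h⟩ := TwoTerm.isRigid_iff_extVanishes.1 hX f
  refine ⟨φ ∘ₗ h₀, ?_⟩
  change (φ ∘ₗ h₀) ∘ₗ X.d = ψ
  have hzero : φ ∘ₗ X.d ∘ₗ h₁ = 0 := by rw [← LinearMap.comp_assoc, hφ', LinearMap.zero_comp]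
  rw [← hf, h, LinearMap.comp_add, hzero, zero_add, LinearMap.comp_assoc]

end Dimension

section GVector

variable {Λ : Type v} [Ring Λ] {n : ℕ} {e : Fin n → Λ} {J : Finset (Fin n)}

theorem finite_of_isSimpleModule (k : Type u) [Field k] [Algebra k Λ] [Module.Finite k Λ]
    (S : Type*) [AddCommGroup S] [Module Λᵐᵒᵖ S] [Module k S]
    [IsScalarTower k Λᵐᵒᵖ S] [IsSimpleModule Λᵐᵒᵖ S] : Module.Finite k S := by
  have : Module.Finite k Λᵐᵒᵖ :=
    Module.Finite.equiv (MulOpposite.opLinearEquiv k : Λ ≃ₗ[k] Λᵐᵒᵖ)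
  exact Module.Finite.trans Λᵐᵒᵖ S

theorem IsBasicSystem.mul_sum (he : IsBasicSystem e) {j : Fin n} (hj : j ∈ J) :
    e j * ∑ i ∈ J, e i = e j := by
  rw [Finset.mul_sum, Finset.sum_eq_single_of_mem j hj fun i _ hi =>
    he.complete.ortho hi.symm]
  exact he.complete.idem j

theorem IsBasicSystem.sum_mul (he : IsBasicSystem e) {j : Fin n} (hj : j ∈ J) :
    (∑ i ∈ J, e i) * e j = e j := by
  rw [Finset.sum_mul, Finset.sum_eq_single_of_mem j hj fun i _ hi => he.complete.ortho hi]
  exact he.complete.idem j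

/-- If the `g`-vector of a rigid object vanishes outside `J`, then the object is supported
on `J`. -/
theorem TwoTerm.HasGVector.isSupported (k : Type u) [Field k] [Algebra k Λ] [Module.Finite k Λ]
    (he : IsBasicSystem e) {X : TwoTerm Λ} (hX : X.IsRigid)
    {g : Fin n → ℤ} (hg : X.HasGVector e g) (hJ : ∀ i, i ∉ J → g i = 0) :
    X.IsSupported (∑ j ∈ J, e j) := by
  intro S _ _ _ hS
  let _ : Module k S := Module.compHom S (algebraMap k Λᵐᵒᵖ)
  have : IsScalarTower k Λᵐᵒᵖ S := IsScalarTower.of_algebraMap_smul fun _ _ => rfl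
  have := finite_of_isSimpleModule (Λ := Λ) k S
  obtain ⟨a, b, ha, hb, hab⟩ := hg
  -- For `i ∈ J` there are no nonzero maps from `e i Λ` to `S`; for the other `i` the multiplicities
  -- in `P₀` and `P₁` agree.
  have hdim : Module.finrank k (X.P₀.obj →ₗ[Λᵐᵒᵖ] S) =
      Module.finrank k (X.P₁.obj →ₗ[Λᵐᵒᵖ] S) := by
    rw [finrank_hom_eq_sum k ha, finrank_hom_eq_sum k hb]
    refine Finset.sum_congr rfl fun i _ => ?_
    by_cases hi : i ∈ J
    · rw [finrank_rightIdeal_hom_eq_zero (he.primitive i).idem, mul_zero, mul_zero]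
      intro s
      rw [← he.sum_mul hi, op_mul, mul_smul, hS, smul_zero]
    · have : (a i : ℤ) - b i = 0 := by rw [← hab, hJ i hi]
      rw [show a i = b i by omega]
  have := finite_hom (k := k) (Λ := Λ) (S := S) X.P₀.obj
  have := finite_hom (k := k) (Λ := Λ) (S := S) X.P₁.obj
  have hiff := LinearMap.injective_iff_surjective_of_finrank_eq_finrank
    (f := X.precomp k S) hdim
  change Function.Bijective (X.precomp k S)
  rcases hX.injective_or_surjective (k := k) (S := S) with h | h
  · exact ⟨h, hiff.1 h⟩
  · exact ⟨hiff.2 h, h⟩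

/-- The simple top `S` of `e i Λ` distinguishes the multiplicities of `e i Λ`. -/
theorem IsBasicSystem.exists_finrank_eq (k : Type u) [Field k] [Algebra k Λ] [Module.Finite k Λ]
    (he : IsBasicSystem e) (i : Fin n) :
    ∃ (S : Type v) (_ : AddCommGroup S) (_ : Module Λᵐᵒᵖ S) (_ : Module k S)
      (_ : IsScalarTower k Λᵐᵒᵖ S) (_ : IsSimpleModule Λᵐᵒᵖ S) (c : ℕ), 0 < c ∧
      (i ∉ J → ∀ s : S, op (∑ j ∈ J, e j) • s = 0) ∧
      ∀ (P : ProjCat Λ) (a : Fin n → ℕ), HasMultiplicities e P a →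
        Module.finrank k (P.obj →ₗ[Λᵐᵒᵖ] S) = a i * c := by
  have := isArtinianRing_op (Λ := Λ) k
  obtain ⟨S, _, _, hsimple, ⟨f, hf⟩, h⟩ : ∃ (S : Type v) (_ : AddCommGroup S)
      (_ : Module Λᵐᵒᵖ S), IsSimpleModule Λᵐᵒᵖ S ∧ (∃ f : rightIdeal (e i) →ₗ[Λᵐᵒᵖ] S, f ≠ 0) ∧
        ∀ j, j ≠ i → ∀ s : S, op (e j) • s = 0 := by
    obtain ⟨N, hN, h⟩ := he.exists_simple i
    exact ⟨rightIdeal (e i) ⧸ N, inferInstance, inferInstance, isSimpleModule_iff_isCoatom.2 hN,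
      ⟨N.mkQ, fun h0 => hN.1 (by rw [← Submodule.ker_mkQ N, h0, LinearMap.ker_zero])⟩, h⟩
  let _ : Module k S := Module.compHom S (algebraMap k Λᵐᵒᵖ)
  have hst : IsScalarTower k Λᵐᵒᵖ S := IsScalarTower.of_algebraMap_smul fun _ _ => rfl
  have := finite_of_isSimpleModule (Λ := Λ) k S
  -- The constant `c` is the dimension of `Hom(e i Λ, S)`, which need not be `1` over a general
  -- field; only its positivity matters.
  refine ⟨S, inferInstance, inferInstance, inferInstance, hst, hsimple,
    Module.finrank k (rightIdeal (e i) →ₗ[Λᵐᵒᵖ] S), ?_, ?_, ?_⟩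
  · have := finite_hom (k := k) (Λ := Λ) (S := S) (rightIdeal (e i))
    have : Nontrivial (rightIdeal (e i) →ₗ[Λᵐᵒᵖ] S) := ⟨f, 0, hf⟩
    exact Module.finrank_pos
  · intro hi s
    rw [Finset.op_sum, Finset.sum_smul]
    exact Finset.sum_eq_zero fun j hj => h j (fun hji => hi (hji ▸ hj)) s
  · intro P a ha
    rw [finrank_hom_eq_sum k ha]
    refine Finset.sum_eq_single_of_mem i (Finset.mem_univ i) fun j _ hj => ?_
    rw [finrank_rightIdeal_hom_eq_zero (he.primitive j).idem (h j hj), mul_zero]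

/-- The `g`-vector of an object supported on `J` vanishes outside `J`. -/
theorem TwoTerm.IsSupported.gVector_eq_zero (k : Type u) [Field k] [Algebra k Λ] [Module.Finite k Λ]
    (he : IsBasicSystem e) {X : TwoTerm Λ}
    (hX : X.IsSupported (∑ j ∈ J, e j)) {g : Fin n → ℤ} (hg : X.HasGVector e g) (i : Fin n)
    (hi : i ∉ J) : g i = 0 := by
  obtain ⟨S, _, _, _, _, _, c, hc, hS, hrank⟩ := he.exists_finrank_eq (J := J) k i
  obtain ⟨a, b, ha, hb, hab⟩ := hg
  have h := (LinearEquiv.ofBijective (X.precomp k S) (hX S (hS hi))).finrank_eq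
  rw [hrank _ _ ha, hrank _ _ hb] at h
  rw [hab, Nat.eq_of_mul_eq_mul_right hc h, sub_self]

/-- Rigidity enters in the direction from `g`-vectors to support, to exclude cancellation: the zero
map `e i Λ → e i Λ` with `i ∉ J` has `g`-vector zero but is not supported on `J`. -/
theorem TwoTerm.isSupported_iff_exists_gVector (k : Type u) [Field k] [Algebra k Λ]
    [Module.Finite k Λ]
    (he : IsBasicSystem e) {X : TwoTerm Λ}
    (hX : X.IsRigid) : X.IsSupported (∑ j ∈ J, e j) ↔
      ∃ g : Fin n → ℤ, X.HasGVector e g ∧ ∀ i, i ∉ J → g i = 0 := by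
  have := isArtinianRing_op (Λ := Λ) k
  constructor
  · intro h
    obtain ⟨a, ha⟩ := he.exists_hasMultiplicities X.P₀
    obtain ⟨b, hb⟩ := he.exists_hasMultiplicities X.P₁
    have hg : X.HasGVector e fun i => (a i : ℤ) - b i := ⟨a, b, ha, hb, fun _ => rfl⟩
    exact ⟨_, hg, h.gVector_eq_zero k he hg⟩
  · rintro ⟨g, hg, hJ⟩
    exact hg.isSupported k he hX hJ

/-- For `i ∉ J` the top of `e i Λ` is annihilated by `e_J`, so it receives no nonzero map from a
module generated by its `e_J`-part; this forces multiplicity zero. Conversely `e j = e j * e_J` for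
`j ∈ J`, so the generator of `e j Λ` lies in the `e_J`-part. -/
theorem isGeneratedBy_iff_hasMultiplicities (k : Type u) [Field k] [Algebra k Λ] [Module.Finite k Λ]
    (he : IsBasicSystem e) (P : ProjCat Λ) :
    IsGeneratedBy (∑ j ∈ J, e j) P.obj ↔
      ∃ a : Fin n → ℕ, HasMultiplicities e P a ∧ ∀ i, i ∉ J → a i = 0 := by
  have := isArtinianRing_op (Λ := Λ) k
  constructor
  · intro h
    obtain ⟨a, ha⟩ := he.exists_hasMultiplicities P
    refine ⟨a, ha, fun i hi => ?_⟩
    obtain ⟨S, _, _, _, _, _, c, hc, hS, hrank⟩ := he.exists_finrank_eq (J := J) k i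
    have hsub : Subsingleton (P.obj →ₗ[Λᵐᵒᵖ] S) := ⟨fun f g => by
      rw [h.hom_eq_zero (hS hi) f, h.hom_eq_zero (hS hi) g]⟩
    have h0 : Module.finrank k (P.obj →ₗ[Λᵐᵒᵖ] S) = 0 := Module.finrank_zero_of_subsingleton
    rw [hrank P a ha] at h0
    exact (Nat.mul_eq_zero.1 h0).resolve_right hc.ne'
  · rintro ⟨a, ⟨f⟩, ha⟩
    refine IsGeneratedBy.map (M := ∀ i, Fin (a i) → rightIdeal (e i))
      (IsGeneratedBy.pi fun i => IsGeneratedBy.pi fun l => ?_) f.symm.surjective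
    by_cases hi : i ∈ J
    · exact rightIdeal_isGeneratedBy (he.primitive i).idem (he.mul_sum hi)
    · have hl := l.2
      have h0 := ha i hi
      omega

theorem TwoTerm.isSupportedOn_iff_isGenerated (k : Type u) [Field k] [Algebra k Λ]
    [Module.Finite k Λ]
    (he : IsBasicSystem e) (X : TwoTerm Λ) :
    X.IsSupportedOn e J ↔ X.IsGenerated (∑ j ∈ J, e j) := by
  unfold TwoTerm.IsSupportedOn
  rw [← isGeneratedBy_iff_hasMultiplicities k he, ← isGeneratedBy_iff_hasMultiplicities k he]
  exact ⟨fun h => ⟨h.2, h.1⟩, fun h => ⟨h.2, h.1⟩⟩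

theorem siltingVerticesOn_eq (k : Type u) [Field k] [Algebra k Λ] [Module.Finite k Λ]
    (he : IsBasicSystem e) :
    siltingVerticesOn e J = {x | x.rep.IsSupported (∑ j ∈ J, e j)} := by
  ext x
  exact (TwoTerm.isSupported_iff_exists_gVector k he x.isRigid).symm

theorem siltingVerticesSupportedOn_eq (k : Type u) [Field k] [Algebra k Λ] [Module.Finite k Λ]
    (he : IsBasicSystem e) :
    siltingVerticesSupportedOn e J = {x | x.rep.IsSupported (∑ j ∈ J, e j)} := by
  have := isArtinianRing_op (Λ := Λ) k
  ext x
  constructor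
  · rintro ⟨Y, hY, hxY⟩
    rw [TwoTerm.isSupportedOn_iff_isGenerated k he] at hY
    exact hY.isSupported.of_isRetract hxY.isRetract
  · intro h
    obtain ⟨Y, hY, hxY⟩ := TwoTerm.IsSupported.exists_isGenerated
      he.complete.toOrthogonalIdempotents.isIdempotentElem_sum h
    exact ⟨Y, (TwoTerm.isSupportedOn_iff_isGenerated k he Y).2 hY, hxY⟩

/-- The `g`-vector of a `τ`-rigid pair vanishes outside `J` if and only if the corresponding
2-term object is supported on `J`. -/
theorem TauPair.Corresponds.exists_gVector_iff {k : Type u} [Field k] [Algebra k Λ]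
    [Module.Finite k Λ]
    (he : IsBasicSystem e) {V : TauPair Λ}
    {X : TwoTerm Λ} (h : V.Corresponds X) (hV : V.IsRigid k) :
    (∃ g : Fin n → ℤ, V.HasGVector e g ∧ ∀ i, i ∉ J → g i = 0) ↔
      X.IsSupported (∑ j ∈ J, e j) := by
  have := isArtinianRing_op (Λ := Λ) k
  constructor
  · rintro ⟨g, ⟨Y, π, hY, a, b, c, ha, hb, hc, hg⟩, hJ⟩
    -- The presentation used for the `g`-vector may differ from the one behind `h`. In degree `-1`
    -- of the resulting object the multiplicities of `P₁` and `P` add up, so it has the `g`-vector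
    -- of the pair.
    have h' : V.Corresponds (Y.addShift V.P) := ⟨Y, π, hY, .refl _⟩
    have hg' : (Y.addShift V.P).HasGVector e g :=
      ⟨a, _, ha, hasMultiplicities_prod hb hc, fun i => by rw [hg]; push_cast; ring⟩
    exact (hg'.isSupported k he ((h'.isRigid_iff k).1 hV) hJ).of_isRetract
      (h.isIsomorphic h' ⟨⟨.refl _ _⟩, ⟨.refl _ _⟩⟩).isRetract
  · intro hX
    obtain ⟨Y, π, hY, hXY⟩ := h
    have hW := hX.of_isRetract hXY.symm.isRetract
    obtain ⟨a, ha⟩ := he.exists_hasMultiplicities Y.P₀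
    obtain ⟨b, hb⟩ := he.exists_hasMultiplicities Y.P₁
    obtain ⟨c, hc⟩ := he.exists_hasMultiplicities V.P
    have hg' : (Y.addShift V.P).HasGVector e fun i => (a i : ℤ) - b i - c i :=
      ⟨a, _, ha, hasMultiplicities_prod hb hc, fun i => by push_cast; ring⟩
    exact ⟨_, ⟨Y, π, hY, a, b, c, ha, hb, hc, fun _ => rfl⟩, hW.gVector_eq_zero k he hg'⟩

end GVector

end SiltingCorner

/-! ### The main theorem. -/

theorem theorem1p1 (k : Type u) [Field k] (Λ : Type v) [Ring Λ] [Algebra k Λ]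
    [Module.Finite k Λ] {n : ℕ} (e : Fin n → Λ) (he : SiltingCorner.IsBasicSystem e)
    (J : Finset (Fin n)) (hJ : J.Nonempty) :
    -- the support `τ`-tilting complexes and their dual graphs
    ((SiltingCorner.tauTiltingComplex
        (SiltingCorner.CornerAlgebra he.complete.toOrthogonalIdempotents J) k).Isomorphic
      ((SiltingCorner.tauTiltingComplex Λ k).induced (SiltingCorner.tauVerticesOn e J k)) ∧
    Nonempty ((SiltingCorner.tauTiltingComplex
        (SiltingCorner.CornerAlgebra he.complete.toOrthogonalIdempotents J) k).dualGraph ≃g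
      ((SiltingCorner.tauTiltingComplex Λ k).induced
        (SiltingCorner.tauVerticesOn e J k)).dualGraph)) ∧
    -- the 2-term silting complexes and their dual graphs
    ((SiltingCorner.siltingComplex
        (SiltingCorner.CornerAlgebra he.complete.toOrthogonalIdempotents J)).Isomorphic
      ((SiltingCorner.siltingComplex Λ).induced (SiltingCorner.siltingVerticesOn e J)) ∧
    Nonempty ((SiltingCorner.siltingComplex
        (SiltingCorner.CornerAlgebra he.complete.toOrthogonalIdempotents J)).dualGraph ≃g
      ((SiltingCorner.siltingComplex Λ).induced
        (SiltingCorner.siltingVerticesOn e J)).dualGraph)) ∧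
    -- the two descriptions of the vertices of the induced 2-term silting complex agree
    SiltingCorner.siltingVerticesOn e J = SiltingCorner.siltingVerticesSupportedOn e J := by
  open SiltingCorner in
  have := isArtinianRing_op (Λ := Λ) k
  have hs : (siltingComplex (CornerAlgebra he.complete.toOrthogonalIdempotents J)).Isomorphic
      ((siltingComplex Λ).induced (siltingVerticesOn e J)) := by
    rw [siltingVerticesOn_eq k he]
    exact siltingComplex_corner_isomorphic _
  have ht : (tauTiltingComplex
      (CornerAlgebra he.complete.toOrthogonalIdempotents J) k).Isomorphic
      ((tauTiltingComplex Λ k).induced (tauVerticesOn e J k)) := by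
    -- The passage is through the silting complexes of both algebras; over `Λ` the bijection `ψ`
    -- must also match the vertices selected by their `g`-vectors.
    obtain ⟨φ, -, hφ⟩ := exists_tauVertex_equiv_siltingVertex
      (CornerAlgebra he.complete.toOrthogonalIdempotents J) k
    obtain ⟨ψ, hψ, hψ'⟩ := exists_tauVertex_equiv_siltingVertex Λ k
    have h1 : (tauTiltingComplex
        (CornerAlgebra he.complete.toOrthogonalIdempotents J) k).Isomorphic
        (siltingComplex (CornerAlgebra he.complete.toOrthogonalIdempotents J)) := ⟨φ, hφ⟩
    refine (h1.trans hs).trans (AbstractSimplicialComplex.Isomorphic.induced ψ hψ' ?_).symm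
    intro x
    rw [siltingVerticesOn_eq k he]
    exact (hψ x).exists_gVector_iff he x.isRigid
  exact ⟨⟨ht, ht.nonempty_dualGraph_iso⟩, ⟨hs, hs.nonempty_dualGraph_iso⟩,
    (siltingVerticesOn_eq k he).trans (siltingVerticesSupportedOn_eq k he).symm⟩
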